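/- Let $M$ be a simply connected smooth finite-dimensional manifold without boundary, $G$ a connected finite-dimensional Lie group with Lie algebra $\mathfrak g$, and $\pi:P\to M$ a smooth principal $G$-bundle with a flat smooth connection $A$ ($F=0$). Let $n\ge 1$, and let $B$ be a smooth $\mathfrak g$-valued $(n+1)$-form on $M$ transforming in the adjoint representation: for each frame $p\in P$ it has a value $B_p\in\Lambda^{n+1}T^*_{\pi(p)}M\otimes\mathfrak g$, with $B_{p\cdot g}=\mathrm{Ad}(g^{-1})B_p$. Fix $p_0\in P$ and $x_0=\pi(p_0)$. For $x\in M$ let $B^W(x)=W^{-1}B(x)W$ be the value of $B$ in the frame over $x$ obtained from $p_0$ by parallel transport with $A$ along a path from $x_0$ to $x$ (independent of the path). Let $\Omega^n(M,x_0)$ be the space of smooth maps $N:[0,2\pi]^n\to M$, $\sigma\mapsto x(\sigma)$, that send the boundary of the cube to $x_0$. A tangent vector of it at $N$ is a smooth vector field $X$ along $N$ (not necessarily tangential to $N$) vanishing on the boundary of the cube. Let $\mathcal A$ be the connection on $\Omega^n(M,x_0)$ given by $$\mathcal A_N(X)=\int_N\iota_XB^W=\int_{[0,2\pi]^n}B^W(x(\sigma))\Bigl(X(\sigma),\tfrac{\partial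 x}{\partial\sigma^1},\dots,\tfrac{\partial x}{\partial\sigma^n}\Bigr)\,d^n\sigma .$$ * $\mathcal A$ is *curvature local* if the nonlocal commutator term of its curvature $\mathcal F(X,Y)=\int_N W^{-1}(\iota_Y\iota_XD_AB)W+\bigl[\int_N\iota_XB^W,\int_N\iota_YB^W\bigr]$ vanishes, that is, $\bigl[\int_N\iota_XB^W,\int_N\iota_YB^W\bigr]=0$ for all $N\in\Omega^n(M,x_0)$ and all tangent vectors $X,Y$ at $N$. * A loop in $\Omega^n(M,x_0)$ is a smooth map $\Gamma:[0,2\pi]^n\times[0,2\pi]\to M$ with $\Gamma(\cdot,\tau)\in\Omega^n(M,x_0)$ for all $\tau$ and $\Gamma(\cdot,0)=\Gamma(\cdot,2\pi)$. Its holonomy is $\mathrm{hol}(\Gamma)=\mathcal W(2\pi)\in G$, where $\frac{d\mathcal W}{d\tau}+\mathcal A_{\Gamma(\cdot,\tau)}(\partial_\tau\Gamma)\,\mathcal W=0$ and $\mathcal W(0)=1$. $\mathcal A$ is *r-flat* if $\mathrm{hol}(\Gamma\circ h)=\mathrm{hol}(\Gamma)$ for every such $\Gamma$ and every diffeomorphism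 $h$ of $[0,2\pi]^{n+1}$ that is the identity on the boundary and is connected to the identity by a smooth isotopy through such diffeomorphisms. **Theorem.** $\mathcal A$ is curvature local if and only if it is r-flat. Moreover each of these two conditions is equivalent to $$[B^W_{\omega\mu_1\cdots\mu_n}(x),\,B^W_{\rho\nu_1\cdots\nu_n}(x')]=0\quad\text{for all }x,x'\in M\text{ and all indices},$$ and to the condition that $[\iota_{X}B^W(x(\sigma)),\iota_{Y}B^W(x(\sigma'))]=0$ along every $N\in\Omega^n(M,x_0)$, for all $\sigma,\sigma'\in[0,2\pi]^n$, $X\in T_{x(\sigma)}M$, $Y\in T_{x(\sigma')}M$. (Here $\iota_XB^W(x(\sigma))$ denotes the coefficient $B^W(x(\sigma))(X,\partial_{\sigma^1}x,\dots,\partial_{\sigma^n}x)$.) -/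

import Mathlib

open Set Manifold
open scoped ContDiff

noncomputable section

namespace LoopSpace

/-- The model space of an `m`-dimensional manifold. Mathlib's `TangentSpace (𝓡 m) x` is, by
definition, a copy of it. -/
abbrev E (m : ℕ) : Type := EuclideanSpace ℝ (Fin m)

/-- The underlying normed vector space of the Lie algebra `T₁G` of a `k`-dimensional Lie group. -/
abbrev LieAlg (k : ℕ) (G : Type*) [TopologicalSpace G] [ChartedSpace (E k) G] [Group G] : Type :=
  E k

section LieGroup

variable {k : ℕ} (G : Type*) [TopologicalSpace G] [ChartedSpace (E k) G] [Group G]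

/-- The Lie bracket of `T₁G` (Mathlib's bracket on `GroupLieAlgebra`, from left-invariant vector
fields). -/
def bracket (ξ η : LieAlg k G) : LieAlg k G :=
  Bracket.bracket (L := GroupLieAlgebra (𝓡 k) G) (M := GroupLieAlgebra (𝓡 k) G) ξ η

variable {G}

/-- The adjoint action of `G` on its Lie algebra: the derivative at `1` of `h ↦ g h g⁻¹`. -/
def Ad (g : G) (ξ : LieAlg k G) : LieAlg k G :=
  mfderiv (𝓡 k) (𝓡 k) (fun h : G => g * h * g⁻¹) 1 ξ

/-- The tangent vector `ξ g` at `g`: the image of `ξ ∈ T₁G` under right multiplication by `g`. -/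
def rightTranslate (ξ : LieAlg k G) (g : G) : TangentSpace (𝓡 k) g :=
  mfderiv (𝓡 k) (𝓡 k) (fun h : G => h * g) 1 ξ

/-- `W` solves `dW/dτ + a(τ) W = 0` on `[0, 2π]` with `W(0) = 1`. -/
def IsWilsonLine (a : ℝ → LieAlg k G) (W : ℝ → G) : Prop :=
  W 0 = 1 ∧ ∀ τ ∈ Icc 0 (2 * Real.pi),
    HasMFDerivWithinAt 𝓘(ℝ, ℝ) (𝓡 k) W (Icc 0 (2 * Real.pi)) τ
      (ContinuousLinearMap.toSpanSingleton ℝ (-rightTranslate (a τ) (W τ)))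

open Classical in
/-- `W(2π)`, where `W` is the solution of `dW/dτ + a(τ) W = 0`, `W(0) = 1`. -/
def holonomy (a : ℝ → LieAlg k G) : G :=
  if h : ∃ W : ℝ → G, IsWilsonLine a W then h.choose (2 * Real.pi) else 1

end LieGroup

section Bundle

variable {m k : ℕ}
  {M : Type*} [TopologicalSpace M] [ChartedSpace (E m) M]
  (G : Type*) [TopologicalSpace G] [ChartedSpace (E k) G] [Group G]
  {P : Type*} [TopologicalSpace P] [ChartedSpace (ModelProd (E m) (E k)) P] [MulAction Gᵐᵒᵖ P]

variable (m k) in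
/-- `proj : P → M` is a smooth principal `G`-bundle; the right action `p · g` is
`MulOpposite.op g • p`. -/
structure IsPrincipalBundle (proj : P → M) : Prop where
  smooth_proj : ContMDiff ((𝓡 m).prod (𝓡 k)) (𝓡 m) ∞ proj
  smooth_action : ContMDiff (((𝓡 m).prod (𝓡 k)).prod (𝓡 k)) ((𝓡 m).prod (𝓡 k)) ∞
    (fun z : P × G => MulOpposite.op z.2 • z.1)
  proj_action : ∀ (p : P) (g : G), proj (MulOpposite.op g • p) = proj p
  locally_trivial : ∀ x : M, ∃ U : Set M, IsOpen U ∧ x ∈ U ∧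
    ∃ e : OpenPartialHomeomorph P (M × G),
      e.source = proj ⁻¹' U ∧ e.target = U ×ˢ univ ∧
      ContMDiffOn ((𝓡 m).prod (𝓡 k)) ((𝓡 m).prod (𝓡 k)) ∞ e e.source ∧
      ContMDiffOn ((𝓡 m).prod (𝓡 k)) ((𝓡 m).prod (𝓡 k)) ∞ e.symm e.target ∧
      ∀ p ∈ e.source, (e p).1 = proj p ∧
        ∀ g : G, e (MulOpposite.op g • p) = ((e p).1, (e p).2 * g)

variable (m P) in
/-- The inverse of the preferred chart of `P` at `p`, as a map from the model vector space. -/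
def chartInv (p : P) : E m × E k → P := (extChartAt ((𝓡 m).prod (𝓡 k)) p).symm

variable (m P) in
/-- The (open) image in the model vector space of the preferred chart of `P` at `p`. -/
def chartImage (p : P) : Set (E m × E k) := (extChartAt ((𝓡 m).prod (𝓡 k)) p).target

/-- The derivative of the inverse of the preferred chart of `P` at `p`. -/
def chartInvDeriv (p : P) (z : E m × E k) :
    (E m × E k) →L[ℝ] TangentSpace ((𝓡 m).prod (𝓡 k)) (chartInv m P p z) :=
  mfderiv 𝓘(ℝ, E m × E k) ((𝓡 m).prod (𝓡 k)) (chartInv m P p) z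

/-- A `𝔤`-valued `1`-form on `P`. -/
abbrev OneForm (m k : ℕ) (G P : Type*) [TopologicalSpace G] [ChartedSpace (E k) G] [Group G]
    [TopologicalSpace P] [ChartedSpace (ModelProd (E m) (E k)) P] :=
  ∀ p : P, TangentSpace ((𝓡 m).prod (𝓡 k)) p →L[ℝ] LieAlg k G

variable {G}

/-- The expression of a `1`-form in the preferred chart at `p`: its pullback along the inverse of
the chart. -/
def OneForm.inChart (α : OneForm m k G P) (p : P) (z : E m × E k) :
    (E m × E k) →L[ℝ] LieAlg k G :=
  (α (chartInv m P p z)).comp (chartInvDeriv p z)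

variable (m k G P) in
/-- A (principal) connection on `P`, as a `𝔤`-valued `1`-form: smooth, reproducing the generators
of the vertical vector fields, and equivariant. -/
structure Connection where
  form : OneForm m k G P
  smooth : ∀ p : P, ContDiffOn ℝ ∞ (OneForm.inChart form p) (chartImage m P p)
  vertical : ∀ (p : P) (ξ : LieAlg k G),
    form p (mfderiv (𝓡 k) ((𝓡 m).prod (𝓡 k)) (fun g : G => MulOpposite.op g • p) 1 ξ) = ξ
  equivariant : ∀ (p : P) (g : G) (v : TangentSpace ((𝓡 m).prod (𝓡 k)) p),
    form (MulOpposite.op g • p)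
      (mfderiv ((𝓡 m).prod (𝓡 k)) ((𝓡 m).prod (𝓡 k)) (fun q : P => MulOpposite.op g • q) p v)
      = Ad g⁻¹ (form p v)

/-- The curvature `F(u, v) = dω(u, v) + [ω(u), ω(v)]` at `p`, computed in the preferred chart
at `p`. -/
def Connection.curvature (A : Connection m k G P) (p : P)
    (u v : TangentSpace ((𝓡 m).prod (𝓡 k)) p) : LieAlg k G :=
  fderiv ℝ (A.form.inChart p) (extChartAt ((𝓡 m).prod (𝓡 k)) p p) u v
    - fderiv ℝ (A.form.inChart p) (extChartAt ((𝓡 m).prod (𝓡 k)) p p) v u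
    + bracket G (A.form p u) (A.form p v)

/-- `F = 0`. -/
def Connection.IsFlat (A : Connection m k G P) : Prop :=
  ∀ (p : P) (u v : TangentSpace ((𝓡 m).prod (𝓡 k)) p), A.curvature p u v = 0

variable (m k G) in
/-- A `𝔤`-valued `r`-form `B` on `M` transforming in the adjoint representation under changes of
frame: to each frame `p` it assigns its value `B_p`, an alternating form on the tangent space of `M`
at `proj p`, with `B_{p · g} = Ad(g⁻¹) B_p`. It is smooth: its pullback `p ↦ B_p ∘ d(proj)` is a
smooth form on `P`. -/
structure AdForm (proj : P → M) (r : ℕ) where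
  form : ∀ p : P, TangentSpace (𝓡 m) (proj p) [⋀^Fin r]→L[ℝ] LieAlg k G
  smooth : ∀ p : P, ContDiffOn ℝ ∞
    (fun z : E m × E k => ((form (chartInv m P p z)).compContinuousLinearMap
      ((mfderiv ((𝓡 m).prod (𝓡 k)) (𝓡 m) proj (chartInv m P p z)).comp (chartInvDeriv p z)) :
        (E m × E k) [⋀^Fin r]→L[ℝ] LieAlg k G)) (chartImage m P p)
  equivariant : ∀ (p : P) (g : G) (v : Fin r → E m),
    form (MulOpposite.op g • p) v = Ad g⁻¹ (form p v)

/-- `q` is obtained from `p` by horizontal lift of one smooth curve. -/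
def Connection.HorizontalStep (A : Connection m k G P) (p q : P) : Prop :=
  ∃ c : ℝ → P, ContMDiffOn 𝓘(ℝ, ℝ) ((𝓡 m).prod (𝓡 k)) ∞ c (Icc 0 1) ∧ c 0 = p ∧ c 1 = q ∧
    ∀ t ∈ Icc (0 : ℝ) 1,
      A.form (c t) (mfderivWithin 𝓘(ℝ, ℝ) ((𝓡 m).prod (𝓡 k)) c (Icc 0 1) t (1 : ℝ)) = 0

/-- `q` is the parallel transport of the frame `p` along some piecewise smooth curve. -/
def Connection.IsTransport (A : Connection m k G P) (p q : P) : Prop :=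
  Relation.ReflTransGen A.HorizontalStep p q

open Classical in
/-- The parallel transport of the frame `p₀` to the fibre over `x`, along a chosen curve. (For `A`
flat and `M` simply connected it depends only on the endpoint `x`.) -/
def Connection.frame (A : Connection m k G P) (proj : P → M) (p₀ : P) (x : M) : P :=
  if h : ∃ q : P, proj q = x ∧ A.IsTransport p₀ q then h.choose else p₀

/-- The parallel-transported form `B^W = W⁻¹ B W` at `x`: the value of `B` in the frame at `x`
that is the parallel transport of `p₀`. -/
def transported {proj : P → M} {r : ℕ} (A : Connection m k G P) (B : AdForm m k G proj r) (p₀ : P)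
    (x : M) : TangentSpace (𝓡 m) x [⋀^Fin r]→L[ℝ] LieAlg k G :=
  B.form (A.frame proj p₀ x)

end Bundle

section Loops

/-- The cube `[0, 2π]ⁿ`. -/
def cube (n : ℕ) : Set (Fin n → ℝ) := Icc 0 (fun _ => 2 * Real.pi)

/-- The cube `[0, 2π]ⁿ × [0, 2π]` of points `(σ, τ)`. -/
def cubeTime (n : ℕ) : Set ((Fin n → ℝ) × ℝ) := cube n ×ˢ Icc 0 (2 * Real.pi)

variable {m : ℕ} {M : Type*} [TopologicalSpace M] [ChartedSpace (E m) M] [IsManifold (𝓡 m) ∞ M]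

variable (m) in
/-- `N ∈ Ωⁿ(M, x₀)`: a smooth map `[0, 2π]ⁿ → M` sending the boundary of the cube to `x₀`. -/
def IsNLoop (n : ℕ) (x₀ : M) (N : (Fin n → ℝ) → M) : Prop :=
  ContMDiffOn 𝓘(ℝ, Fin n → ℝ) (𝓡 m) ∞ N (cube n) ∧ ∀ σ ∈ frontier (cube n), N σ = x₀

/-- `X` is a tangent vector of `Ωⁿ(M, x₀)` at `N`: a smooth vector field along `N` that vanishes on
the boundary of the cube. -/
def IsTangentAt {n : ℕ} (N : (Fin n → ℝ) → M) (X : ∀ σ, TangentSpace (𝓡 m) (N σ)) : Prop :=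
  ContMDiffOn 𝓘(ℝ, Fin n → ℝ) (𝓡 m).tangent ∞
    (fun σ => (⟨N σ, X σ⟩ : TangentBundle (𝓡 m) M)) (cube n) ∧
  ∀ σ ∈ frontier (cube n), X σ = 0

/-- The partial derivative `∂x/∂σⁱ`. -/
def partialDeriv {n : ℕ} (N : (Fin n → ℝ) → M) (σ : Fin n → ℝ) (i : Fin n) :
    TangentSpace (𝓡 m) (N σ) :=
  mfderivWithin 𝓘(ℝ, Fin n → ℝ) (𝓡 m) N (cube n) σ (Pi.single i (1 : ℝ) : Fin n → ℝ)

variable (m) in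
/-- A loop in `Ωⁿ(M, x₀)` (with any base loop): a smooth map `Γ(σ, τ)` with `Γ(·, τ) ∈ Ωⁿ(M, x₀)`
for every `τ` and `Γ(·, 0) = Γ(·, 2π)`. -/
def IsLoopOfNLoops (n : ℕ) (x₀ : M) (Γ : (Fin n → ℝ) × ℝ → M) : Prop :=
  ContMDiffOn 𝓘(ℝ, (Fin n → ℝ) × ℝ) (𝓡 m) ∞ Γ (cubeTime n) ∧
  (∀ σ ∈ frontier (cube n), ∀ τ ∈ Icc 0 (2 * Real.pi), Γ (σ, τ) = x₀) ∧
  ∀ σ ∈ cube n, Γ (σ, 0) = Γ (σ, 2 * Real.pi)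

/-- The velocity `∂x/∂τ` of a loop of `n`-loops. -/
def velocity {n : ℕ} (Γ : (Fin n → ℝ) × ℝ → M) (σ : Fin n → ℝ) (τ : ℝ) :
    TangentSpace (𝓡 m) (Γ (σ, τ)) :=
  mfderivWithin 𝓘(ℝ, (Fin n → ℝ) × ℝ) (𝓡 m) Γ (cubeTime n) (σ, τ)
    ((0, 1) : (Fin n → ℝ) × ℝ)

/-- `h` is a diffeomorphism of the cube `[0, 2π]ⁿ⁺¹` that is the identity on the boundary. -/
def IsCubeDiffeo (n : ℕ) (h : (Fin n → ℝ) × ℝ → (Fin n → ℝ) × ℝ) : Prop :=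
  ContDiffOn ℝ ∞ h (cubeTime n) ∧ MapsTo h (cubeTime n) (cubeTime n) ∧
  (∃ j : (Fin n → ℝ) × ℝ → (Fin n → ℝ) × ℝ, ContDiffOn ℝ ∞ j (cubeTime n) ∧
    MapsTo j (cubeTime n) (cubeTime n) ∧ InvOn j h (cubeTime n) (cubeTime n)) ∧
  ∀ z ∈ frontier (cubeTime n), h z = z

/-- `h` is a diffeomorphism of the cube `[0, 2π]ⁿ⁺¹` that is the identity on the boundary and is
connected to the identity, by a smooth isotopy through such diffeomorphisms. -/
def IsReparametrization (n : ℕ) (h : (Fin n → ℝ) × ℝ → (Fin n → ℝ) × ℝ) : Prop :=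
  ∃ H : ℝ → (Fin n → ℝ) × ℝ → (Fin n → ℝ) × ℝ,
    ContDiffOn ℝ ∞ (fun z : ℝ × ((Fin n → ℝ) × ℝ) => H z.1 z.2) (Icc 0 1 ×ˢ cubeTime n) ∧
    (∀ s ∈ Icc (0 : ℝ) 1, IsCubeDiffeo n (H s)) ∧
    EqOn (H 0) id (cubeTime n) ∧ EqOn (H 1) h (cubeTime n)

end Loops

section LoopConnection

variable {m k n : ℕ}
  {M : Type*} [TopologicalSpace M] [ChartedSpace (E m) M] [IsManifold (𝓡 m) ∞ M]
  {G : Type*} [TopologicalSpace G] [ChartedSpace (E k) G] [Group G]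
  {P : Type*} [TopologicalSpace P] [ChartedSpace (ModelProd (E m) (E k)) P] [MulAction Gᵐᵒᵖ P]
  {proj : P → M}
  (A : Connection m k G P) (B : AdForm m k G proj (n + 1)) (p₀ : P)

/-- The coefficient of `dσ¹ ∧ ⋯ ∧ dσⁿ` in `ι_v B^W`, for `v` a tangent vector of `M` at `N(σ)`:
`B^W(v, ∂x/∂σ¹, …, ∂x/∂σⁿ)`. -/
def contraction (N : (Fin n → ℝ) → M) (σ : Fin n → ℝ) (v : TangentSpace (𝓡 m) (N σ)) :
    LieAlg k G :=
  transported A B p₀ (N σ) (Matrix.vecCons v (partialDeriv N σ))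

/-- The connection `𝒜` on `Ωⁿ(M, x₀)`: `𝒜_N(X) = ∫_N ι_X B^W`. -/
def loopConnection (N : (Fin n → ℝ) → M) (X : ∀ σ, TangentSpace (𝓡 m) (N σ)) : LieAlg k G :=
  ∫ σ in cube n, contraction A B p₀ N σ (X σ)

/-- `𝒜` is curvature local: the nonlocal commutator term `[∫_N ι_X B^W, ∫_N ι_Y B^W]` of the
curvature `ℱ(X, Y) = ∫_N W⁻¹ (ι_Y ι_X D_A B) W + [∫_N ι_X B^W, ∫_N ι_Y B^W]` vanishes. -/
def IsCurvatureLocal : Prop :=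
  ∀ N : (Fin n → ℝ) → M, IsNLoop m n (proj p₀) N →
    ∀ X Y : ∀ σ, TangentSpace (𝓡 m) (N σ), IsTangentAt N X → IsTangentAt N Y →
      bracket G (loopConnection A B p₀ N X) (loopConnection A B p₀ N Y) = 0

/-- The pointwise form of the commutator condition, along every `n`-loop. -/
def CommutesAlongLoops : Prop :=
  ∀ N : (Fin n → ℝ) → M, IsNLoop m n (proj p₀) N → ∀ σ ∈ cube n, ∀ σ' ∈ cube n,
    ∀ (X : TangentSpace (𝓡 m) (N σ)) (Y : TangentSpace (𝓡 m) (N σ')),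
      bracket G (contraction A B p₀ N σ X) (contraction A B p₀ N σ' Y) = 0

/-- The parallel-transported components of `B` commute at all pairs of points of `M`. -/
def ComponentsCommute : Prop :=
  ∀ (x x' : M) (v : Fin (n + 1) → TangentSpace (𝓡 m) x)
    (v' : Fin (n + 1) → TangentSpace (𝓡 m) x'),
    bracket G (transported A B p₀ x v) (transported A B p₀ x' v') = 0

/-- The holonomy of `𝒜` along a loop of `n`-loops: `W(2π)`, where
`dW/dτ + 𝒜(∂x/∂τ) W = 0`, `W(0) = 1`. -/
def loopHolonomy (Γ : (Fin n → ℝ) × ℝ → M) : G :=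
  holonomy (fun τ => loopConnection A B p₀ (fun σ => Γ (σ, τ)) (fun σ => velocity Γ σ τ))

/-- `𝒜` is r-flat: its holonomy is invariant under reparametrizations of `[0, 2π]ⁿ⁺¹`. -/
def IsRFlat : Prop :=
  ∀ Γ : (Fin n → ℝ) × ℝ → M, IsLoopOfNLoops m n (proj p₀) Γ →
    ∀ h : (Fin n → ℝ) × ℝ → (Fin n → ℝ) × ℝ, IsReparametrization n h →
      loopHolonomy A B p₀ (Γ ∘ h) = loopHolonomy A B p₀ Γ

end LoopConnection

end LoopSpace

end

/-! Flatness and simple connectedness turn parallel transport into a global object: there is a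
horizontal section `s` of the bundle through `p₀` (`Connection.exists_global_horizontalSection`),
and the transported frame at `x` is `s x` whatever path is chosen (`IsHorizontalSection.frame_eq`).
So `B^W` is an ordinary Lie-algebra-valued form on `M`, given by `B.formAt (s x)`, with continuous
pullbacks along smooth maps. All four conditions are compared with the commutation of its
components.

Suppose that the components commute. Integrals of them then lie in their bicommutant, whose elements
commute with each other (`integral_mem_bicommutant`); this gives curvature locality, and the
pointwise condition along loops is a special case. For r-flatness, the differential equation with
commuting coefficients is solved by a product of one-parameter subgroups, so the holonomy is a
function of the total integral alone (`exists_holonomy_eq_of_commuting`). By Fubini that integral is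
the integral of a top-degree form over the cube of dimension `n + 1`. A diffeomorphism isotopic to
the identity has positive Jacobian, so it leaves the integral unchanged
(`IsReparametrization.setIntegral_det_smul`).

Conversely, take two "blobs": families of maps that are constantly `x₀` outside two disjoint balls
of the cube, each with an arbitrary 1-jet at the centre of its ball (`exists_blob`). The `sweep` of
a blob is the value of the loop space connection on its velocity. Each condition forces the sweeps
of the two blobs to commute. Multiplying the velocities by arbitrary functions of `σ` and applying
the fundamental lemma of the calculus of variations then gives the commutation of arbitrary
components (`components_commute_of_sweep`).

For curvature locality, the two blobs are moved separately from the same base loop, and for the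
pointwise condition the brackets are integrated. For r-flatness, the blobs go out and back in
interleaved order, which gives a group commutator `U₂(T)⁻¹ U₁(S)⁻¹ U₂(T) U₁(S)` as holonomy
(`holonomy_interleaved`). A reparametrization supported near the second blob delays it until the
first has finished, and then the holonomy is trivial (`holonomy_consecutive`). Hence `U₁(S)` and
`U₂(T)` commute for all small `S` and `T`, and differentiating at zero gives the bracket
(`bracketL_eq_zero_of_commute`).

The analytic groundwork consists of Lie group calculus in the chart at the identity, and a Frobenius
theorem that produces the local horizontal sections. -/

noncomputable section

namespace LoopSpace

open Filter Topology

set_option linter.unusedSectionVars false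

/-! ### Manifold derivatives read in preferred charts -/

section ChartCalculus

variable {E₁ H₁ M₁ : Type*} [NormedAddCommGroup E₁] [NormedSpace ℝ E₁] [TopologicalSpace H₁]
  {I₁ : ModelWithCorners ℝ E₁ H₁} [I₁.Boundaryless] [TopologicalSpace M₁] [ChartedSpace H₁ M₁]
  {E₂ H₂ M₂ : Type*} [NormedAddCommGroup E₂] [NormedSpace ℝ E₂] [TopologicalSpace H₂]
  {I₂ : ModelWithCorners ℝ E₂ H₂} [TopologicalSpace M₂] [ChartedSpace H₂ M₂]

theorem hasMFDerivAt_charts_iff {f : M₁ → M₂} {x : M₁} {D : E₁ →L[ℝ] E₂} :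
    HasMFDerivAt I₁ I₂ f x D ↔ ContinuousAt f x ∧
      HasFDerivAt (fun z => extChartAt I₂ (f x) (f ((extChartAt I₁ x).symm z))) D
        (extChartAt I₁ x x) := by
  have h : HasMFDerivAt I₁ I₂ f x D ↔ ContinuousAt f x ∧
      HasFDerivWithinAt (fun z => extChartAt I₂ (f x) (f ((extChartAt I₁ x).symm z))) D
        (range I₁) (extChartAt I₁ x x) := Iff.rfl
  rw [h, I₁.range_eq_univ, hasFDerivWithinAt_univ]

theorem mfderiv_eq_fderiv_charts {f : M₁ → M₂} {x : M₁} (hf : MDifferentiableAt I₁ I₂ f x) :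
    (mfderiv I₁ I₂ f x : E₁ →L[ℝ] E₂) =
      fderiv ℝ (fun z => extChartAt I₂ (f x) (f ((extChartAt I₁ x).symm z)))
        (extChartAt I₁ x x) := by
  exact (hasMFDerivAt_charts_iff.1 hf.hasMFDerivAt).2.fderiv.symm

theorem hasMFDerivWithinAt_vector_iff {V : Type*} [NormedAddCommGroup V] [NormedSpace ℝ V]
    {f : V → M₂} {s : Set V} {x : V} {D : V →L[ℝ] E₂} :
    HasMFDerivWithinAt 𝓘(ℝ, V) I₂ f s x D ↔ ContinuousWithinAt f s x ∧
      HasFDerivWithinAt (fun z => extChartAt I₂ (f x) (f z)) D s x := by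
  unfold HasMFDerivWithinAt
  simp only [mfld_simps, writtenInExtChartAt]
  rfl

theorem contDiffAt_chart_comp [IsManifold I₂ ∞ M₂] {V : Type*} [NormedAddCommGroup V]
    [NormedSpace ℝ V] {f : V → M₂} {x : V} {y : M₂} (hf : ContMDiffAt 𝓘(ℝ, V) I₂ ∞ f x)
    (hy : f x ∈ (extChartAt I₂ y).source) : ContDiffAt ℝ ∞ (fun z => extChartAt I₂ y (f z)) x := by
  rw [← contMDiffAt_iff_contDiffAt]
  rw [extChartAt_source] at hy
  exact (contMDiffAt_extChartAt' hy).comp x hf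

theorem contMDiffAt_extChartAt_symm [IsManifold I₁ ∞ M₁] {x : M₁} {z : E₁}
    (hz : z ∈ (extChartAt I₁ x).target) :
    ContMDiffAt 𝓘(ℝ, E₁) I₁ ∞ (extChartAt I₁ x).symm z :=
  (contMDiffOn_extChartAt_symm x).contMDiffAt ((isOpen_extChartAt_target x).mem_nhds hz)

end ChartCalculus

/-! ### Multiplication and conjugation in the chart at the identity -/

section LieCharts

variable {k : ℕ} (G : Type*) [TopologicalSpace G] [ChartedSpace (E k) G] [Group G]

/-- The preferred chart at the identity. -/
abbrev idChart : PartialEquiv G (E k) := extChartAt (𝓡 k) (1 : G)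

/-- The coordinates of the identity. -/
abbrev idCoord : E k := idChart G 1

/-- The multiplication of `G` in the chart at the identity. -/
def chartMul (x y : E k) : E k := idChart G ((idChart G).symm x * (idChart G).symm y)

variable {G}

/-- The conjugation by `g` in the chart at the identity. -/
def chartConj (g : G) (x : E k) : E k := idChart G (g * (idChart G).symm x * g⁻¹)

/-- The derivative of conjugation at the identity as a continuous linear map. -/
def AdL (g : G) : E k →L[ℝ] E k := fderiv ℝ (chartConj g) (idCoord G)

variable [LieGroup (𝓡 k) ∞ G]

include k in
theorem isTopologicalGroup_of_lieGroup (_ : LieGroup (𝓡 k) ∞ G) : IsTopologicalGroup G :=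
  topologicalGroup_of_lieGroup (𝓡 k) ∞

omit [Group G] [LieGroup (𝓡 k) ∞ G] in
theorem idCoord_mem_target [Group G] : idCoord G ∈ (idChart (k := k) G).target :=
  mem_extChartAt_target _

theorem idChart_symm_idCoord : (idChart (k := k) G).symm (idCoord G) = 1 := extChartAt_to_inv _

theorem contDiffAt_chartMul {x y : E k} (hx : x ∈ (idChart G).target) (hy : y ∈ (idChart G).target)
    (hxy : (idChart G).symm x * (idChart G).symm y ∈ (idChart (k := k) G).source) :
    ContDiffAt ℝ ∞ (fun z : E k × E k => chartMul G z.1 z.2) (x, y) := by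
  refine contDiffAt_chart_comp (I₂ := 𝓡 k) (f := fun z : E k × E k =>
    (idChart G).symm z.1 * (idChart G).symm z.2) ?_ hxy
  refine ContMDiffAt.mul ?_ ?_
  · exact (contMDiffAt_extChartAt_symm hx).comp (x, y) contDiffAt_fst.contMDiffAt
  · exact (contMDiffAt_extChartAt_symm hy).comp (x, y) contDiffAt_snd.contMDiffAt

theorem contDiffAt_chartMul_idCoord :
    ContDiffAt ℝ ∞ (fun z : E k × E k => chartMul G z.1 z.2) (idCoord G, idCoord G) :=
  contDiffAt_chartMul idCoord_mem_target idCoord_mem_target (by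
    simp only [idChart_symm_idCoord, mul_one]; exact mem_extChartAt_source _)

theorem contDiffAt_chartConj (g : G) : ContDiffAt ℝ ∞ (chartConj g) (idCoord (k := k) G) := by
  refine contDiffAt_chart_comp (I₂ := 𝓡 k) (f := fun z : E k => g * (idChart G).symm z * g⁻¹) ?_ ?_
  · exact (contMDiffAt_const.mul (contMDiffAt_extChartAt_symm idCoord_mem_target)).mul
      contMDiffAt_const
  · simp only [idChart_symm_idCoord, mul_one, mul_inv_cancel]; exact mem_extChartAt_source _

omit [LieGroup (𝓡 k) ∞ G] in
theorem chartConj_idCoord (g : G) : chartConj g (idCoord (k := k) G) = idCoord G := by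
  simp [chartConj, idCoord]

theorem hasFDerivAt_chartConj (g : G) : HasFDerivAt (chartConj g) (AdL g) (idCoord (k := k) G) :=
  ((contDiffAt_chartConj g).differentiableAt (by simp)).hasFDerivAt

theorem Ad_eq_AdL (g : G) (ξ : E k) : Ad g ξ = AdL g ξ := by
  have h : MDifferentiableAt (𝓡 k) (𝓡 k) (fun h : G => g * h * g⁻¹) 1 :=
    ((contMDiffAt_const.mul contMDiffAt_id).mul contMDiffAt_const :
      ContMDiffAt (𝓡 k) (𝓡 k) ∞ (fun h : G => g * h * g⁻¹) 1).mdifferentiableAt (by simp)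
  have h2 := mfderiv_eq_fderiv_charts h
  have h3 : g * 1 * g⁻¹ = 1 := by group
  rw [Ad]
  refine (congrArg (fun L : E k →L[ℝ] E k => L ξ) h2).trans ?_
  rw [h3]
  rfl

omit [LieGroup (𝓡 k) ∞ G] in
theorem eventually_symm_idChart {V : Type*} {f : V → G} {l : Filter V} (hf : Tendsto f l (𝓝 1)) :
    ∀ᶠ v in l, (idChart (k := k) G).symm (idChart G (f v)) = f v := by
  filter_upwards [hf.eventually (extChartAt_source_mem_nhds (I := 𝓡 k) (1 : G))] with v hv
  exact (idChart G).left_inv hv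

/-- The restrictions of the product to the two axes are `x * 1 = x` and `1 * y = y`, so both partial
derivatives are the identity. -/
theorem hasFDerivAt_chartMul_idCoord :
    HasFDerivAt (fun z : E k × E k => chartMul G z.1 z.2)
      (ContinuousLinearMap.fst ℝ (E k) (E k) + ContinuousLinearMap.snd ℝ (E k) (E k))
      (idCoord G, idCoord G) := by
  have hd := (contDiffAt_chartMul_idCoord (k := k) (G := G)).differentiableAt (by simp)
  have h := hd.hasFDerivAt
  set D := fderiv ℝ (fun z : E k × E k => chartMul G z.1 z.2) (idCoord G, idCoord G)
  have hnear : ∀ᶠ z in 𝓝 (idCoord (k := k) G), z ∈ (idChart G).target :=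
    (isOpen_extChartAt_target _).mem_nhds idCoord_mem_target
  have h1 : D.comp (ContinuousLinearMap.inl ℝ (E k) (E k)) = ContinuousLinearMap.id ℝ (E k) := by
    have := HasFDerivAt.comp (idCoord (k := k) G) (f := fun e => (e, idCoord (k := k) G)) h
      (hasFDerivAt_prodMk_left (𝕜 := ℝ) (idCoord (k := k) G) (idCoord (k := k) G))
    refine this.unique ((hasFDerivAt_id (𝕜 := ℝ) (idCoord (k := k) G)).congr_of_eventuallyEq ?_)
    filter_upwards [hnear] with z hz
    simp only [Function.comp, chartMul, idChart_symm_idCoord, mul_one, id]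
    exact (idChart G).right_inv hz
  have h2 : D.comp (ContinuousLinearMap.inr ℝ (E k) (E k)) = ContinuousLinearMap.id ℝ (E k) := by
    have := HasFDerivAt.comp (idCoord (k := k) G) (f := fun e => (idCoord (k := k) G, e)) h
      (hasFDerivAt_prodMk_right (𝕜 := ℝ) (idCoord (k := k) G) (idCoord (k := k) G))
    refine this.unique ((hasFDerivAt_id (𝕜 := ℝ) (idCoord (k := k) G)).congr_of_eventuallyEq ?_)
    filter_upwards [hnear] with z hz
    simp only [Function.comp, chartMul, idChart_symm_idCoord, one_mul, id]
    exact (idChart G).right_inv hz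
  have hD : D = ContinuousLinearMap.fst ℝ (E k) (E k) + ContinuousLinearMap.snd ℝ (E k) (E k) := by
    refine ContinuousLinearMap.ext fun z => ?_
    have e1 : D (z.1, 0) = z.1 := congrArg (fun L => L z.1) h1
    have e2 : D (0, z.2) = z.2 := congrArg (fun L => L z.2) h2
    have e3 : z = (z.1, 0) + (0, z.2) := by simp
    rw [e3, map_add, e1, e2]
    simp
  rwa [← hD]

theorem tendsto_idChart_symm :
    Tendsto (idChart (k := k) G).symm (𝓝 (idCoord G)) (𝓝 1) := by
  have h := (contMDiffAt_extChartAt_symm (I₁ := 𝓡 k) (M₁ := G)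
    (idCoord_mem_target (k := k) (G := G))).continuousAt.tendsto
  rwa [idChart_symm_idCoord] at h

end LieCharts

/-! ### Right logarithmic derivatives of curves in the group -/

section LogDeriv

variable {k : ℕ} {G : Type*} [TopologicalSpace G] [ChartedSpace (E k) G] [Group G]

/-- `W` is continuous at `τ` and `dW/dτ = a W(τ)`, expressed in the chart at the identity. -/
def HasLogDerivWithinAt (W : ℝ → G) (a : E k) (s : Set ℝ) (τ : ℝ) : Prop :=
  ContinuousWithinAt W s τ ∧ HasDerivWithinAt (fun t => idChart (k := k) G (W t * (W τ)⁻¹)) a s τ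

variable [LieGroup (𝓡 k) ∞ G]

theorem hasLogDerivWithinAt_const (g : G) (s : Set ℝ) (τ : ℝ) :
    HasLogDerivWithinAt (k := k) (fun _ => g) 0 s τ :=
  ⟨continuousWithinAt_const, hasDerivWithinAt_const _ _ _⟩

theorem HasLogDerivWithinAt.tendsto {W : ℝ → G} {a : E k} {s : Set ℝ} {τ : ℝ}
    (h : HasLogDerivWithinAt W a s τ) :
    Tendsto (fun t => W t * (W τ)⁻¹) (𝓝[s] τ) (𝓝 1) := by
  have := isTopologicalGroup_of_lieGroup (k := k) (G := G) inferInstance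
  have := h.1.tendsto.mul_const (W τ)⁻¹
  rwa [mul_inv_cancel] at this

/-- Product rule. Writing `A t * B t * (A τ * B τ)⁻¹` as the product of `A t * (A τ)⁻¹` and the
conjugate by `A τ` of `B t * (B τ)⁻¹`, both factors are near `1`, where multiplication is addition
to first order. -/
theorem HasLogDerivWithinAt.mul {A B : ℝ → G} {α β : E k} {s : Set ℝ} {τ : ℝ}
    (hA : HasLogDerivWithinAt A α s τ) (hB : HasLogDerivWithinAt B β s τ) :
    HasLogDerivWithinAt (fun t => A t * B t) (α + AdL (A τ) β) s τ := by
  have := isTopologicalGroup_of_lieGroup (k := k) (G := G) inferInstance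
  refine ⟨hA.1.mul hB.1, ?_⟩
  have hc := (hasFDerivAt_chartConj (k := k) (A τ))
  have hb : HasDerivWithinAt (fun t => chartConj (A τ) (idChart (k := k) G (B t * (B τ)⁻¹)))
      (AdL (A τ) β) s τ := by
    have hc' : HasFDerivAt (chartConj (A τ)) (AdL (A τ)) (idChart (k := k) G (B τ * (B τ)⁻¹)) := by
      rwa [mul_inv_cancel]
    exact hc'.comp_hasDerivWithinAt τ hB.2
  have hm := hasFDerivAt_chartMul_idCoord (k := k) (G := G)
  have hprod : HasDerivWithinAt (fun t => chartMul G (idChart (k := k) G (A t * (A τ)⁻¹))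
      (chartConj (A τ) (idChart (k := k) G (B t * (B τ)⁻¹)))) (α + AdL (A τ) β) s τ := by
    have hm' : HasFDerivAt (fun z : E k × E k => chartMul G z.1 z.2)
        (ContinuousLinearMap.fst ℝ (E k) (E k) + ContinuousLinearMap.snd ℝ (E k) (E k))
        (idChart (k := k) G (A τ * (A τ)⁻¹),
          chartConj (A τ) (idChart (k := k) G (B τ * (B τ)⁻¹))) := by
      rw [mul_inv_cancel, mul_inv_cancel, chartConj_idCoord]
      exact hm
    exact hm'.comp_hasDerivWithinAt τ (hA.2.prodMk hb)
  have hconj : Tendsto (fun t => A τ * (B t * (B τ)⁻¹) * (A τ)⁻¹) (𝓝[s] τ) (𝓝 1) := by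
    have := (hB.tendsto.const_mul (A τ)).mul_const (A τ)⁻¹
    simpa using this
  have key : ∀ t, (idChart (k := k) G).symm (idChart G (A t * (A τ)⁻¹)) = A t * (A τ)⁻¹ →
      (idChart (k := k) G).symm (idChart G (B t * (B τ)⁻¹)) = B t * (B τ)⁻¹ →
      (idChart (k := k) G).symm (idChart G (A τ * (B t * (B τ)⁻¹) * (A τ)⁻¹)) =
        A τ * (B t * (B τ)⁻¹) * (A τ)⁻¹ →
      idChart (k := k) G (A t * B t * (A τ * B τ)⁻¹) =
        chartMul G (idChart (k := k) G (A t * (A τ)⁻¹))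
          (chartConj (A τ) (idChart (k := k) G (B t * (B τ)⁻¹))) := by
    intro t h1 h2 h3
    simp only [chartMul, chartConj, h1, h2, h3]
    congr 1
    group
  refine hprod.congr_of_eventuallyEq ?_ ?_
  · filter_upwards [eventually_symm_idChart (k := k) hA.tendsto,
      eventually_symm_idChart (k := k) hB.tendsto, eventually_symm_idChart (k := k) hconj]
      with t h1 h2 h3 using key t h1 h2 h3
  · refine key τ ?_ ?_ ?_ <;> simp

/-- Only differentiability matters here. The precise derivative of an inverse is recovered later, in
`HasLogDerivWithinAt.inv`, by differentiating `A⁻¹ * A = 1`. -/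
theorem exists_hasFDerivAt_chartInv :
    ∃ D : E k →L[ℝ] E k, ∀ g : G, HasFDerivAt
      (fun y : E k => idChart G (g⁻¹ * ((idChart (k := k) G).symm y)⁻¹ * g)) ((AdL g⁻¹).comp D)
      (idCoord G) := by
  have := isTopologicalGroup_of_lieGroup (k := k) (G := G) inferInstance
  have h0 : ContDiffAt ℝ ∞ (fun y : E k => idChart (k := k) G (((idChart (k := k) G).symm y)⁻¹)) (idCoord G) := by
    refine contDiffAt_chart_comp (I₂ := 𝓡 k) ?_ ?_
    · exact ContMDiffAt.inv (contMDiffAt_extChartAt_symm idCoord_mem_target)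
    · simp only [idChart_symm_idCoord, inv_one]; exact mem_extChartAt_source _
  refine ⟨fderiv ℝ (fun y : E k => idChart (k := k) G (((idChart (k := k) G).symm y)⁻¹))
    (idCoord G), fun g => ?_⟩
  have h1 := (h0.differentiableAt (by simp)).hasFDerivAt
  have h2 : HasFDerivAt (chartConj g⁻¹) (AdL g⁻¹)
      (idChart (k := k) G (((idChart (k := k) G).symm (idCoord G))⁻¹)) := by
    simp only [idChart_symm_idCoord, inv_one]; exact hasFDerivAt_chartConj _
  refine (h2.comp (idCoord G) h1).congr_of_eventuallyEq ?_
  have ht : Tendsto (fun y => ((idChart (k := k) G).symm y)⁻¹) (𝓝 (idCoord G)) (𝓝 1) := by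
    have h := (tendsto_idChart_symm (k := k) (G := G)).inv
    rwa [inv_one] at h
  filter_upwards [eventually_symm_idChart (k := k) ht] with y hy
  simp only [Function.comp, chartConj, hy, inv_inv]

theorem HasLogDerivWithinAt.exists_inv {A : ℝ → G} {α : E k} {s : Set ℝ} {τ : ℝ}
    (hA : HasLogDerivWithinAt A α s τ) :
    ∃ β : E k, HasLogDerivWithinAt (fun t => (A t)⁻¹) β s τ := by
  have := isTopologicalGroup_of_lieGroup (k := k) (G := G) inferInstance
  obtain ⟨D, hD⟩ := exists_hasFDerivAt_chartInv (k := k) (G := G)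
  refine ⟨(AdL (A τ)⁻¹).comp D α, hA.1.inv, ?_⟩
  have h : HasFDerivAt (fun y => idChart G ((A τ)⁻¹ * ((idChart (k := k) G).symm y)⁻¹ * A τ))
      ((AdL (A τ)⁻¹).comp D) (idChart (k := k) G (A τ * (A τ)⁻¹)) := by
    rw [mul_inv_cancel]; exact hD (A τ)
  have h' := h.comp_hasDerivWithinAt τ hA.2
  refine h'.congr_of_eventuallyEq ?_ ?_
  · filter_upwards [eventually_symm_idChart (k := k) hA.tendsto] with t ht
    simp only [Function.comp, ht]
    congr 1; group
  · simp

theorem AdL_one : AdL (1 : G) = ContinuousLinearMap.id ℝ (E k) := by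
  refine (hasFDerivAt_chartConj (k := k) (1 : G)).unique
    ((hasFDerivAt_id (𝕜 := ℝ) (idCoord (k := k) G)).congr_of_eventuallyEq ?_)
  filter_upwards [(isOpen_extChartAt_target _).mem_nhds (idCoord_mem_target (k := k) (G := G))]
    with z hz
  simp only [chartConj, one_mul, inv_one, mul_one, id]
  exact (idChart G).right_inv hz

theorem AdL_mul (g h : G) : AdL (k := k) (g * h) = (AdL g).comp (AdL h) := by
  have := isTopologicalGroup_of_lieGroup (k := k) (G := G) inferInstance
  have h1 : HasFDerivAt (chartConj g) (AdL g) (chartConj h (idCoord (k := k) G)) := by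
    rw [chartConj_idCoord]; exact hasFDerivAt_chartConj g
  refine (hasFDerivAt_chartConj (k := k) (g * h)).unique
    ((h1.comp _ (hasFDerivAt_chartConj h)).congr_of_eventuallyEq ?_)
  have ht : Tendsto (fun y => h * (idChart (k := k) G).symm y * h⁻¹) (𝓝 (idCoord G)) (𝓝 1) := by
    have := ((tendsto_idChart_symm (k := k) (G := G)).const_mul h).mul_const h⁻¹
    rwa [mul_one, mul_inv_cancel] at this
  filter_upwards [eventually_symm_idChart (k := k) ht] with y hy
  simp only [Function.comp, chartConj, hy]
  congr 1; group

theorem HasLogDerivWithinAt.unique {W : ℝ → G} {a b : E k} {s : Set ℝ} {τ : ℝ}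
    (ha : HasLogDerivWithinAt W a s τ) (hb : HasLogDerivWithinAt W b s τ)
    (hs : UniqueDiffWithinAt ℝ s τ) : a = b :=
  hs.eq_deriv s ha.2 hb.2

theorem HasLogDerivWithinAt.inv {A : ℝ → G} {α : E k} {s : Set ℝ} {τ : ℝ}
    (hA : HasLogDerivWithinAt A α s τ) (hs : UniqueDiffWithinAt ℝ s τ) :
    HasLogDerivWithinAt (fun t => (A t)⁻¹) (-(AdL (A τ)⁻¹ α)) s τ := by
  obtain ⟨β, hβ⟩ := hA.exists_inv
  have h := hβ.mul hA
  simp only [inv_mul_cancel] at h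
  have h2 := h.unique (hasLogDerivWithinAt_const (k := k) (1 : G) s τ) hs
  rwa [← eq_neg_of_add_eq_zero_left h2]

end LogDeriv

theorem eqOn_of_eventually_eq {X Y : Type*} [TopologicalSpace X] {f : X → Y} {s : Set X}
    (hs : IsPreconnected s) (h : ∀ t ∈ s, ∀ᶠ t' in 𝓝[s] t, f t' = f t) {x y : X} (hx : x ∈ s)
    (hy : y ∈ s) : f x = f y := by
  -- With the discrete topology on the target, local constancy is continuity, and a continuous map
  -- from a preconnected set to a discrete space is constant.
  let _ : TopologicalSpace Y := ⊥
  have : DiscreteTopology Y := ⟨rfl⟩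
  refine hs.constant (fun t ht => ?_) hx hy
  rw [ContinuousWithinAt, nhds_discrete]
  exact tendsto_pure.2 (h t ht)

/-! ### Derivatives of left and right translation in the chart at the identity -/

section LieCharts

variable {k : ℕ} (G : Type*) [TopologicalSpace G] [ChartedSpace (E k) G] [Group G]

/-- The derivative at the identity of right multiplication by the element with coordinates `y`. -/
def chartR (y : E k) : E k →L[ℝ] E k := fderiv ℝ (fun x => chartMul G x y) (idCoord G)

/-- The derivative at the identity of left multiplication by the element with coordinates `x`. -/
def chartL (x : E k) : E k →L[ℝ] E k := fderiv ℝ (fun y => chartMul G x y) (idCoord G)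

/-- The second derivative of the multiplication at the identity. -/
def chartMulSnd : E k × E k →L[ℝ] E k × E k →L[ℝ] E k :=
  fderiv ℝ (fderiv ℝ fun z : E k × E k => chartMul G z.1 z.2) (idCoord G, idCoord G)

variable {G}
variable [LieGroup (𝓡 k) ∞ G]

theorem contDiffAt_chartMul_right {y : E k} (hy : y ∈ (idChart (k := k) G).target) :
    ContDiffAt ℝ ∞ (fun z : E k × E k => chartMul G z.1 z.2) (idCoord G, y) :=
  contDiffAt_chartMul idCoord_mem_target hy (by
    rw [idChart_symm_idCoord, one_mul]; exact (idChart G).map_target hy)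

theorem contDiffAt_chartMul_left {x : E k} (hx : x ∈ (idChart (k := k) G).target) :
    ContDiffAt ℝ ∞ (fun z : E k × E k => chartMul G z.1 z.2) (x, idCoord G) :=
  contDiffAt_chartMul hx idCoord_mem_target (by
    rw [idChart_symm_idCoord, mul_one]; exact (idChart G).map_target hx)

theorem hasFDerivAt_chartR {y : E k} (hy : y ∈ (idChart (k := k) G).target) :
    HasFDerivAt (fun x => chartMul G x y) (chartR G y) (idCoord G) := by
  have h := ((contDiffAt_chartMul_right hy).differentiableAt (by simp)).comp (idCoord (k := k) G)
    (f := fun e => (e, y)) (hasFDerivAt_prodMk_left (𝕜 := ℝ) (idCoord (k := k) G) y).differentiableAt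
  exact h.hasFDerivAt

theorem hasFDerivAt_chartL {x : E k} (hx : x ∈ (idChart (k := k) G).target) :
    HasFDerivAt (fun y => chartMul G x y) (chartL G x) (idCoord G) := by
  have h := ((contDiffAt_chartMul_left hx).differentiableAt (by simp)).comp (idCoord (k := k) G)
    (f := fun e => (x, e)) (hasFDerivAt_prodMk_right (𝕜 := ℝ) x (idCoord (k := k) G)).differentiableAt
  exact h.hasFDerivAt

theorem chartR_eq {y : E k} (hy : y ∈ (idChart (k := k) G).target) :
    chartR G y = (fderiv ℝ (fun z : E k × E k => chartMul G z.1 z.2) (idCoord G, y)).comp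
      (ContinuousLinearMap.inl ℝ (E k) (E k)) :=
  (hasFDerivAt_chartR hy).unique
    (HasFDerivAt.comp (idCoord (k := k) G) (f := fun e => (e, y))
      ((contDiffAt_chartMul_right hy).differentiableAt (by simp)).hasFDerivAt
      (hasFDerivAt_prodMk_left (𝕜 := ℝ) (idCoord (k := k) G) y))

theorem chartL_eq {x : E k} (hx : x ∈ (idChart (k := k) G).target) :
    chartL G x = (fderiv ℝ (fun z : E k × E k => chartMul G z.1 z.2) (x, idCoord G)).comp
      (ContinuousLinearMap.inr ℝ (E k) (E k)) :=
  (hasFDerivAt_chartL hx).unique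
    (HasFDerivAt.comp (idCoord (k := k) G) (f := fun e => (x, e))
      ((contDiffAt_chartMul_left hx).differentiableAt (by simp)).hasFDerivAt
      (hasFDerivAt_prodMk_right (𝕜 := ℝ) x (idCoord (k := k) G)))

theorem chartR_idCoord : chartR G (idCoord (k := k) G) = ContinuousLinearMap.id ℝ (E k) := by
  rw [chartR_eq idCoord_mem_target, hasFDerivAt_chartMul_idCoord.fderiv]
  ext1 z; simp

theorem chartL_idCoord : chartL G (idCoord (k := k) G) = ContinuousLinearMap.id ℝ (E k) := by
  rw [chartL_eq idCoord_mem_target, hasFDerivAt_chartMul_idCoord.fderiv]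
  ext1 z; simp

theorem idChart_target_mem_nhds {y : E k} (hy : y ∈ (idChart (k := k) G).target) :
    (idChart (k := k) G).target ∈ 𝓝 y := (isOpen_extChartAt_target _).mem_nhds hy

theorem contDiffAt_chartR {y : E k} (hy : y ∈ (idChart (k := k) G).target) :
    ContDiffAt ℝ 1 (chartR (k := k) G) y := by
  have h : ContDiffAt ℝ 1 (fun y => (fderiv ℝ (fun z : E k × E k => chartMul G z.1 z.2)
      (idCoord G, y)).comp (ContinuousLinearMap.inl ℝ (E k) (E k))) y := by
    refine ContDiffAt.clm_comp ?_ contDiffAt_const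
    exact ((contDiffAt_chartMul_right hy).fderiv_right (m := 1) (by norm_cast)).comp y
      (contDiffAt_const.prodMk contDiffAt_id)
  refine h.congr_of_eventuallyEq ?_
  filter_upwards [idChart_target_mem_nhds hy] with z hz using chartR_eq hz

theorem hasFDerivAt_fderiv_chartMul :
    HasFDerivAt (fderiv ℝ (fun z : E k × E k => chartMul G z.1 z.2)) (chartMulSnd G)
      (idCoord (k := k) G, idCoord G) :=
  ((contDiffAt_chartMul_idCoord.fderiv_right (m := 1) (by norm_cast)).differentiableAt
    (by simp)).hasFDerivAt

theorem chartMulSnd_symm (z w : E k × E k) :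
    chartMulSnd G z w = chartMulSnd G w z :=
  (contDiffAt_chartMul_idCoord (k := k) (G := G)).isSymmSndFDerivAt
    (by rw [minSmoothness_of_isRCLikeNormedField]; norm_cast) z w

theorem hasFDerivAt_chartL_apply (w : E k) :
    HasFDerivAt (fun x => chartL G x w)
      (((chartMulSnd G).flip (0, w)).comp (ContinuousLinearMap.inl ℝ (E k) (E k)))
      (idCoord (k := k) G) := by
  have h := HasFDerivAt.comp (idCoord (k := k) G) (f := fun e => (e, idCoord (k := k) G))
    hasFDerivAt_fderiv_chartMul
    (hasFDerivAt_prodMk_left (𝕜 := ℝ) (idCoord (k := k) G) (idCoord (k := k) G))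
  have h2 := h.clm_apply (hasFDerivAt_const ((0 : E k), w) (idCoord (k := k) G))
  refine (h2.congr_of_eventuallyEq ?_).congr_fderiv ?_
  · filter_upwards [idChart_target_mem_nhds (idCoord_mem_target (k := k) (G := G))] with z hz
    simp [chartL_eq hz]
  · ext1 v; simp

theorem hasFDerivAt_chartR_apply (w : E k) :
    HasFDerivAt (fun x => chartR G x w)
      (((chartMulSnd G).flip (w, 0)).comp (ContinuousLinearMap.inr ℝ (E k) (E k)))
      (idCoord (k := k) G) := by
  have h := HasFDerivAt.comp (idCoord (k := k) G) (f := fun e => (idCoord (k := k) G, e))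
    hasFDerivAt_fderiv_chartMul
    (hasFDerivAt_prodMk_right (𝕜 := ℝ) (idCoord (k := k) G) (idCoord (k := k) G))
  have h2 := h.clm_apply (hasFDerivAt_const (w, (0 : E k)) (idCoord (k := k) G))
  refine (h2.congr_of_eventuallyEq ?_).congr_fderiv ?_
  · filter_upwards [idChart_target_mem_nhds (idCoord_mem_target (k := k) (G := G))] with z hz
    simp [chartR_eq hz]
  · ext1 v; simp

/-- Infinitesimal form of `g * y = (g * y * g⁻¹) * g`. It is the source of the derivative of the
adjoint action. -/
theorem chartL_eq_chartR_comp_AdL {x : E k} (hx : x ∈ (idChart (k := k) G).target) :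
    chartL G x = (chartR G x).comp (AdL ((idChart G).symm x)) := by
  have := isTopologicalGroup_of_lieGroup (k := k) (G := G) inferInstance
  set g := (idChart G).symm x
  have h1 : HasFDerivAt (fun y => chartMul G y x) (chartR G x) (chartConj g (idCoord (k := k) G)) := by
    rw [chartConj_idCoord]; exact hasFDerivAt_chartR hx
  refine (hasFDerivAt_chartL hx).unique
    ((h1.comp _ (hasFDerivAt_chartConj g)).congr_of_eventuallyEq ?_)
  have ht : Tendsto (fun y => g * (idChart (k := k) G).symm y * g⁻¹) (𝓝 (idCoord G)) (𝓝 1) := by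
    have := ((tendsto_idChart_symm (k := k) (G := G)).const_mul g).mul_const g⁻¹
    rwa [mul_one, mul_inv_cancel] at this
  filter_upwards [eventually_symm_idChart (k := k) ht] with y hy
  simp only [Function.comp, chartConj, chartMul, hy]
  congr 1; simp only [g]; group

/-! ### Manifold derivatives versus logarithmic derivatives -/

section Translate

/-- The derivative of right translation by `g`, between the preferred charts at `1` and `g`. -/
def translateR (g : G) : E k →L[ℝ] E k :=
  fderiv ℝ (fun z => extChartAt (𝓡 k) g ((idChart G).symm z * g)) (idCoord G)

theorem hasFDerivAt_translateR (g : G) :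
    HasFDerivAt (fun z => extChartAt (𝓡 k) g ((idChart G).symm z * g)) (translateR g)
      (idCoord (k := k) G) := by
  refine ((contDiffAt_chart_comp (I₂ := 𝓡 k) ?_ ?_).differentiableAt (n := ∞) (by simp)).hasFDerivAt
  · exact (contMDiffAt_extChartAt_symm idCoord_mem_target).mul contMDiffAt_const
  · rw [idChart_symm_idCoord, one_mul]; exact mem_extChartAt_source _

theorem rightTranslate_eq (ξ : E k) (g : G) : rightTranslate ξ g = (translateR g ξ : E k) := by
  have h : MDifferentiableAt (𝓡 k) (𝓡 k) (fun h : G => h * g) 1 :=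
    ((contMDiffAt_id.mul contMDiffAt_const) :
      ContMDiffAt (𝓡 k) (𝓡 k) ∞ (fun h : G => h * g) 1).mdifferentiableAt (by simp)
  have h2 := mfderiv_eq_fderiv_charts h
  rw [rightTranslate]
  refine (congrArg (fun L : E k →L[ℝ] E k => L ξ) h2).trans ?_
  rw [one_mul]
  rfl

/-- The inverse of `translateR`. -/
def translateRInv (g : G) : E k →L[ℝ] E k :=
  fderiv ℝ (fun z => idChart G ((extChartAt (𝓡 k) g).symm z * g⁻¹)) (extChartAt (𝓡 k) g g)

theorem hasFDerivAt_translateRInv (g : G) :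
    HasFDerivAt (fun z : E k => idChart (k := k) G ((extChartAt (𝓡 k) g).symm z * g⁻¹)) (translateRInv g)
      (extChartAt (𝓡 k) g g) := by
  refine ((contDiffAt_chart_comp (I₂ := 𝓡 k) ?_ ?_).differentiableAt (n := ∞) (by simp)).hasFDerivAt
  · exact (contMDiffAt_extChartAt_symm (mem_extChartAt_target _)).mul contMDiffAt_const
  · rw [extChartAt_to_inv, mul_inv_cancel]; exact mem_extChartAt_source _

theorem translateRInv_translateR (g : G) (ξ : E k) : translateRInv g (translateR g ξ) = ξ := by
  have := isTopologicalGroup_of_lieGroup (k := k) (G := G) inferInstance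
  have h1 : HasFDerivAt (fun z : E k => idChart (k := k) G ((extChartAt (𝓡 k) g).symm z * g⁻¹))
      (translateRInv g) (extChartAt (𝓡 k) g ((idChart (k := k) G).symm (idCoord G) * g)) := by
    rw [idChart_symm_idCoord, one_mul]; exact hasFDerivAt_translateRInv g
  have h2 := HasFDerivAt.comp (idCoord (k := k) G)
    (f := fun z : E k => extChartAt (𝓡 k) g ((idChart G).symm z * g)) h1 (hasFDerivAt_translateR g)
  have h3 : (translateRInv g).comp (translateR g) = ContinuousLinearMap.id ℝ (E k) := by
    refine h2.unique ((hasFDerivAt_id (𝕜 := ℝ) (idCoord (k := k) G)).congr_of_eventuallyEq ?_)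
    have ht : Tendsto (fun y : E k => (idChart (k := k) G).symm y * g) (𝓝 (idCoord G)) (𝓝 g) := by
      have := (tendsto_idChart_symm (k := k) (G := G)).mul_const g
      rwa [one_mul] at this
    filter_upwards [ht.eventually (extChartAt_source_mem_nhds (I := 𝓡 k) g),
      idChart_target_mem_nhds (idCoord_mem_target (k := k) (G := G))] with y hy hy2
    simp only [Function.comp, (extChartAt (𝓡 k) g).left_inv hy, mul_inv_cancel_right, id]
    exact (idChart G).right_inv hy2
  exact congrArg (fun L => L ξ) h3

/-- The two sides express the same equation in the preferred chart at `W τ` and, after right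
translation by `(W τ)⁻¹`, in the chart at the identity. `translateR` passes from the second to the
first, and its left inverse goes back. -/
theorem hasMFDerivWithinAt_iff_hasLogDerivWithinAt {W : ℝ → G} {a : E k} {s : Set ℝ} {τ : ℝ} :
    HasMFDerivWithinAt 𝓘(ℝ, ℝ) (𝓡 k) W s τ
      (ContinuousLinearMap.toSpanSingleton ℝ (-rightTranslate a (W τ))) ↔
    HasLogDerivWithinAt W (-a) s τ := by
  have := isTopologicalGroup_of_lieGroup (k := k) (G := G) inferInstance
  have e1 : HasMFDerivWithinAt 𝓘(ℝ, ℝ) (𝓡 k) W s τ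
      (ContinuousLinearMap.toSpanSingleton ℝ (-rightTranslate a (W τ))) ↔
      ContinuousWithinAt W s τ ∧
        HasDerivWithinAt (fun t => extChartAt (𝓡 k) (W τ) (W t)) (translateR (W τ) (-a)) s τ := by
    rw [map_neg, ← rightTranslate_eq a (W τ)]
    exact hasMFDerivWithinAt_vector_iff
  rw [e1]
  refine and_congr_right fun hc => ?_
  constructor
  · intro h
    have h2 := (hasFDerivAt_translateRInv (W τ)).comp_hasDerivWithinAt τ h
    rw [translateRInv_translateR] at h2
    refine h2.congr_of_eventuallyEq ?_ ?_
    · filter_upwards [hc.tendsto.eventually (extChartAt_source_mem_nhds (I := 𝓡 k) (W τ))] with t ht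
      simp only [Function.comp, (extChartAt (𝓡 k) (W τ)).left_inv ht]
    · simp only [Function.comp, extChartAt_to_inv]
  · intro h
    have h0 : HasFDerivAt (fun z => extChartAt (𝓡 k) (W τ) ((idChart G).symm z * W τ))
        (translateR (W τ)) (idChart (k := k) G (W τ * (W τ)⁻¹)) := by
      rw [mul_inv_cancel]; exact hasFDerivAt_translateR (W τ)
    have h2 := h0.comp_hasDerivWithinAt τ h
    have h3 : HasLogDerivWithinAt W (-a) s τ := ⟨hc, h⟩
    refine h2.congr_of_eventuallyEq ?_ ?_
    · filter_upwards [eventually_symm_idChart (k := k) h3.tendsto] with t ht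
      simp only [Function.comp, ht, inv_mul_cancel_right]
    · simp only [Function.comp, mul_inv_cancel, idChart_symm_idCoord, one_mul]

end Translate

/-! ### Local existence for the equation of a curve with given logarithmic derivative -/

section Curves

theorem HasLogDerivWithinAt.mono {W : ℝ → G} {a : E k} {s s' : Set ℝ} {τ : ℝ}
    (h : HasLogDerivWithinAt W a s τ) (hs : s' ⊆ s) : HasLogDerivWithinAt W a s' τ :=
  ⟨h.1.mono hs, h.2.mono hs⟩

/-- In one fixed chart, translated by `c`, the equation `W' = a W` becomes the ordinary differential
equation `y' = chartR y a`. The next lemma is the converse for `c = 1`. -/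
theorem HasLogDerivWithinAt.hasDerivWithinAt_chart {W : ℝ → G} {a : E k} {s : Set ℝ} {t : ℝ}
    (h : HasLogDerivWithinAt W a s t) (c : G) (hc : W t * c⁻¹ ∈ (idChart (k := k) G).source) :
    HasDerivWithinAt (fun t' => idChart (k := k) G (W t' * c⁻¹))
      (chartR G (idChart G (W t * c⁻¹)) a) s t := by
  have h1 : HasFDerivAt (fun x => chartMul G x (idChart G (W t * c⁻¹)))
      (chartR G (idChart G (W t * c⁻¹))) (idChart (k := k) G (W t * (W t)⁻¹)) := by
    rw [mul_inv_cancel]; exact hasFDerivAt_chartR ((idChart G).map_source hc)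
  refine (h1.comp_hasDerivWithinAt t h.2).congr_of_eventuallyEq ?_ ?_
  · filter_upwards [eventually_symm_idChart (k := k) h.tendsto] with t' ht'
    simp only [Function.comp, chartMul, ht', (idChart G).left_inv hc]
    congr 1; group
  · simp only [Function.comp, chartMul, mul_inv_cancel, idChart_symm_idCoord, one_mul,
      (idChart G).left_inv hc]

theorem hasLogDerivWithinAt_of_chart {y : ℝ → E k} {a : E k} {s : Set ℝ} {t : ℝ}
    (hy : y t ∈ (idChart (k := k) G).target) (h : HasDerivWithinAt y (chartR G (y t) a) s t) :
    HasLogDerivWithinAt (fun t' => (idChart G).symm (y t')) a s t := by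
  have := isTopologicalGroup_of_lieGroup (k := k) (G := G) inferInstance
  have hsymm := contMDiffAt_extChartAt_symm (I₁ := 𝓡 k) (M₁ := G) hy
  refine ⟨hsymm.continuousAt.comp_continuousWithinAt h.continuousWithinAt, ?_⟩
  set g := (idChart G).symm (y t) with hg
  have hd : HasFDerivAt (fun w : E k => idChart (k := k) G ((idChart (k := k) G).symm w * g⁻¹))
      (fderiv ℝ (fun w : E k => idChart G ((idChart (k := k) G).symm w * g⁻¹)) (y t)) (y t) := by
    refine ((contDiffAt_chart_comp (I₂ := 𝓡 k) ?_ ?_).differentiableAt (n := ∞)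
      (by simp)).hasFDerivAt
    · exact hsymm.mul contMDiffAt_const
    · rw [← hg, mul_inv_cancel]; exact mem_extChartAt_source _
  have he : chartMul G (idCoord G) (y t) = y t := by
    simp only [chartMul, idChart_symm_idCoord, one_mul]; exact (idChart G).right_inv hy
  have h1 := HasFDerivAt.comp (idCoord (k := k) G) (by rwa [he]) (hasFDerivAt_chartR hy)
  have h2 := h1.unique
    ((hasFDerivAt_id (𝕜 := ℝ) (idCoord (k := k) G)).congr_of_eventuallyEq (by
      have ht : Tendsto (fun x : E k => (idChart (k := k) G).symm x * g) (𝓝 (idCoord G)) (𝓝 g) := by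
        have := (tendsto_idChart_symm (k := k) (G := G)).mul_const g
        rwa [one_mul] at this
      filter_upwards [ht.eventually ((isOpen_extChartAt_source (I := 𝓡 k) (1 : G)).mem_nhds
        ((idChart G).map_target hy)),
        idChart_target_mem_nhds (idCoord_mem_target (k := k) (G := G))] with x hx hx2
      simp only [Function.comp, chartMul, ← hg, (idChart G).left_inv hx, mul_inv_cancel_right, id]
      exact (idChart G).right_inv hx2))
  have h3 := hd.comp_hasDerivWithinAt t h
  have h4 := congrArg (fun L => L a) h2
  simp only [ContinuousLinearMap.comp_apply, ContinuousLinearMap.id_apply] at h4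
  rw [h4] at h3
  exact h3

/-- Picard–Lindelöf for `y' = chartR y (C t)` in the chart. The vector field is Lipschitz in `y`
because `chartR` is continuously differentiable near the identity. -/
theorem exists_hasLogDerivWithinAt {C : ℝ → E k} (hC : Continuous C) :
    ∃ δ > 0, ∃ U : ℝ → G, U 0 = 1 ∧
      ∀ s ∈ Icc (-δ) δ, HasLogDerivWithinAt U (C s) (Icc (-δ) δ) s := by
  have hR := contDiffAt_chartR (G := G) (idCoord_mem_target (k := k))
  obtain ⟨K, s, hs, hK⟩ := hR.exists_lipschitzOnWith
  obtain ⟨r, hr, hrs⟩ := Metric.nhds_basis_closedBall.mem_iff.1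
    (inter_mem hs (idChart_target_mem_nhds (idCoord_mem_target (k := k) (G := G))))
  obtain ⟨Cm, hCm⟩ := isCompact_Icc.exists_bound_of_continuousOn (s := Icc (-1 : ℝ) 1)
    hC.continuousOn
  have hCm0 : 0 ≤ Cm := (norm_nonneg _).trans (hCm 0 (by simp))
  lift Cm to NNReal using hCm0
  lift r to NNReal using hr.le
  have hRb : ∀ y ∈ Metric.closedBall (idCoord (k := k) G) r, ‖chartR G y‖ ≤ K * r + 1 := by
    intro y hy
    have h1 := hK.dist_le_mul y (hrs hy).1 _ (mem_of_mem_nhds hs)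
    rw [chartR_idCoord, dist_eq_norm] at h1
    calc ‖chartR G y‖ = ‖(chartR G y - ContinuousLinearMap.id ℝ (E k))
          + ContinuousLinearMap.id ℝ (E k)‖ := by simp
      _ ≤ _ := norm_add_le _ _
      _ ≤ K * r + 1 := by
        refine add_le_add (h1.trans ?_) ContinuousLinearMap.norm_id_le
        exact mul_le_mul_of_nonneg_left hy K.2
  -- `L` bounds the speed on the ball of radius `r`, so a time `δ ≤ r / (L + 1)` is too short to
  -- leave that ball.
  set L : NNReal := (K * r + 1) * Cm with hL
  set δ : ℝ := min 1 (r / (L + 1)) with hδ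
  have hδ0 : 0 < δ := lt_min one_pos (div_pos hr (by positivity))
  have hδ1 : δ ≤ 1 := min_le_left _ _
  have hsub : Icc (-δ) δ ⊆ Icc (-1 : ℝ) 1 := Icc_subset_Icc (by linarith) hδ1
  have h0 : (0 : ℝ) ∈ Icc (-δ) δ := ⟨by linarith, hδ0.le⟩
  have hPL : IsPicardLindelof (fun t y => chartR G y (C t)) (tmin := -δ) (tmax := δ) ⟨0, h0⟩
      (idCoord (k := k) G) r 0 L (K * Cm) := by
    refine ⟨fun t ht => ?_, fun y hy => ?_, fun t ht y hy => ?_, ?_⟩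
    · refine LipschitzOnWith.of_dist_le_mul fun y hy z hz => ?_
      have h1 := hK.dist_le_mul y (hrs hy).1 z (hrs hz).1
      rw [dist_eq_norm] at h1 ⊢
      rw [← sub_apply]
      calc _ ≤ ‖chartR G y - chartR G z‖ * ‖C t‖ := ContinuousLinearMap.le_opNorm _ _
        _ ≤ (K * dist y z) * Cm :=
          mul_le_mul h1 (hCm t (hsub ht)) (norm_nonneg _) (by positivity)
        _ = _ := by push_cast; ring
    · exact ((chartR G y).continuous.comp hC).continuousOn
    · calc _ ≤ ‖chartR G y‖ * ‖C t‖ := ContinuousLinearMap.le_opNorm _ _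
        _ ≤ (K * r + 1) * Cm :=
          mul_le_mul (hRb y hy) (hCm t (hsub ht)) (norm_nonneg _) (by positivity)
        _ = _ := by rw [hL]; push_cast; ring
    · simp only [sub_zero, zero_sub, neg_neg, max_self, NNReal.coe_zero]
      calc (L : ℝ) * δ ≤ L * (r / (L + 1)) := by gcongr; exact min_le_right _ _
        _ = L / (L + 1) * r := by ring
        _ ≤ 1 * r := by gcongr; rw [div_le_one (by positivity)]; linarith
        _ = r := one_mul _
  obtain ⟨y, hy0, hy⟩ := hPL.exists_eq_forall_mem_Icc_hasDerivWithinAt₀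
  -- The solution obtained is not known to stay in the chart, so the time interval is shrunk by
  -- continuity at `0`.
  have hmem : ∀ᶠ t in 𝓝 (0 : ℝ), t ∈ Icc (-δ) δ ∧ y t ∈ (idChart (k := k) G).target := by
    have hI : Icc (-δ) δ ∈ 𝓝 (0 : ℝ) := Icc_mem_nhds (by linarith) hδ0
    have hc : ContinuousAt y 0 := (hy 0 h0).continuousWithinAt.continuousAt hI
    refine (eventually_mem_set.2 hI).and (hc.eventually (idChart_target_mem_nhds ?_))
    simp only [hy0]; exact idCoord_mem_target
  obtain ⟨ε, hε, hεs⟩ := Metric.nhds_basis_closedBall.eventually_iff.1 hmem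
  have hball : Metric.closedBall (0 : ℝ) ε = Icc (-ε) ε := by
    rw [Real.closedBall_eq_Icc]; simp
  rw [hball] at hεs
  refine ⟨ε, hε, fun t => (idChart G).symm (y t), ?_, fun t ht => ?_⟩
  · simp only [hy0]; exact idChart_symm_idCoord
  · exact hasLogDerivWithinAt_of_chart (hεs ht).2
      ((hy t (hεs ht).1).mono fun t' ht' => (hεs ht').1)

end Curves

end LieCharts

/-! ### The Lie bracket as a second derivative, and the derivative of the adjoint action -/

section Bracket

variable {k : ℕ} {G : Type*} [TopologicalSpace G] [ChartedSpace (E k) G] [Group G]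

/-- The Lie bracket as a continuous bilinear map. -/
def bracketL (G : Type*) [TopologicalSpace G] [ChartedSpace (E k) G] [Group G] :
    E k →L[ℝ] E k →L[ℝ] E k :=
  let Q : E k →L[ℝ] E k →L[ℝ] E k := (ContinuousLinearMap.inr ℝ (E k) (E k)).precomp (E k) ∘L
    ((chartMulSnd G).comp (ContinuousLinearMap.inl ℝ (E k) (E k)))
  Q - Q.flip

theorem bracketL_apply (v w : E k) :
    bracketL G v w = chartMulSnd G (v, 0) (0, w) - chartMulSnd G (w, 0) (0, v) := rfl

variable [LieGroup (𝓡 k) ∞ G]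

theorem mfderiv_mul_left_one (g : G) (v : E k) :
    (mfderiv (𝓡 k) (𝓡 k) (fun h : G => g * h) 1 : E k →L[ℝ] E k) v =
      fderiv ℝ (fun y => extChartAt (𝓡 k) g (g * (idChart G).symm y)) (idCoord G) v := by
  have h : MDifferentiableAt (𝓡 k) (𝓡 k) (fun h : G => g * h) 1 :=
    ((contMDiffAt_const.mul contMDiffAt_id) :
      ContMDiffAt (𝓡 k) (𝓡 k) ∞ (fun h : G => g * h) 1).mdifferentiableAt (by simp)
  have h2 := mfderiv_eq_fderiv_charts h
  refine (congrArg (fun L : E k →L[ℝ] E k => L v) h2).trans ?_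
  rw [mul_one]

/-- A left-invariant field is the derivative at `1` of left multiplication, which in the chart is
`chartL`. Its derivative at the identity is then a mixed second derivative of the multiplication. -/
theorem mpullback_mulInvariantVectorField_idChart (v : E k) {z : E k}
    (hz : z ∈ (idChart (k := k) G).target) :
    (VectorField.mpullbackWithin 𝓘(ℝ, E k) (𝓡 k) (idChart (k := k) G).symm
      (mulInvariantVectorField (I := 𝓡 k) (G := G) v) (range (𝓡 k)) z : E k) = chartL G z v := by
  have := isTopologicalGroup_of_lieGroup (k := k) (G := G) inferInstance
  rw [VectorField.mpullbackWithin_apply]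
  have hinv := isInvertible_mfderivWithin_extChartAt_symm (I := 𝓡 k) (x := (1 : G)) hz
  refine (hinv.inverse_apply_eq).2 ?_
  have hr : range (𝓡 k) = (univ : Set (E k)) := (𝓡 k).range_eq_univ
  set g := (idChart (k := k) G).symm z with hg
  have hd : MDifferentiableAt 𝓘(ℝ, E k) (𝓡 k) (idChart (k := k) G).symm z :=
    (contMDiffAt_extChartAt_symm (I₁ := 𝓡 k) (M₁ := G) hz).mdifferentiableAt (by simp)
  have h1 : (mfderivWithin 𝓘(ℝ, E k) (𝓡 k) (idChart (k := k) G).symm (range (𝓡 k)) z :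
      E k →L[ℝ] E k) = fderiv ℝ (fun y => extChartAt (𝓡 k) g ((idChart (k := k) G).symm y)) z := by
    rw [hr, mfderivWithin_univ]
    exact mfderiv_eq_fderiv_charts hd
  have h2 : HasFDerivAt (fun y => extChartAt (𝓡 k) g ((idChart (k := k) G).symm y))
      (fderiv ℝ (fun y => extChartAt (𝓡 k) g ((idChart (k := k) G).symm y)) z)
      (chartMul G z (idCoord G)) := by
    have he : chartMul G z (idCoord G) = z := by
      simp only [chartMul, idChart_symm_idCoord, mul_one]; exact (idChart G).right_inv hz
    rw [he]
    refine ((contDiffAt_chart_comp (I₂ := 𝓡 k) (contMDiffAt_extChartAt_symm hz)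
      ?_).differentiableAt (n := ∞) (by simp)).hasFDerivAt
    rw [← hg]; exact mem_extChartAt_source _
  have h3 := (h2.comp _ (hasFDerivAt_chartL hz)).congr_of_eventuallyEq
    (f₁ := fun y => extChartAt (𝓡 k) g (g * (idChart G).symm y)) (by
      have ht : Tendsto (fun y : E k => g * (idChart (k := k) G).symm y) (𝓝 (idCoord G)) (𝓝 g) := by
        have := (tendsto_idChart_symm (k := k) (G := G)).const_mul g
        rwa [mul_one] at this
      filter_upwards [ht.eventually ((isOpen_extChartAt_source (I := 𝓡 k) (1 : G)).mem_nhds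
        ((idChart G).map_target hz))] with y hy
      exact congrArg (extChartAt (𝓡 k) g) ((idChart G).left_inv hy).symm)
  refine (mfderiv_mul_left_one g v).trans ?_
  rw [h3.fderiv]
  exact (congrArg (fun L : E k →L[ℝ] E k => L (chartL G z v)) h1).symm

/-- The group bracket is the vector field bracket of the fields `z ↦ chartL G z v` at the identity.
There the fields have value `v`, and their derivatives are the mixed second derivatives of the
multiplication. -/
theorem bracket_eq_bracketL (v w : E k) : bracket G v w = bracketL G v w := by
  let D : E k →L[ℝ] E k := mfderiv (𝓡 k) 𝓘(ℝ, E k) (idChart (k := k) G) 1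
  have hmd : D = ContinuousLinearMap.id ℝ (E k) := by
    have h' : HasFDerivAt (fun z : E k => extChartAt 𝓘(ℝ, E k) (idCoord (k := k) G)
        (idChart (k := k) G ((idChart (k := k) G).symm z))) (ContinuousLinearMap.id ℝ (E k))
        (idCoord (k := k) G) := by
      refine (hasFDerivAt_id (𝕜 := ℝ) (idCoord (k := k) G)).congr_of_eventuallyEq ?_
      filter_upwards [idChart_target_mem_nhds (idCoord_mem_target (k := k) (G := G))] with z hz
      exact (idChart (k := k) G).right_inv hz
    have h : HasMFDerivAt (𝓡 k) 𝓘(ℝ, E k) (idChart (k := k) G) 1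
        (ContinuousLinearMap.id ℝ (E k)) :=
      hasMFDerivAt_charts_iff.2 ⟨continuousAt_extChartAt _, h'⟩
    exact h.mfderiv
  have hnear := idChart_target_mem_nhds (idCoord_mem_target (k := k) (G := G))
  set V : E k → E k → E k := fun v z => VectorField.mpullbackWithin 𝓘(ℝ, E k) (𝓡 k)
    (idChart (k := k) G).symm (mulInvariantVectorField (I := 𝓡 k) (G := G) v) (range (𝓡 k)) z
    with hV
  have hVd : ∀ v, HasFDerivAt (V v)
      (((chartMulSnd G).flip (0, v)).comp (ContinuousLinearMap.inl ℝ (E k) (E k)))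
      (idCoord (k := k) G) := by
    intro v
    refine (hasFDerivAt_chartL_apply v).congr_of_eventuallyEq ?_
    filter_upwards [hnear] with z hz using mpullback_mulInvariantVectorField_idChart v hz
  have hVe : ∀ v, V v (idCoord (k := k) G) = v := by
    intro v
    refine (mpullback_mulInvariantVectorField_idChart v idCoord_mem_target).trans ?_
    rw [chartL_idCoord]; rfl
  have h1 : bracket G v w = D.inverse (VectorField.lieBracketWithin ℝ (V v) (V w)
        ((idChart (k := k) G).symm ⁻¹' univ ∩ range (𝓡 k)) (idCoord (k := k) G)) := rfl
  rw [h1, hmd, (𝓡 k).range_eq_univ, preimage_univ, univ_inter, VectorField.lieBracketWithin_univ,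
    VectorField.lieBracket, (hVd v).fderiv, (hVd w).fderiv, hVe, hVe]
  simp [bracketL_apply]

theorem bracket_self (v : E k) : bracketL G v v = 0 := by simp [bracketL_apply]

theorem bracketL_antisymm (v w : E k) : bracketL G v w = -bracketL G w v := by
  simp [bracketL_apply]

/-- The derivative of `Ad` is `ad`. Near the identity `chartR` is invertible, so `chartL = chartR ∘
AdL` shows first that `AdL` is differentiable. The Leibniz rule then makes its derivative the
difference of those of `chartL` and `chartR`, two mixed second derivatives whose difference is the
bracket. -/
theorem hasFDerivAt_AdL (η : E k) :
    HasFDerivAt (fun x => AdL ((idChart (k := k) G).symm x) η) ((bracketL G).flip η)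
      (idCoord (k := k) G) := by
  have hnear := idChart_target_mem_nhds (idCoord_mem_target (k := k) (G := G))
  have hR := contDiffAt_chartR (G := G) (idCoord_mem_target (k := k))
  have hinv : ∀ᶠ x in 𝓝 (idCoord (k := k) G), (chartR G x).IsInvertible := by
    have h1 : range ((↑) : (E k ≃L[ℝ] E k) → E k →L[ℝ] E k) ∈ 𝓝 (chartR G (idCoord (k := k) G)) := by
      rw [chartR_idCoord]; exact ContinuousLinearEquiv.nhds (ContinuousLinearEquiv.refl ℝ (E k))
    exact hR.continuousAt.eventually h1
  have hI : DifferentiableAt ℝ (fun x => (chartR G x).inverse (chartL G x η))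
      (idCoord (k := k) G) := by
    have h1 : DifferentiableAt ℝ (ContinuousLinearMap.inverse : (E k →L[ℝ] E k) → E k →L[ℝ] E k)
        (chartR G (idCoord (k := k) G)) := by
      rw [chartR_idCoord]
      exact (contDiffAt_map_inverse (n := 1) (ContinuousLinearEquiv.refl ℝ (E k))).differentiableAt
        (by simp)
    exact (h1.comp _ (hR.differentiableAt (by simp))).clm_apply
      (hasFDerivAt_chartL_apply η).differentiableAt
  have heq : (fun x => AdL ((idChart (k := k) G).symm x) η) =ᶠ[𝓝 (idCoord (k := k) G)]
      fun x => (chartR G x).inverse (chartL G x η) := by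
    filter_upwards [hnear, hinv] with x hx hx2
    rw [eq_comm, hx2.inverse_apply_eq, chartL_eq_chartR_comp_AdL hx]
    rfl
  have hf := (hI.congr_of_eventuallyEq heq).hasFDerivAt
  set D := fderiv ℝ (fun x => AdL ((idChart (k := k) G).symm x) η) (idCoord (k := k) G)
  have h2 := (hR.differentiableAt (by simp)).hasFDerivAt.clm_apply hf
  have h3 := h2.congr_of_eventuallyEq (f₁ := fun x => chartL G x η) (by
    filter_upwards [hnear] with x hx
    rw [chartL_eq_chartR_comp_AdL hx, ContinuousLinearMap.comp_apply])
  have h4 := h3.unique (hasFDerivAt_chartL_apply η)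
  have h5 := (((hR.differentiableAt (by simp)).hasFDerivAt.clm_apply
    (hasFDerivAt_const η (idCoord (k := k) G)))).unique (hasFDerivAt_chartR_apply η)
  refine hf.congr_fderiv ?_
  ext1 v
  have e4 := congrArg (fun L => L v) h4
  have e5 := congrArg (fun L => L v) h5
  simp only [add_apply, ContinuousLinearMap.comp_apply,
    ContinuousLinearMap.flip_apply, chartR_idCoord, idChart_symm_idCoord, AdL_one,
    ContinuousLinearMap.id_apply, ContinuousLinearMap.inl_apply, ContinuousLinearMap.inr_apply,
    zero_apply, zero_add, map_zero] at e4 e5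
  rw [e5] at e4
  rw [ContinuousLinearMap.flip_apply, bracketL_apply, ← e4,
    chartMulSnd_symm (0, v) (η, 0)]
  abel

theorem HasLogDerivWithinAt.hasDerivWithinAt_AdL {U : ℝ → G} {a : E k} {s : Set ℝ} {τ : ℝ}
    (h : HasLogDerivWithinAt U a s τ) (η : E k) :
    HasDerivWithinAt (fun t => AdL (U t) η) (bracketL G a (AdL (U τ) η)) s τ := by
  have h1 : HasFDerivAt (fun x => AdL ((idChart (k := k) G).symm x) (AdL (U τ) η))
      ((bracketL G).flip (AdL (U τ) η)) (idChart (k := k) G (U τ * (U τ)⁻¹)) := by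
    rw [mul_inv_cancel]; exact hasFDerivAt_AdL _
  refine (h1.comp_hasDerivWithinAt τ h.2).congr_of_eventuallyEq ?_ ?_
  · filter_upwards [eventually_symm_idChart (k := k) h.tendsto] with t ht
    simp only [Function.comp, ht]
    rw [← ContinuousLinearMap.comp_apply, ← AdL_mul, inv_mul_cancel_right]
  · simp only [Function.comp, mul_inv_cancel, idChart_symm_idCoord, AdL_one,
      ContinuousLinearMap.id_apply]

/-- Differentiating `U₁ s * U₂ t * (U₁ s)⁻¹ = U₂ t` in `t` at `0` gives `Ad (U₁ s) C₂ = C₂`;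
differentiating this in `s` at `0` gives the bracket. -/
theorem bracketL_eq_zero_of_commute {C₁ C₂ : E k} {U₁ U₂ : ℝ → G} {δ₁ δ₂ : ℝ}
    (hδ₁ : 0 < δ₁) (hδ₂ : 0 < δ₂) (hU₁ : HasLogDerivWithinAt U₁ C₁ (Icc 0 δ₁) 0)
    (hU₂ : HasLogDerivWithinAt U₂ C₂ (Icc 0 δ₂) 0) (h₁ : U₁ 0 = 1) (h₂ : U₂ 0 = 1)
    (hcomm : ∀ s ∈ Icc 0 δ₁, ∀ t ∈ Icc 0 δ₂, U₁ s * U₂ t = U₂ t * U₁ s) :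
    bracketL G C₁ C₂ = 0 := by
  have hA : ∀ s ∈ Icc 0 δ₁, AdL (U₁ s) C₂ = C₂ := by
    intro s hs
    have hd : HasFDerivAt (chartConj (U₁ s)) (AdL (U₁ s)) (idChart (k := k) G (U₂ 0 * (U₂ 0)⁻¹)) := by
      rw [mul_inv_cancel]; exact hasFDerivAt_chartConj _
    have h3 := hd.comp_hasDerivWithinAt 0 hU₂.2
    refine (uniqueDiffOn_Icc hδ₂ 0 ⟨le_rfl, hδ₂.le⟩).eq_deriv _ h3
      (hU₂.2.congr_of_eventuallyEq ?_ ?_)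
    · filter_upwards [eventually_symm_idChart (k := k) hU₂.tendsto, self_mem_nhdsWithin] with t ht ht2
      simp only [Function.comp, chartConj, ht]
      rw [h₂, inv_one, mul_one, hcomm s hs t ht2, mul_inv_cancel_right]
    · simp only [Function.comp, mul_inv_cancel]
      exact chartConj_idCoord _
  have h4 := hU₁.hasDerivWithinAt_AdL C₂
  have h5 : HasDerivWithinAt (fun t => AdL (U₁ t) C₂) 0 (Icc 0 δ₁) 0 :=
    (hasDerivWithinAt_const _ _ C₂).congr (fun t ht => hA t ht) (hA 0 ⟨le_rfl, hδ₁.le⟩)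
  have h6 := (uniqueDiffOn_Icc hδ₁ 0 ⟨le_rfl, hδ₁.le⟩).eq_deriv _ h4 h5
  rwa [h₁, AdL_one] at h6

end Bracket

/-! ### Uniqueness of Wilson lines -/

section Uniqueness

variable {k : ℕ} {G : Type*} [TopologicalSpace G] [ChartedSpace (E k) G] [Group G]
  [LieGroup (𝓡 k) ∞ G]

/-- The mean value inequality, in the chart translated to `V t`, gives local constancy;
connectedness does the rest. -/
theorem eq_of_hasLogDerivWithinAt_zero {V : ℝ → G} {S : Set ℝ} (hS : Convex ℝ S)
    (h : ∀ t ∈ S, HasLogDerivWithinAt (k := k) V 0 S t) {x y : ℝ} (hx : x ∈ S) (hy : y ∈ S) :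
    V x = V y := by
  refine eqOn_of_eventually_eq hS.isPreconnected (fun t ht => ?_) hx hy
  have h1 := (h t ht).tendsto.eventually (extChartAt_source_mem_nhds (I := 𝓡 k) (1 : G))
  obtain ⟨ε, hε, hs⟩ := Metric.mem_nhdsWithin_iff.1 h1
  have hconv : Convex ℝ (Metric.ball t ε ∩ S) := (convex_ball t ε).inter hS
  filter_upwards [inter_mem_nhdsWithin S (Metric.ball_mem_nhds t hε)] with t' ht'
  have hd : ∀ r ∈ Metric.ball t ε ∩ S, HasDerivWithinAt
      (fun r => idChart (k := k) G (V r * (V t)⁻¹)) 0 (Metric.ball t ε ∩ S) r := by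
    intro r hr
    have := (h r hr.2).hasDerivWithinAt_chart (V t) (hs hr)
    rw [map_zero] at this
    exact this.mono inter_subset_right
  have h2 := hconv.norm_image_sub_le_of_norm_hasDerivWithin_le (C := 0) hd (by simp)
    (⟨Metric.mem_ball_self hε, ht⟩) (⟨ht'.2, ht'.1⟩)
  have h3 : idChart (k := k) G (V t' * (V t)⁻¹) = idChart (k := k) G (V t * (V t)⁻¹) := by
    rw [← sub_eq_zero, ← norm_le_zero_iff]; simpa using h2
  have h4 := (idChart (k := k) G).injOn (hs ⟨ht'.2, ht'.1⟩)
    (hs ⟨Metric.mem_ball_self hε, ht⟩) h3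
  exact mul_right_cancel h4

/-- `V⁻¹ W` has logarithmic derivative `-Ad(V⁻¹) a + Ad(V⁻¹) a = 0`. -/
theorem eqOn_of_hasLogDerivWithinAt {V W : ℝ → G} {a : ℝ → E k} {x y : ℝ} (hxy : x < y)
    (hV : ∀ t ∈ Icc x y, HasLogDerivWithinAt V (a t) (Icc x y) t)
    (hW : ∀ t ∈ Icc x y, HasLogDerivWithinAt W (a t) (Icc x y) t) {t₀ : ℝ} (ht₀ : t₀ ∈ Icc x y)
    (h0 : V t₀ = W t₀) : EqOn V W (Icc x y) := by
  intro t ht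
  have h : ∀ t ∈ Icc x y, HasLogDerivWithinAt (k := k) (fun t => (V t)⁻¹ * W t) 0 (Icc x y) t := by
    intro t ht
    have h1 := ((hV t ht).inv (uniqueDiffOn_Icc hxy t ht)).mul (hW t ht)
    rwa [neg_add_cancel] at h1
  have h2 := eq_of_hasLogDerivWithinAt_zero (convex_Icc x y) h ht ht₀
  simp only [h0, inv_mul_cancel] at h2
  exact (inv_mul_eq_one.1 h2)

theorem isWilsonLine_iff {a : ℝ → E k} {W : ℝ → G} :
    IsWilsonLine a W ↔ W 0 = 1 ∧ ∀ τ ∈ Icc 0 (2 * Real.pi),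
      HasLogDerivWithinAt W (-(a τ)) (Icc 0 (2 * Real.pi)) τ := by
  unfold IsWilsonLine
  refine and_congr_right fun _ => forall₂_congr fun τ _ => ?_
  exact hasMFDerivWithinAt_iff_hasLogDerivWithinAt

/-- Uniqueness makes the choice in the definition harmless, so a holonomy is computed by exhibiting
any explicit solution. -/
theorem holonomy_eq {a : ℝ → E k} {W : ℝ → G} (hW : IsWilsonLine a W) :
    holonomy a = W (2 * Real.pi) := by
  have hex : ∃ W : ℝ → G, IsWilsonLine a W := ⟨W, hW⟩
  rw [holonomy, dif_pos hex]
  have h1 := isWilsonLine_iff.1 hex.choose_spec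
  have h2 := isWilsonLine_iff.1 hW
  have hpi : (0 : ℝ) < 2 * Real.pi := by positivity
  exact eqOn_of_hasLogDerivWithinAt hpi h1.2 h2.2 ⟨le_rfl, hpi.le⟩ (h1.1.trans h2.1.symm)
    ⟨hpi.le, le_rfl⟩

end Uniqueness

/-! ### Differential equations with commuting coefficients -/

section Commuting

variable {k : ℕ} {G : Type*} [TopologicalSpace G] [ChartedSpace (E k) G] [Group G]
  [LieGroup (𝓡 k) ∞ G]

theorem HasLogDerivWithinAt.comp {U : ℝ → G} {ξ : E k} {f : ℝ → ℝ} {c : ℝ} {s s' : Set ℝ} {τ : ℝ}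
    (h : HasLogDerivWithinAt U ξ s (f τ)) (hf : HasDerivWithinAt f c s' τ) (hs : MapsTo f s' s) :
    HasLogDerivWithinAt (fun t => U (f t)) (c • ξ) s' τ :=
  ⟨h.1.comp hf.continuousWithinAt hs, h.2.scomp τ hf hs⟩

theorem HasLogDerivWithinAt.mul_const {U : ℝ → G} {ξ : E k} {s : Set ℝ} {τ : ℝ}
    (h : HasLogDerivWithinAt U ξ s τ) (g : G) : HasLogDerivWithinAt (fun t => U t * g) ξ s τ := by
  have := h.mul (hasLogDerivWithinAt_const (k := k) g s τ)
  rwa [map_zero, add_zero] at this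

/-- The difference `Ad (U t) η - η` vanishes at `0` and, because `[ξ, η] = 0`, solves the linear
equation `f' = [ξ, f]`; Grönwall's inequality makes it zero. -/
theorem AdL_eq_self_of_bracketL_eq_zero_Icc {U : ℝ → G} {ξ η : E k} {R : ℝ}
    (h : ∀ s ∈ Icc 0 R, HasLogDerivWithinAt U ξ (Icc 0 R) s) (h0 : U 0 = 1)
    (hξ : bracketL G ξ η = 0) : ∀ s ∈ Icc 0 R, AdL (U s) η = η := by
  have hd : ∀ s ∈ Icc 0 R, HasDerivWithinAt (fun t => AdL (U t) η - η)
      (bracketL G ξ (AdL (U s) η)) (Icc 0 R) s := fun s hs =>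
    ((h s hs).hasDerivWithinAt_AdL η).sub_const η
  have := eq_zero_of_abs_deriv_le_mul_abs_self_of_eq_zero_right (K := ‖bracketL G ξ‖)
    (f := fun t => AdL (U t) η - η) (f' := fun s => bracketL G ξ (AdL (U s) η)) (a := 0) (b := R)
    (fun s hs => (hd s hs).continuousWithinAt)
    (fun s hs => (hd s ⟨hs.1, hs.2.le⟩).mono_of_mem_nhdsWithin (Icc_mem_nhdsGE_of_mem hs))
    (by simp [h0, AdL_one]) (fun s _ => by
      have : bracketL G ξ (AdL (U s) η) = bracketL G ξ (AdL (U s) η - η) := by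
        rw [map_sub, hξ, sub_zero]
      rw [this]; exact ContinuousLinearMap.le_opNorm _ _)
  exact fun s hs => sub_eq_zero.1 (this s hs)

theorem AdL_eq_self_of_bracketL_eq_zero {U : ℝ → G} {ξ η : E k} {R : ℝ}
    (h : ∀ s ∈ Icc (-R) R, HasLogDerivWithinAt U ξ (Icc (-R) R) s) (h0 : U 0 = 1)
    (hξ : bracketL G ξ η = 0) : ∀ s ∈ Icc (-R) R, AdL (U s) η = η := by
  intro s hs
  have hR : 0 ≤ R := by linarith [hs.1, hs.2]
  rcases le_total 0 s with hs0 | hs0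
  · refine AdL_eq_self_of_bracketL_eq_zero_Icc (R := R) (fun t ht => ?_) h0 hξ s ⟨hs0, hs.2⟩
    exact (h t ⟨by linarith [ht.1], ht.2⟩).mono (Icc_subset_Icc (by linarith) le_rfl)
  · have h1 : ∀ t ∈ Icc 0 R, HasLogDerivWithinAt (fun t => U (-t)) ((-1 : ℝ) • ξ) (Icc 0 R) t := by
      intro t ht
      refine HasLogDerivWithinAt.comp (f := fun t => -t) (h (-t) ⟨by linarith [ht.2], by linarith [ht.1]⟩)
        (hasDerivAt_neg t).hasDerivWithinAt ?_
      intro r hr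
      exact ⟨by linarith [hr.2], by linarith [hr.1]⟩
    have h2 := AdL_eq_self_of_bracketL_eq_zero_Icc (η := η) h1 (by simpa using h0) (by simp [hξ]) (-s)
      ⟨by linarith, by linarith [hs.1]⟩
    simpa using h2

theorem HasLogDerivWithinAt.pow {U : ℝ → G} {ξ : E k} {s : Set ℝ} {τ : ℝ}
    (h : HasLogDerivWithinAt U ξ s τ) (hA : AdL (U τ) ξ = ξ) (n : ℕ) :
    HasLogDerivWithinAt (fun t => U t ^ n) ((n : ℝ) • ξ) s τ := by
  induction n with
  | zero => simpa using hasLogDerivWithinAt_const (k := k) (1 : G) s τ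
  | succ n ih =>
    have h1 := h.mul ih
    have e : ξ + AdL (U τ) ((n : ℝ) • ξ) = ((n + 1 : ℕ) : ℝ) • ξ := by
      rw [map_smul, hA]; push_cast; module
    rw [e] at h1
    simpa only [pow_succ'] using h1

/-- A local solution is prolonged by taking the `n`-th power of its value at time `s / n`. Since `Ad
(U s) ξ = ξ`, the power multiplies the logarithmic derivative by `n`, which cancels the rescaling.
-/
theorem exists_oneParameter (ξ : E k) {R : ℝ} (hR : 0 < R) :
    ∃ U : ℝ → G, U 0 = 1 ∧ ∀ s ∈ Icc (-R) R, HasLogDerivWithinAt U ξ (Icc (-R) R) s := by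
  obtain ⟨δ, hδ, U, hU0, hU⟩ := exists_hasLogDerivWithinAt (G := G) (C := fun _ => ξ)
    continuous_const
  obtain ⟨n, hn⟩ := exists_nat_gt (R / δ)
  have hn0 : (0 : ℝ) < n := (div_pos hR hδ).trans hn
  have hnR : R * (n : ℝ)⁻¹ ≤ δ := by
    rw [← div_eq_mul_inv, div_le_iff₀ hn0]
    rw [div_lt_iff₀ hδ] at hn; linarith
  have hmaps : MapsTo (fun s => s * (n : ℝ)⁻¹) (Icc (-R) R) (Icc (-δ) δ) := by
    intro s hs
    have hi : (0 : ℝ) ≤ (n : ℝ)⁻¹ := by positivity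
    constructor
    · nlinarith [mul_le_mul_of_nonneg_right hs.1 hi]
    · nlinarith [mul_le_mul_of_nonneg_right hs.2 hi]
  refine ⟨fun s => U (s * (n : ℝ)⁻¹) ^ n, by simp [hU0], fun s hs => ?_⟩
  have h1 := HasLogDerivWithinAt.comp (f := fun s => s * (n : ℝ)⁻¹) (hU _ (hmaps hs))
    ((hasDerivAt_id s).mul_const (n : ℝ)⁻¹).hasDerivWithinAt hmaps
  have hA := AdL_eq_self_of_bracketL_eq_zero hU hU0 (bracket_self ξ) _ (hmaps hs)
  have h2 := h1.pow (by rw [map_smul, hA]) n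
  have e : (n : ℝ) • ((1 * (n : ℝ)⁻¹) • ξ) = ξ := by
    rw [smul_smul, one_mul, mul_inv_cancel₀ hn0.ne', one_smul]
  rwa [e] at h2

theorem hasLogDerivWithinAt_list_prod {s : Set ℝ} {τ : ℝ} (l : List ((ℝ → G) × E k))
    (h : ∀ p ∈ l, HasLogDerivWithinAt p.1 p.2 s τ)
    (hA : ∀ p ∈ l, ∀ q ∈ l, AdL (p.1 τ) q.2 = q.2) :
    HasLogDerivWithinAt (fun t => (l.map fun p => p.1 t).prod) (l.map fun p => p.2).sum s τ := by
  induction l with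
  | nil => simpa using hasLogDerivWithinAt_const (k := k) (1 : G) s τ
  | cons p l ih =>
    have h1 := (h p (by simp)).mul (ih (fun q hq => h q (by simp [hq]))
      (fun q hq r hr => hA q (by simp [hq]) r (by simp [hr])))
    have e : AdL (p.1 τ) (l.map fun p => p.2).sum = (l.map fun p => p.2).sum := by
      rw [map_list_sum, List.map_map]
      congr 1
      exact List.map_congr_left fun q hq => hA p (by simp) q (by simp [hq])
    rw [e] at h1
    simpa using h1

theorem bracketL_eq_zero_of_mem_span {S : Set (E k)}
    (hS : ∀ x ∈ S, ∀ y ∈ S, bracketL G x y = 0) {x y : E k} (hx : x ∈ Submodule.span ℝ S)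
    (hy : y ∈ Submodule.span ℝ S) : bracketL G x y = 0 := by
  induction hx using Submodule.span_induction with
  | mem x hx =>
    induction hy using Submodule.span_induction with
    | mem y hy => exact hS x hx y hy
    | zero => simp
    | add y z _ _ h1 h2 => rw [map_add, h1, h2, add_zero]
    | smul c y _ h => rw [map_smul, h, smul_zero]
  | zero => simp
  | add x z _ _ h1 h2 => rw [map_add, add_apply, h1, h2, add_zero]
  | smul c x _ h => rw [map_smul, smul_apply, h, smul_zero]

/-- The holonomy of commuting coefficients depends only on their integral. -/
theorem exists_holonomy_eq_of_commuting {S : Set (E k)}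
    (hS : ∀ x ∈ S, ∀ y ∈ S, bracketL G x y = 0) (M : ℝ) :
    ∃ H : E k → G, ∀ a : ℝ → E k, ContinuousOn a (Icc 0 (2 * Real.pi)) →
      (∀ τ ∈ Icc 0 (2 * Real.pi), a τ ∈ S) → (∀ τ ∈ Icc 0 (2 * Real.pi), ‖a τ‖ ≤ M) →
      holonomy a = H (∫ τ in (0 : ℝ)..(2 * Real.pi), a τ) := by
  have hpi : (0 : ℝ) < 2 * Real.pi := by positivity
  set V := Submodule.span ℝ S with hV
  let b := Module.finBasis ℝ V
  -- the coordinates on `V`, extended to the whole space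
  obtain ⟨pr, hpr⟩ := V.subtype.exists_leftInverse_of_injective (by simp)
  let co : Fin (Module.finrank ℝ V) → E k →L[ℝ] ℝ := fun i =>
    LinearMap.toContinuousLinearMap ((b.coord i).comp pr)
  have hco : ∀ x ∈ V, ∑ i, co i x • (b i : E k) = x := by
    intro x hx
    have h1 : pr x = ⟨x, hx⟩ := congrArg (fun L => L ⟨x, hx⟩) hpr
    have h2 := b.sum_repr ⟨x, hx⟩
    have h3 := congrArg (fun v : V => (v : E k)) h2
    have e : ∀ i, co i x = b.repr ⟨x, hx⟩ i := fun i => by simp [co, h1]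
    simp only [e]
    simpa only [Submodule.coe_sum, Submodule.coe_smul] using h3
  obtain ⟨Q, hQ0, hQ⟩ : ∃ Q : ℝ, 0 < Q ∧ ∀ i, ‖co i‖ ≤ Q := by
    refine ⟨∑ i, ‖co i‖ + 1, by positivity, fun i => ?_⟩
    have := Finset.single_le_sum (f := fun i => ‖co i‖) (fun i _ => norm_nonneg _)
      (Finset.mem_univ i)
    linarith
  -- The one-parameter subgroups are available on bounded intervals only. The bound `M` on the
  -- coefficients fixes, before `a` is given, an interval containing all coordinates of its partial
  -- integrals.
  set R : ℝ := Q * (|M| * (2 * Real.pi)) + 1 with hR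
  have hR0 : 0 < R := by positivity
  choose U hU0 hU using fun i => exists_oneParameter (G := G) (b i : E k) hR0
  -- The solution is the product of one-parameter subgroups along a basis of the span of `S`,
  -- evaluated at minus the coordinates of `∫₀^τ a`. The basis vectors commute, so the logarithmic
  -- derivatives of the factors add up to `-a τ`.
  refine ⟨fun x => (List.ofFn fun i => U i (-(co i x))).prod, fun a ha haS haM => ?_⟩
  let f : ℝ → E k := fun τ => ∫ t in (0 : ℝ)..τ, a t
  have hf : ∀ τ ∈ Icc 0 (2 * Real.pi), HasDerivWithinAt f (a τ) (Icc 0 (2 * Real.pi)) τ := by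
    intro τ hτ
    have hint : IntervalIntegrable a MeasureTheory.volume 0 τ := by
      refine ContinuousOn.intervalIntegrable_of_Icc hτ.1 (ha.mono (Icc_subset_Icc le_rfl hτ.2))
    have : Fact (τ ∈ Icc 0 (2 * Real.pi)) := ⟨hτ⟩
    refine intervalIntegral.integral_hasDerivWithinAt_right hint (s := Icc 0 (2 * Real.pi))
      (t := Icc 0 (2 * Real.pi)) ?_ (ha τ hτ)
    exact ⟨Icc 0 (2 * Real.pi), self_mem_nhdsWithin,
      ha.aestronglyMeasurable measurableSet_Icc⟩
  have hfb : ∀ τ ∈ Icc 0 (2 * Real.pi), ‖f τ‖ ≤ |M| * (2 * Real.pi) := by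
    intro τ hτ
    have h1 := intervalIntegral.norm_integral_le_of_norm_le_const (f := a) (a := 0) (b := τ)
      (C := |M|) (fun t ht => by
        rw [uIoc_of_le hτ.1] at ht
        exact (haM t ⟨ht.1.le, ht.2.trans hτ.2⟩).trans (le_abs_self _))
    refine h1.trans ?_
    rw [sub_zero, abs_of_nonneg hτ.1]
    exact mul_le_mul_of_nonneg_left hτ.2 (abs_nonneg _)
  have hmaps : ∀ i, MapsTo (fun τ => -(co i (f τ))) (Icc 0 (2 * Real.pi)) (Icc (-R) R) := by
    intro i τ hτ
    rw [mem_Icc, ← abs_le, abs_neg, ← Real.norm_eq_abs]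
    calc _ ≤ ‖co i‖ * ‖f τ‖ := ContinuousLinearMap.le_opNorm _ _
      _ ≤ Q * (|M| * (2 * Real.pi)) :=
        mul_le_mul (hQ i) (hfb τ hτ) (norm_nonneg _) hQ0.le
      _ ≤ R := by rw [hR]; linarith
  have hW : IsWilsonLine a (fun τ => (List.ofFn fun i => U i (-(co i (f τ)))).prod) := by
    refine isWilsonLine_iff.2 ⟨?_, fun τ hτ => ?_⟩
    · simp [f, hU0]
    · have h1 := hasLogDerivWithinAt_list_prod (G := G) (s := Icc 0 (2 * Real.pi)) (τ := τ)
        (List.ofFn fun i => ((fun τ => U i (-(co i (f τ)))), (-(co i (a τ))) • (b i : E k)))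
        (by
          intro p hp
          obtain ⟨i, rfl⟩ := List.mem_ofFn.1 hp
          refine HasLogDerivWithinAt.comp (f := fun τ => -(co i (f τ))) (hU i _ (hmaps i hτ)) ?_
            (hmaps i)
          exact (((co i).hasFDerivAt.comp_hasDerivWithinAt τ (hf τ hτ))).neg)
        (by
          intro p hp q hq
          obtain ⟨i, rfl⟩ := List.mem_ofFn.1 hp
          obtain ⟨j, rfl⟩ := List.mem_ofFn.1 hq
          simp only [map_smul]
          rw [AdL_eq_self_of_bracketL_eq_zero (hU i) (hU0 i) ?_ _ (hmaps i hτ)]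
          exact bracketL_eq_zero_of_mem_span hS (b i).2 (b j).2)
      simp only [List.map_ofFn, Function.comp_def, List.sum_ofFn] at h1
      have e : ∑ i, -(co i (a τ)) • (b i : E k) = -(a τ) := by
        conv_rhs => rw [← hco (a τ) (Submodule.subset_span (haS τ hτ))]
        rw [← Finset.sum_neg_distrib]
        exact Finset.sum_congr rfl fun i _ => neg_smul _ _
      rwa [e] at h1
  exact holonomy_eq hW

end Commuting

/-! ### Two forms of Grönwall's inequality -/

section Gronwall

variable {F : Type*} [NormedAddCommGroup F] [NormedSpace ℝ F]

theorem norm_le_of_norm_deriv_le {f f' : ℝ → F} {K ε : ℝ} (hK : 0 < K) (hε : 0 ≤ ε)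
    (hf : ∀ t ∈ Icc (0 : ℝ) 1, HasDerivWithinAt f (f' t) (Icc 0 1) t) (h0 : f 0 = 0)
    (hb : ∀ t ∈ Icc (0 : ℝ) 1, ‖f' t‖ ≤ K * ‖f t‖ + ε) :
    ∀ t ∈ Icc (0 : ℝ) 1, ‖f t‖ ≤ Real.exp K / K * ε := by
  intro t ht
  have h := norm_le_gronwallBound_of_norm_deriv_right_le (f := f) (f' := f') (δ := 0) (K := K)
    (ε := ε) (a := 0) (b := 1) (fun s hs => (hf s hs).continuousWithinAt)
    (fun s hs => (hf s ⟨hs.1, hs.2.le⟩).mono_of_mem_nhdsWithin (Icc_mem_nhdsGE_of_mem hs))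
    (by simp [h0]) (fun s hs => hb s ⟨hs.1, hs.2.le⟩) t ht
  simp only [gronwallBound_of_K_ne_0 hK.ne', zero_mul, zero_add, sub_zero] at h
  refine h.trans ?_
  have h1 : Real.exp (K * t) ≤ Real.exp K := Real.exp_le_exp.2 (by nlinarith [ht.2])
  calc ε / K * (Real.exp (K * t) - 1) ≤ ε / K * Real.exp K := by
        refine mul_le_mul_of_nonneg_left (by linarith) (by positivity)
    _ = _ := by ring

theorem eq_zero_of_norm_deriv_le {f f' : ℝ → F} {K a b t₀ : ℝ}
    (hf : ∀ t ∈ Icc a b, HasDerivWithinAt f (f' t) (Icc a b) t) (h0 : f t₀ = 0)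
    (ht₀ : t₀ ∈ Icc a b) (hb : ∀ t ∈ Icc a b, ‖f' t‖ ≤ K * ‖f t‖) : ∀ t ∈ Icc a b, f t = 0 := by
  have fwd : ∀ (f f' : ℝ → F) (a b : ℝ),
      (∀ t ∈ Icc a b, HasDerivWithinAt f (f' t) (Icc a b) t) → f a = 0 →
      (∀ t ∈ Icc a b, ‖f' t‖ ≤ K * ‖f t‖) → ∀ t ∈ Icc a b, f t = 0 := by
    intro f f' a b hf h0 hb
    exact eq_zero_of_abs_deriv_le_mul_abs_self_of_eq_zero_right (K := K) (f' := f')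
      (fun s hs => (hf s hs).continuousWithinAt)
      (fun s hs => (hf s ⟨hs.1, hs.2.le⟩).mono_of_mem_nhdsWithin (Icc_mem_nhdsGE_of_mem hs)) h0
      (fun s hs => hb s ⟨hs.1, hs.2.le⟩)
  intro t ht
  rcases le_total t₀ t with h | h
  · exact fwd f f' t₀ b (fun s hs => (hf s ⟨ht₀.1.trans hs.1, hs.2⟩).mono
      (Icc_subset_Icc ht₀.1 le_rfl)) h0 (fun s hs => hb s ⟨ht₀.1.trans hs.1, hs.2⟩) t ⟨h, ht.2⟩
  · have hm : MapsTo (fun s : ℝ => -s) (Icc (-t₀) (-a)) (Icc a b) := fun s hs =>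
      ⟨by linarith [hs.2], by linarith [hs.1, ht₀.2]⟩
    have := fwd (fun s => f (-s)) (fun s => (-1 : ℝ) • f' (-s)) (-t₀) (-a) (fun s hs => by
      exact (hf (-s) (hm hs)).scomp s (hasDerivAt_neg s).hasDerivWithinAt hm) (by simpa using h0)
      (fun s hs => by
        rw [norm_smul]; simpa using hb (-s) (hm hs)) (-t) ⟨by linarith, by linarith [ht.1]⟩
    simpa using this

end Gronwall

/-! ### Frobenius theorem for total differential equations -/

section Frobenius

variable {V F : Type*} [NormedAddCommGroup V] [NormedSpace ℝ V] [FiniteDimensional ℝ V]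
  [NormedAddCommGroup F] [NormedSpace ℝ F] [FiniteDimensional ℝ F]

theorem exists_lipschitzWith_fderiv {W Z : Type*} [NormedAddCommGroup W] [NormedSpace ℝ W]
    [NormedAddCommGroup Z] [NormedSpace ℝ Z] {U : W → Z} (hU : ContDiff ℝ ∞ U)
    (hUc : HasCompactSupport U) : ∃ C, LipschitzWith C (fderiv ℝ U) := by
  have hU' : ContDiff ℝ ∞ (fderiv ℝ U) := hU.fderiv_right (by norm_cast)
  exact hU'.lipschitzWith_of_hasCompactSupport (hUc.fderiv (𝕜 := ℝ)) (by simp)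

theorem exists_norm_fderiv_le {W Z : Type*} [NormedAddCommGroup W] [NormedSpace ℝ W]
    [NormedAddCommGroup Z] [NormedSpace ℝ Z] {U : W → Z} (hU : ContDiff ℝ ∞ U)
    (hUc : HasCompactSupport U) : ∃ B, ∀ x, ‖fderiv ℝ U x‖ ≤ B :=
  (hU.continuous_fderiv (by simp)).bounded_above_of_compact_support (hUc.fderiv (𝕜 := ℝ))

theorem norm_sub_sub_fderiv_le {W Z : Type*} [NormedAddCommGroup W] [NormedSpace ℝ W]
    [NormedAddCommGroup Z] [NormedSpace ℝ Z] {U : W → Z} (hU : Differentiable ℝ U) {C : NNReal}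
    (hC : LipschitzWith C (fderiv ℝ U)) (p q : W) :
    ‖U q - U p - fderiv ℝ U p (q - p)‖ ≤ C * ‖q - p‖ ^ 2 := by
  have h := (convex_closedBall p ‖q - p‖).norm_image_sub_le_of_norm_hasFDerivWithin_le'
    (f := U) (f' := fderiv ℝ U) (φ := fderiv ℝ U p) (C := C * ‖q - p‖) (x := p) (y := q)
    (fun x _ => (hU x).hasFDerivAt.hasFDerivWithinAt) (fun x hx => ?_) (by simp)
    (by simp [dist_eq_norm])
  · rw [pow_two, ← mul_assoc]; exact h
  · have := hC.dist_le_mul x p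
    rw [dist_eq_norm] at this
    exact this.trans (mul_le_mul_of_nonneg_left hx C.2)

set_option maxHeartbeats 400000 in
/-- A total differential equation `dy = U(x, y) dx` satisfying the integrability condition near a
point has a local solution through this point. -/
theorem exists_hasFDerivAt_of_integrable_aux {U : V × F → V →L[ℝ] F} (hU : ContDiff ℝ ∞ U)
    (hUc : HasCompactSupport U) {x₀ : V} {y₀ : F} {Ω : Set (V × F)} (hΩ : Ω ∈ 𝓝 (x₀, y₀))
    (hint : ∀ z ∈ Ω, ∀ v w, fderiv ℝ U z (v, U z v) w = fderiv ℝ U z (w, U z w) v) :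
    ∃ r > 0, ∃ g : V → F, g x₀ = y₀ ∧
      ∀ x ∈ Metric.ball x₀ r, (x, g x) ∈ Ω ∧ HasFDerivAt g (U (x, g x)) x := by
  obtain ⟨K, hK⟩ := hU.lipschitzWith_of_hasCompactSupport hUc (by simp)
  obtain ⟨C, hC⟩ := exists_lipschitzWith_fderiv hU hUc
  obtain ⟨A, hA⟩ := hU.continuous.bounded_above_of_compact_support hUc
  obtain ⟨B, hB⟩ := exists_norm_fderiv_le hU hUc
  have hA0 : 0 ≤ A := (norm_nonneg _).trans (hA (x₀, y₀))
  have hB0 : 0 ≤ B := (norm_nonneg _).trans (hB (x₀, y₀))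
  lift A to NNReal using hA0
  -- The equation is solved along every ray from `x₀`. The boundedness of `U` makes the solution
  -- exist up to time `1`, and its value there defines `g (x₀ + v)`.
  have hrad : ∀ v : V, ∃ y : ℝ → F, y 0 = y₀ ∧ ∀ t ∈ Icc (0 : ℝ) 1,
      HasDerivWithinAt y (U (x₀ + t • v, y t) v) (Icc 0 1) t := by
    intro v
    have hPL : IsPicardLindelof (fun t y => U (x₀ + t • v, y) v) (tmin := 0) (tmax := 1)
        ⟨0, by simp⟩ y₀ (A * ‖v‖₊) 0 (A * ‖v‖₊) (K * ‖v‖₊) := by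
      refine ⟨fun t _ => ?_, fun y _ => ?_, fun t _ y _ => ?_, ?_⟩
      · refine LipschitzOnWith.of_dist_le_mul fun y _ z _ => ?_
        rw [dist_eq_norm, ← sub_apply]
        have h1 := hK.dist_le_mul (x₀ + t • v, y) (x₀ + t • v, z)
        rw [dist_eq_norm, Prod.dist_eq, dist_self, max_eq_right dist_nonneg] at h1
        calc _ ≤ ‖U (x₀ + t • v, y) - U (x₀ + t • v, z)‖ * ‖v‖ := ContinuousLinearMap.le_opNorm _ _
          _ ≤ (K * dist y z) * ‖v‖ := mul_le_mul_of_nonneg_right h1 (norm_nonneg _)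
          _ = _ := by push_cast; ring
      · have : Continuous fun t : ℝ => U (x₀ + t • v, y) v :=
          (hU.continuous.comp (by fun_prop)).clm_apply continuous_const
        exact this.continuousOn
      · exact (ContinuousLinearMap.le_opNorm _ _).trans
          (mul_le_mul_of_nonneg_right (hA _) (norm_nonneg _))
      · simp
    exact hPL.exists_eq_forall_mem_Icc_hasDerivWithinAt₀
  choose y hy0 hy using hrad
  have hybd : ∀ v, ∀ t ∈ Icc (0 : ℝ) 1, ‖y v t - y₀‖ ≤ A * ‖v‖ := by
    intro v t ht
    have h1 := (convex_Icc (0 : ℝ) 1).norm_image_sub_le_of_norm_hasDerivWithin_le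
      (C := A * ‖v‖) (hy v) (fun s _ => (ContinuousLinearMap.le_opNorm _ _).trans
          (mul_le_mul_of_nonneg_right (hA _) (norm_nonneg _))) (x := 0) (by simp) ht
    rw [hy0] at h1
    refine h1.trans (mul_le_of_le_one_right (by positivity) ?_)
    rw [Real.norm_eq_abs, sub_zero, abs_of_nonneg ht.1]; exact ht.2
  obtain ⟨ρ, hρ, hρΩ⟩ := Metric.mem_nhds_iff.1 hΩ
  -- Along a ray with `‖v‖ < r`, the base moves by at most `‖v‖` and the solution by at most `A *
  -- ‖v‖`, both less than `ρ`.
  set r : ℝ := ρ / (A + 1) with hr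
  have hr0 : 0 < r := by positivity
  have hΩmem : ∀ v, ‖v‖ < r → ∀ t ∈ Icc (0 : ℝ) 1, (x₀ + t • v, y v t) ∈ Ω := by
    intro v hv t ht
    refine hρΩ ?_
    have hv' : (A + 1) * ‖v‖ < ρ := by rw [hr, lt_div_iff₀ (by positivity)] at hv; linarith
    rw [Metric.mem_ball, Prod.dist_eq, max_lt_iff]
    constructor
    · rw [dist_eq_norm, add_sub_cancel_left, norm_smul, Real.norm_eq_abs, abs_of_nonneg ht.1]
      nlinarith [norm_nonneg v, ht.2]
    · rw [dist_eq_norm]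
      have := hybd v t ht
      nlinarith [norm_nonneg v]
  refine ⟨r, hr0, fun x => y (x - x₀) 1, ?_, fun x hx => ⟨?_, ?_⟩⟩
  · have := hybd 0 1 (by simp)
    simpa [sub_eq_zero] using this
  · have := hΩmem (x - x₀) (by rwa [← dist_eq_norm]) 1 (by simp)
    simpa using this
  set v := x - x₀ with hv
  have hvr : ‖v‖ < r := by rw [hv, ← dist_eq_norm]; exact hx
  set K₁ : ℝ := K * r + 1 with hK₁
  have hK₁0 : 0 < K₁ := by positivity
  set c : ℝ := 1 + Real.exp K₁ / K₁ * (A + K * r) with hc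
  have hc1 : 1 ≤ c := by rw [hc]; have : 0 ≤ Real.exp K₁ / K₁ * (A + K * r) := by positivity
                         linarith
  -- Lipschitz dependence of the radial solution on the direction
  have hlip : ∀ h : V, ∀ t ∈ Icc (0 : ℝ) 1,
      ‖y (v + h) t - y v t‖ ≤ Real.exp K₁ / K₁ * (A + K * r) * ‖h‖ := by
    intro h t ht
    have := norm_le_of_norm_deriv_le (f := fun t => y (v + h) t - y v t)
      (f' := fun t => U (x₀ + t • (v + h), y (v + h) t) (v + h) - U (x₀ + t • v, y v t) v)
      (K := K₁) (ε := (A + K * r) * ‖h‖) hK₁0 (by positivity)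
      (fun t ht => (hy _ t ht).sub (hy _ t ht)) (by simp [hy0]) (fun t ht => ?_) t ht
    · rw [mul_assoc]; exact this
    · set p := (x₀ + t • v, y v t)
      set q := (x₀ + t • (v + h), y (v + h) t)
      have e : U q (v + h) - U p v = U q h + (U q - U p) v := by
        rw [map_add, sub_apply]; abel
      have h1 : dist q p ≤ ‖h‖ + ‖y (v + h) t - y v t‖ := by
        rw [Prod.dist_eq]
        refine max_le ?_ ?_
        · simp only [p, q, dist_eq_norm]
          rw [show x₀ + t • (v + h) - (x₀ + t • v) = t • h by module, norm_smul, Real.norm_eq_abs,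
            abs_of_nonneg ht.1]
          nlinarith [norm_nonneg h, ht.2, norm_nonneg (y (v + h) t - y v t)]
        · simp only [p, q, dist_eq_norm]
          linarith [norm_nonneg h]
      have h2 : ‖U q - U p‖ ≤ K * (‖h‖ + ‖y (v + h) t - y v t‖) := by
        rw [← dist_eq_norm]
        exact (hK.dist_le_mul q p).trans (mul_le_mul_of_nonneg_left h1 K.2)
      rw [e]
      calc _ ≤ ‖U q h‖ + ‖(U q - U p) v‖ := norm_add_le _ _
        _ ≤ A * ‖h‖ + (K * (‖h‖ + ‖y (v + h) t - y v t‖)) * r := by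
          refine add_le_add ((ContinuousLinearMap.le_opNorm _ _).trans
            (mul_le_mul_of_nonneg_right (hA _) (norm_nonneg _))) ?_
          exact (ContinuousLinearMap.le_opNorm _ _).trans
            (mul_le_mul h2 hvr.le (norm_nonneg _) (by positivity))
        _ ≤ _ := by
          rw [hK₁]
          nlinarith [norm_nonneg (y (v + h) t - y v t)]
  set K₂ : ℝ := B * r + 1 with hK₂
  have hK₂0 : 0 < K₂ := by positivity
  set D : ℝ := B * c + C * c ^ 2 * r with hD
  have hD0 : 0 ≤ D := by positivity
  have hmain : ∀ h : V, ‖v + h‖ < r →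
      ‖y (v + h) 1 - y v 1 - U (x₀ + v, y v 1) h‖ ≤ Real.exp K₂ / K₂ * D * ‖h‖ ^ 2 := by
    intro h hh
    let p : ℝ → V × F := fun t => (x₀ + t • v, y v t)
    let q : ℝ → V × F := fun t => (x₀ + t • (v + h), y (v + h) t)
    have hp : ∀ t ∈ Icc (0 : ℝ) 1, HasDerivWithinAt p (v, U (p t) v) (Icc 0 1) t := by
      intro t ht
      refine HasDerivWithinAt.prodMk ?_ (hy v t ht)
      simpa using (((hasDerivAt_id t).smul_const v).const_add x₀).hasDerivWithinAt
    have hUp : ∀ t ∈ Icc (0 : ℝ) 1, HasDerivWithinAt (fun t => t • U (p t) h)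
        (t • fderiv ℝ U (p t) (v, U (p t) v) h + (1 : ℝ) • U (p t) h) (Icc 0 1) t := by
      intro t ht
      have h1 := (hU.differentiable (by simp) (p t)).hasFDerivAt.comp_hasDerivWithinAt t (hp t ht)
      have h2 := h1.clm_apply (hasDerivWithinAt_const t (Icc (0 : ℝ) 1) h)
      rw [map_zero, add_zero] at h2
      exact (hasDerivWithinAt_id t _).smul h2
    -- The variation of the radial solution in the direction `h` is compared with its expected value
    -- `t • U (p t) h`. The error satisfies a linear differential inequality with a forcing term
    -- quadratic in `h`.
    have := norm_le_of_norm_deriv_le (f := fun t => y (v + h) t - y v t - t • U (p t) h)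
      (f' := fun t => U (q t) (v + h) - U (p t) v -
        (t • fderiv ℝ U (p t) (v, U (p t) v) h + (1 : ℝ) • U (p t) h))
      (K := K₂) (ε := D * ‖h‖ ^ 2) hK₂0 (by positivity)
      (fun t ht => ((hy _ t ht).sub (hy _ t ht)).sub (hUp t ht)) (by simp [hy0])
      (fun t ht => ?_) 1 (by simp)
    · simp only [p, one_smul] at this
      rw [mul_assoc]; exact this
    -- `U (q t)` is expanded at `p t` along `q t - p t = t • (h, U h) + (0, e)`. The integrability
    -- condition identifies the term `t • DU (h, U h) v` with the one coming from the derivative of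
    -- `t • U (p t) h`, so it cancels; what remains is linear in the error `e` or quadratic in `h`.
    · have hi := hint (p t) (hΩmem v hvr t ht) v h
      set e := y (v + h) t - y v t - t • U (p t) h with he
      have hqp : q t - p t = t • ((h, U (p t) h) : V × F) + ((0, e) : V × F) := by
        ext
        · simp only [p, q, Prod.fst_sub, Prod.fst_add, Prod.smul_fst, add_zero]; module
        · simp only [p, q, he, Prod.snd_sub, Prod.snd_add, Prod.smul_snd]; abel
      have hnqp : ‖q t - p t‖ ≤ c * ‖h‖ := by
        rw [Prod.norm_def]
        refine max_le ?_ ?_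
        · simp only [p, q, Prod.fst_sub]
          rw [show x₀ + t • (v + h) - (x₀ + t • v) = t • h by module, norm_smul, Real.norm_eq_abs,
            abs_of_nonneg ht.1]
          nlinarith [norm_nonneg h, ht.2]
        · simp only [p, q, Prod.snd_sub]
          have := hlip h t ht
          rw [hc]; nlinarith [norm_nonneg h]
      set Rm := U (q t) - U (p t) - fderiv ℝ U (p t) (q t - p t) with hRm
      have hRb : ‖Rm‖ ≤ C * c ^ 2 * ‖h‖ ^ 2 := by
        refine (norm_sub_sub_fderiv_le (hU.differentiable (by simp)) hC (p t) (q t)).trans ?_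
        rw [mul_assoc, ← mul_pow]
        exact mul_le_mul_of_nonneg_left (pow_le_pow_left₀ (norm_nonneg _) hnqp 2) C.2
      have e1 : U (q t) (v + h) - U (p t) v -
          (t • fderiv ℝ U (p t) (v, U (p t) v) h + (1 : ℝ) • U (p t) h) =
          fderiv ℝ U (p t) (0, e) v + fderiv ℝ U (p t) (q t - p t) h + Rm (v + h) := by
        have e2 : U (q t) = U (p t) + fderiv ℝ U (p t) (q t - p t) + Rm := by rw [hRm]; abel
        rw [e2, hi]
        simp only [add_apply, map_add]
        have e3 : fderiv ℝ U (p t) (q t - p t) v =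
            t • fderiv ℝ U (p t) (h, U (p t) h) v + fderiv ℝ U (p t) (0, e) v := by
          rw [hqp, map_add, map_smul]; rfl
        rw [e3, one_smul]; abel
      rw [e1]
      have n1 : ‖fderiv ℝ U (p t) (0, e) v‖ ≤ B * ‖e‖ * r := by
        refine (ContinuousLinearMap.le_opNorm _ _).trans (mul_le_mul ?_ hvr.le (norm_nonneg _)
          (by positivity))
        refine (ContinuousLinearMap.le_opNorm _ _).trans (mul_le_mul (hB _) ?_ (norm_nonneg _) hB0)
        simp [Prod.norm_def]
      have n2 : ‖fderiv ℝ U (p t) (q t - p t) h‖ ≤ B * (c * ‖h‖) * ‖h‖ := by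
        refine (ContinuousLinearMap.le_opNorm _ _).trans (mul_le_mul_of_nonneg_right ?_
          (norm_nonneg _))
        exact (ContinuousLinearMap.le_opNorm _ _).trans (mul_le_mul (hB _) hnqp (norm_nonneg _) hB0)
      have n3 : ‖Rm (v + h)‖ ≤ C * c ^ 2 * ‖h‖ ^ 2 * r :=
        (ContinuousLinearMap.le_opNorm _ _).trans (mul_le_mul hRb hh.le (norm_nonneg _)
          (by positivity))
      refine (norm_add₃_le).trans ?_
      rw [hK₂, hD]
      nlinarith [norm_nonneg e]
  rw [hasFDerivAt_iff_isLittleO_nhds_zero]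
  have hO : (fun h : V => y (x + h - x₀) 1 - y v 1 - U (x, y v 1) h) =O[𝓝 0]
      fun h => ‖h‖ ^ 2 := by
    refine Asymptotics.IsBigO.of_bound (Real.exp K₂ / K₂ * D) ?_
    have hnear : ∀ᶠ h : V in 𝓝 0, ‖v + h‖ < r := by
      have : Tendsto (fun h : V => ‖v + h‖) (𝓝 0) (𝓝 ‖v + 0‖) :=
        (by fun_prop : Continuous fun h : V => ‖v + h‖).tendsto 0
      rw [add_zero] at this
      exact this.eventually (gt_mem_nhds hvr)
    filter_upwards [hnear] with h hh
    have e : x + h - x₀ = v + h := by rw [hv]; abel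
    have e' : x₀ + v = x := by rw [hv]; abel
    have := hmain h hh
    rw [e'] at this
    rw [e, Real.norm_of_nonneg (by positivity : (0 : ℝ) ≤ ‖h‖ ^ 2)]
    exact this
  refine hO.trans_isLittleO ?_
  have : (fun h : V => ‖h‖ ^ 2) =o[𝓝 0] fun h : V => ‖h‖ ^ 1 :=
    (Asymptotics.isLittleO_pow_pow (𝕜 := ℝ) (m := 1) (n := 2) (by norm_num)).comp_tendsto
      (by simpa using (continuous_norm (E := V)).tendsto 0)
  simp only [pow_one] at this
  exact this.of_norm_right

/-- Multiplying `U` by a bump function makes it global and compactly supported without changing it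
near the point. Smoothness follows by bootstrapping: if `g` is of class `n`, its derivative `U (x, g
x)` is too. -/
theorem exists_contDiffOn_of_integrable {U : V × F → V →L[ℝ] F} {x₀ : V} {y₀ : F}
    {Ω : Set (V × F)} (hΩo : IsOpen Ω) (hΩ : (x₀, y₀) ∈ Ω) (hU : ContDiffOn ℝ ∞ U Ω)
    (hint : ∀ z ∈ Ω, ∀ v w, fderiv ℝ U z (v, U z v) w = fderiv ℝ U z (w, U z w) v) :
    ∃ r > 0, ∃ g : V → F, g x₀ = y₀ ∧ ContDiffOn ℝ ∞ g (Metric.ball x₀ r) ∧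
      ∀ x ∈ Metric.ball x₀ r, (x, g x) ∈ Ω ∧ HasFDerivAt g (U (x, g x)) x := by
  obtain ⟨ρ, hρ, hρΩ⟩ := Metric.nhds_basis_closedBall.mem_iff.1 (hΩo.mem_nhds hΩ)
  let χ : ContDiffBump ((x₀, y₀) : V × F) := ⟨ρ / 2, ρ, by positivity, by linarith⟩
  let U' : V × F → V →L[ℝ] F := fun z => χ z • U z
  have hUsupp : HasCompactSupport U' := χ.hasCompactSupport.smul_right
  have hU'smooth : ContDiff ℝ ∞ U' := by
    rw [contDiff_iff_contDiffAt]
    intro z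
    by_cases hz : z ∈ Ω
    · exact χ.contDiff.contDiffAt.smul (hU.contDiffAt (hΩo.mem_nhds hz))
    · have h1 : z ∉ tsupport χ := fun h => hz (hρΩ (by rwa [χ.tsupport_eq] at h))
      have h2 : U' =ᶠ[𝓝 z] fun _ => 0 := by
        filter_upwards [(isClosed_tsupport χ).isOpen_compl.mem_nhds h1] with w hw
        simp [U', image_eq_zero_of_notMem_tsupport hw]
      exact contDiffAt_const.congr_of_eventuallyEq h2
  have hUU' : ∀ z ∈ Metric.ball ((x₀, y₀) : V × F) (ρ / 2), U' =ᶠ[𝓝 z] U := by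
    intro z hz
    filter_upwards [Metric.isOpen_ball.mem_nhds hz] with w hw
    simp [U', χ.one_of_mem_closedBall (Metric.ball_subset_closedBall hw)]
  obtain ⟨r, hr, g, hg0, hg⟩ := exists_hasFDerivAt_of_integrable_aux hU'smooth hUsupp
    (Ω := Metric.ball (x₀, y₀) (ρ / 2)) (Metric.ball_mem_nhds _ (by positivity)) (by
      intro z hz v w
      rw [(hUU' z hz).fderiv_eq, (hUU' z hz).eq_of_nhds]
      refine hint z (hρΩ (Metric.ball_subset_closedBall (Metric.ball_subset_ball ?_ hz))) v w
      linarith)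
  refine ⟨r, hr, g, hg0, ?_, fun x hx => ⟨?_, ?_⟩⟩
  · have hn : ∀ n : ℕ, ContDiffOn ℝ n g (Metric.ball x₀ r) := by
      intro n
      induction n with
      | zero =>
        exact contDiffOn_zero.2 fun x hx => (hg x hx).2.continuousAt.continuousWithinAt
      | succ n ih =>
        push_cast
        rw [contDiffOn_succ_iff_fderiv_of_isOpen Metric.isOpen_ball]
        refine ⟨fun x hx => (hg x hx).2.differentiableAt.differentiableWithinAt, by simp, ?_⟩
        refine ContDiffOn.congr (f := fun x => U' (x, g x)) ?_ fun x hx => (hg x hx).2.fderiv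
        exact (hU'smooth.of_le (by exact_mod_cast le_top)).comp_contDiffOn (contDiffOn_id.prodMk ih)
    exact contDiffOn_infty.2 hn
  · exact hρΩ (Metric.ball_subset_closedBall (Metric.ball_subset_ball (by linarith) (hg x hx).1))
  · rw [← (hUU' _ (hg x hx).1).eq_of_nhds]; exact (hg x hx).2

end Frobenius

/-! ### Derivatives of maps from a vector space to a manifold -/

section VectorDeriv

variable {E₂ H₂ M₂ : Type*} [NormedAddCommGroup E₂] [NormedSpace ℝ E₂] [TopologicalSpace H₂]
  {I₂ : ModelWithCorners ℝ E₂ H₂} [TopologicalSpace M₂] [ChartedSpace H₂ M₂]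
  {V W : Type*} [NormedAddCommGroup V] [NormedSpace ℝ V] [NormedAddCommGroup W] [NormedSpace ℝ W]

variable (I₂) in
/-- The derivative of a map from a vector space to a manifold, with values in the model space. -/
def vd (F : W → M₂) (s : Set W) (z : W) : W →L[ℝ] E₂ := mfderivWithin 𝓘(ℝ, W) I₂ F s z

theorem vd_comp {F : W → M₂} {f : V → W} {s : Set V} {t : Set W} {z : V}
    (hF : MDifferentiableWithinAt 𝓘(ℝ, W) I₂ F t (f z)) (hf : DifferentiableWithinAt ℝ f s z)
    (hst : MapsTo f s t) (hs : UniqueDiffWithinAt ℝ s z) :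
    vd I₂ (F ∘ f) s z = (vd I₂ F t (f z)).comp (fderivWithin ℝ f s z) := by
  have h := mfderivWithin_comp z hF hf.mdifferentiableWithinAt hst hs.uniqueMDiffWithinAt
  rw [mfderivWithin_eq_fderivWithin] at h
  exact h

theorem vd_congr {F F' : W → M₂} {s : Set W} {z : W} (h : F =ᶠ[𝓝[s] z] F') (hz : F z = F' z) :
    vd I₂ F s z = vd I₂ F' s z :=
  Filter.EventuallyEq.mfderivWithin_eq h hz

theorem vd_eq_fderivWithin {F : W → M₂} {s : Set W} {z : W}
    (hF : MDifferentiableWithinAt 𝓘(ℝ, W) I₂ F s z) (hs : UniqueDiffWithinAt ℝ s z) :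
    vd I₂ F s z = fderivWithin ℝ (fun w => extChartAt I₂ (F z) (F w)) s z :=
  ((hasMFDerivWithinAt_vector_iff.1 hF.hasMFDerivWithinAt).2.fderivWithin hs).symm

end VectorDeriv

/-! ### Adapted charts of the bundle and pullbacks of the connection form -/

section Bundle

variable {m k : ℕ}
  {M : Type*} [TopologicalSpace M] [ChartedSpace (E m) M] [IsManifold (𝓡 m) ∞ M]
  {G : Type*} [TopologicalSpace G] [ChartedSpace (E k) G] [Group G] [LieGroup (𝓡 k) ∞ G]
  {P : Type*} [TopologicalSpace P] [ChartedSpace (ModelProd (E m) (E k)) P]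
  [IsManifold ((𝓡 m).prod (𝓡 k)) ∞ P] [MulAction Gᵐᵒᵖ P]
  {proj : P → M}

/-- A chart of the total space adapted to the projection. -/
structure AdaptedChart (proj : P → M) (p : P) where
  dom : Set (E m × E k)
  nbhd : Set P
  toFun : E m × E k → P
  inv : P → E m × E k
  isOpen_dom : IsOpen dom
  isOpen_nbhd : IsOpen nbhd
  mem : p ∈ nbhd
  smooth : ∀ z ∈ dom, ContMDiffAt 𝓘(ℝ, E m × E k) ((𝓡 m).prod (𝓡 k)) ∞ toFun z
  smooth_inv : ∀ q ∈ nbhd, ContMDiffAt ((𝓡 m).prod (𝓡 k)) 𝓘(ℝ, E m × E k) ∞ inv q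
  mapsTo : MapsTo toFun dom nbhd
  mapsTo_inv : MapsTo inv nbhd dom
  left_inv : ∀ q ∈ nbhd, toFun (inv q) = q
  right_inv : ∀ z ∈ dom, inv (toFun z) = z
  proj_mem : ∀ q ∈ nbhd, proj q ∈ (extChartAt (𝓡 m) (proj p)).source
  inv_fst : ∀ q ∈ nbhd, (inv q).1 = extChartAt (𝓡 m) (proj p) (proj q)

/-- A local trivialization followed by charts of the base and of the group; the preferred chart of
the total space need not be compatible with the projection. -/
theorem IsPrincipalBundle.exists_adaptedChart (hP : IsPrincipalBundle m k G proj) (p : P) :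
    Nonempty (AdaptedChart (m := m) (k := k) proj p) := by
  obtain ⟨U, hU, hpU, e, hes, het, he, he', hee⟩ := hP.locally_trivial (proj p)
  have hp : p ∈ e.source := by rw [hes]; exact hpU
  set φ := extChartAt (𝓡 m) (proj p) with hφ
  set χ := extChartAt (𝓡 k) (e p).2 with hχ
  have heq : ∀ z ∈ (φ.target ∩ φ.symm ⁻¹' U) ×ˢ χ.target, (φ.symm z.1, χ.symm z.2) ∈ e.target := by
    rintro ⟨a, b⟩ ⟨h1, -⟩
    rw [het]; exact ⟨h1.2, mem_univ _⟩
  refine ⟨{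
    dom := (φ.target ∩ φ.symm ⁻¹' U) ×ˢ χ.target
    nbhd := e.source ∩ e ⁻¹' (φ.source ×ˢ χ.source)
    toFun := fun z => e.symm (φ.symm z.1, χ.symm z.2)
    inv := fun q => (φ (e q).1, χ (e q).2)
    isOpen_dom := ((continuousOn_extChartAt_symm _).isOpen_inter_preimage
      (isOpen_extChartAt_target _) hU).prod (isOpen_extChartAt_target _)
    isOpen_nbhd := e.isOpen_inter_preimage
      ((isOpen_extChartAt_source _).prod (isOpen_extChartAt_source _))
    mem := ⟨hp, by
      rw [mem_preimage, mem_prod, (hee p hp).1]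
      exact ⟨mem_extChartAt_source _, mem_extChartAt_source _⟩⟩
    smooth := ?_
    smooth_inv := ?_
    mapsTo := ?_
    mapsTo_inv := ?_
    left_inv := ?_
    right_inv := ?_
    proj_mem := ?_
    inv_fst := ?_ }⟩
  · intro z hz
    refine ContMDiffAt.comp z (he'.contMDiffAt (e.open_target.mem_nhds (heq z hz))) ?_
    exact ((contMDiffAt_extChartAt_symm hz.1.1).comp z contDiffAt_fst.contMDiffAt).prodMk
      ((contMDiffAt_extChartAt_symm hz.2).comp z contDiffAt_snd.contMDiffAt)
  · rintro q ⟨hq, hq1, hq2⟩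
    rw [hφ, extChartAt_source] at hq1
    rw [hχ, extChartAt_source] at hq2
    have h := he.contMDiffAt (e.open_source.mem_nhds hq)
    exact ((contMDiffAt_extChartAt' hq1).comp q (contMDiffAt_fst.comp q h)).prodMk_space
      ((contMDiffAt_extChartAt' hq2).comp q (contMDiffAt_snd.comp q h))
  · intro z hz
    refine ⟨e.map_target (heq z hz), ?_⟩
    rw [mem_preimage, e.right_inv (heq z hz)]
    exact ⟨φ.map_target hz.1.1, χ.map_target hz.2⟩
  · rintro q ⟨hq, hq1, hq2⟩
    refine ⟨⟨φ.map_source hq1, ?_⟩, χ.map_source hq2⟩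
    rw [mem_preimage, φ.left_inv hq1, (hee q hq).1]
    rw [hes] at hq; exact hq
  · rintro q ⟨hq, hq1, hq2⟩
    simp only
    rw [φ.left_inv hq1, χ.left_inv hq2]
    exact e.left_inv hq
  · intro z hz
    rw [e.right_inv (heq z hz)]
    exact Prod.ext (φ.right_inv hz.1.1) (χ.right_inv hz.2)
  · rintro q ⟨hq, hq1, hq2⟩
    rw [← (hee q hq).1]; exact hq1
  · rintro q ⟨hq, hq1, hq2⟩
    simp only
    rw [(hee q hq).1]

theorem AdaptedChart.proj_toFun {p : P} (κ : AdaptedChart (m := m) (k := k) proj p) {z : E m × E k}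
    (hz : z ∈ κ.dom) : proj (κ.toFun z) = (extChartAt (𝓡 m) (proj p)).symm z.1 := by
  have h1 := κ.mapsTo hz
  rw [← (extChartAt (𝓡 m) (proj p)).left_inv (κ.proj_mem _ h1), ← κ.inv_fst _ h1, κ.right_inv z hz]

section Pullback

variable {W : Type*} [NormedAddCommGroup W] [NormedSpace ℝ W]

/-- The connection form at a point, as a map on the model space. -/
def Connection.formAt (A : Connection m k G P) (p : P) : E m × E k →L[ℝ] E k := A.form p

/-- The pullback of the connection form to a vector space. -/
def Connection.pullback (A : Connection m k G P) (F : W → P) (s : Set W) (z : W) : W →L[ℝ] E k :=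
  (A.formAt (F z)).comp (vd ((𝓡 m).prod (𝓡 k)) F s z)

theorem Connection.pullback_comp {V : Type*} [NormedAddCommGroup V] [NormedSpace ℝ V]
    (A : Connection m k G P) {F : W → P} {f : V → W} {s : Set V} {t : Set W} {z : V}
    (hF : MDifferentiableWithinAt 𝓘(ℝ, W) ((𝓡 m).prod (𝓡 k)) F t (f z))
    (hf : DifferentiableWithinAt ℝ f s z) (hst : MapsTo f s t) (hs : UniqueDiffWithinAt ℝ s z) :
    A.pullback (F ∘ f) s z = (A.pullback F t (f z)).comp (fderivWithin ℝ f s z) := by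
  rw [Connection.pullback, vd_comp hF hf hst hs]
  rfl

theorem Connection.pullback_congr (A : Connection m k G P) {F F' : W → P} {s : Set W} {z : W}
    (h : F =ᶠ[𝓝[s] z] F') (hz : F z = F' z) : A.pullback F s z = A.pullback F' s z := by
  rw [Connection.pullback, Connection.pullback, vd_congr h hz, hz]

/-- The connection form in the preferred chart at `q`. -/
def Connection.chartForm (A : Connection m k G P) (q : P) : E m × E k → E m × E k →L[ℝ] E k :=
  OneForm.inChart A.form q

theorem Connection.contDiffOn_chartForm (A : Connection m k G P) (q : P) :
    ContDiffOn ℝ ∞ (A.chartForm q) (extChartAt ((𝓡 m).prod (𝓡 k)) q).target := A.smooth q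

theorem Connection.chartForm_eq_pullback (A : Connection m k G P) (q : P) (z : E m × E k) :
    A.chartForm q z = A.pullback (extChartAt ((𝓡 m).prod (𝓡 k)) q).symm univ z := by
  unfold Connection.pullback vd
  rw [mfderivWithin_univ]
  rfl

theorem Connection.pullback_eq_chartForm_comp (A : Connection m k G P) {F : W → P} {z : W} {q : P}
    (hF : ContMDiffAt 𝓘(ℝ, W) ((𝓡 m).prod (𝓡 k)) ∞ F z)
    (hq : F z ∈ (extChartAt ((𝓡 m).prod (𝓡 k)) q).source) :
    A.pullback F univ z = (A.chartForm q (extChartAt ((𝓡 m).prod (𝓡 k)) q (F z))).comp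
      (fderiv ℝ (fun w => extChartAt ((𝓡 m).prod (𝓡 k)) q (F w)) z) := by
  set c := extChartAt ((𝓡 m).prod (𝓡 k)) q
  have hd : DifferentiableAt ℝ (fun w => c (F w)) z :=
    (contDiffAt_chart_comp hF hq).differentiableAt (by simp)
  have hs : ContMDiffAt 𝓘(ℝ, E m × E k) ((𝓡 m).prod (𝓡 k)) ∞ c.symm (c (F z)) :=
    contMDiffAt_extChartAt_symm (c.map_source hq)
  have heq : F =ᶠ[𝓝[univ] z] c.symm ∘ fun w => c (F w) := by
    rw [nhdsWithin_univ]
    filter_upwards [hF.continuousAt.eventually ((isOpen_extChartAt_source q).mem_nhds hq)] with w hw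
    exact (c.left_inv hw).symm
  rw [A.pullback_congr heq (by simp [c.left_inv hq]), A.pullback_comp (F := c.symm) (f := fun w => c (F w)) (t := univ)
    (hs.mdifferentiableAt (by simp)).mdifferentiableWithinAt hd.differentiableWithinAt
    (mapsTo_univ _ _) uniqueDiffWithinAt_univ, fderivWithin_univ, A.chartForm_eq_pullback]

theorem Connection.contDiffAt_pullback (A : Connection m k G P) {F : W → P} {z : W}
    (hF : ∀ᶠ w in 𝓝 z, ContMDiffAt 𝓘(ℝ, W) ((𝓡 m).prod (𝓡 k)) ∞ F w) :
    ContDiffAt ℝ ∞ (A.pullback F univ) z := by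
  set c := extChartAt ((𝓡 m).prod (𝓡 k)) (F z)
  have hz := hF.self_of_nhds
  have hc : ContDiffAt ℝ ∞ (fun w => c (F w)) z := contDiffAt_chart_comp hz (mem_extChartAt_source _)
  have h : ContDiffAt ℝ ∞ (fun w => (A.chartForm (F z) (c (F w))).comp
      (fderiv ℝ (fun w => c (F w)) w)) z := by
    refine ContDiffAt.clm_comp ?_ (hc.fderiv_right (by norm_cast))
    exact ((A.contDiffOn_chartForm (F z)).contDiffAt ((isOpen_extChartAt_target _).mem_nhds
      (mem_extChartAt_target _))).comp z hc
  refine h.congr_of_eventuallyEq ?_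
  filter_upwards [hF, hz.continuousAt.eventually
      (extChartAt_source_mem_nhds (I := (𝓡 m).prod (𝓡 k)) (F z))] with w hw hw2
  exact A.pullback_eq_chartForm_comp hw hw2

/-- The pullback of a flat connection form is closed on its kernel. -/
theorem Connection.IsFlat.fderiv_pullback_symm {A : Connection m k G P} (hA : A.IsFlat) {F : W → P}
    {z : W} (hF : ∀ᶠ w in 𝓝 z, ContMDiffAt 𝓘(ℝ, W) ((𝓡 m).prod (𝓡 k)) ∞ F w) {u v : W}
    (hu : A.pullback F univ z u = 0) (hv : A.pullback F univ z v = 0) :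
    fderiv ℝ (A.pullback F univ) z u v = fderiv ℝ (A.pullback F univ) z v u := by
  set q := F z with hq
  set c := extChartAt ((𝓡 m).prod (𝓡 k)) q
  have hz := hF.self_of_nhds
  have hc : ContDiffAt ℝ ∞ (fun w => c (F w)) z := contDiffAt_chart_comp hz (mem_extChartAt_source _)
  have heq : A.pullback F univ =ᶠ[𝓝 z] fun w => (A.chartForm q (c (F w))).comp
      (fderiv ℝ (fun w => c (F w)) w) := by
    filter_upwards [hF, hz.continuousAt.eventually
      (extChartAt_source_mem_nhds (I := (𝓡 m).prod (𝓡 k)) (F z))] with w hw hw2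
    exact A.pullback_eq_chartForm_comp hw hw2
  have h1 : DifferentiableAt ℝ (A.chartForm q) (c (F z)) :=
    ((A.contDiffOn_chartForm q).contDiffAt ((isOpen_extChartAt_target _).mem_nhds
      (mem_extChartAt_target _))).differentiableAt (by simp)
  have h2 : DifferentiableAt ℝ (fderiv ℝ (fun w => c (F w))) z :=
    (hc.fderiv_right (m := ∞) (by norm_cast)).differentiableAt (by simp)
  have h3 := (h1.hasFDerivAt.comp (f := fun w => c (F w)) z
    (hc.differentiableAt (by simp)).hasFDerivAt).clm_comp h2.hasFDerivAt
  -- The derivative of the pullback has two terms. The one with the second derivative of the map is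
  -- symmetric. The other is symmetric by flatness, since the bracket term of the curvature vanishes
  -- on horizontal vectors.
  have hsymm : IsSymmSndFDerivAt ℝ (fun w => c (F w)) z :=
    hc.isSymmSndFDerivAt (by rw [minSmoothness_of_isRCLikeNormedField]; norm_cast)
  have hform : ∀ w, A.formAt q (fderiv ℝ (fun w => c (F w)) z w) = A.pullback F univ z w := by
    intro w
    rw [Connection.pullback, vd_eq_fderivWithin
      (hz.mdifferentiableAt (by simp)).mdifferentiableWithinAt uniqueDiffWithinAt_univ,
      fderivWithin_univ]
    rfl
  have hflat := hA q (fderiv ℝ (fun w => c (F w)) z u) (fderiv ℝ (fun w => c (F w)) z v)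
  have hbr : bracket G (A.formAt q (fderiv ℝ (fun w => c (F w)) z u))
      (A.formAt q (fderiv ℝ (fun w => c (F w)) z v)) = 0 := by
    rw [hform, hform, hu, hv, bracket_eq_bracketL, map_zero]
  have hflat' : fderiv ℝ (A.chartForm q) (c q) (fderiv ℝ (fun w => c (F w)) z u)
        (fderiv ℝ (fun w => c (F w)) z v) -
      fderiv ℝ (A.chartForm q) (c q) (fderiv ℝ (fun w => c (F w)) z v)
        (fderiv ℝ (fun w => c (F w)) z u) = 0 := by
    have h4 : fderiv ℝ (A.chartForm q) (c q) (fderiv ℝ (fun w => c (F w)) z u)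
        (fderiv ℝ (fun w => c (F w)) z v) -
      fderiv ℝ (A.chartForm q) (c q) (fderiv ℝ (fun w => c (F w)) z v)
        (fderiv ℝ (fun w => c (F w)) z u) + bracket G (A.formAt q (fderiv ℝ (fun w => c (F w)) z u))
      (A.formAt q (fderiv ℝ (fun w => c (F w)) z v)) = 0 := hflat
    rwa [hbr, add_zero] at h4
  rw [heq.fderiv_eq]
  erw [h3.fderiv]
  have e := hsymm u v
  simp only [add_apply, ContinuousLinearMap.comp_apply, ContinuousLinearMap.compL_apply,
    ContinuousLinearMap.flip_apply]
  rw [e, sub_eq_zero.1 hflat']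

end Pullback

end Bundle

/-! ### The horizontal distribution as a graph -/

section Horizontal

variable {V F : Type*} [NormedAddCommGroup V] [NormedSpace ℝ V] [FiniteDimensional ℝ V]
  [NormedAddCommGroup F] [NormedSpace ℝ F] [FiniteDimensional ℝ F]

/-- The linear map whose graph is the kernel of `L`. -/
def kernelSlope (L : V × F →L[ℝ] F) : V →L[ℝ] F :=
  -((L.comp (ContinuousLinearMap.inr ℝ V F)).inverse.comp
    (L.comp (ContinuousLinearMap.inl ℝ V F)))

theorem exists_equiv_of_surjective {L : V × F →L[ℝ] F}
    (hL : ∀ y, ∃ b, L (0, b) = y) :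
    ∃ e : F ≃L[ℝ] F, (e : F →L[ℝ] F) = L.comp (ContinuousLinearMap.inr ℝ V F) := by
  set T := L.comp (ContinuousLinearMap.inr ℝ V F)
  have hs : Function.Surjective (T : F →ₗ[ℝ] F) := fun y => hL y
  have hi : Function.Injective (T : F →ₗ[ℝ] F) := LinearMap.injective_iff_surjective.2 hs
  exact ⟨(LinearEquiv.ofBijective (T : F →ₗ[ℝ] F) ⟨hi, hs⟩).toContinuousLinearEquiv, by
    ext x; rfl⟩

theorem apply_eq_zero_iff {L : V × F →L[ℝ] F} (hL : ∀ y, ∃ b, L (0, b) = y) (v : V) (w : F) :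
    L (v, w) = 0 ↔ w = kernelSlope L v := by
  obtain ⟨e, he⟩ := exists_equiv_of_surjective hL
  have h1 : L (v, w) = L (v, 0) + e w := by
    have : (e : F →L[ℝ] F) w = L (0, w) := by rw [he]; rfl
    rw [show L (v, w) = L (v, 0) + L (0, w) by rw [← map_add]; simp, ← this]
    rfl
  have h2 : kernelSlope L v = -e.symm (L (v, 0)) := by
    unfold kernelSlope
    rw [← he, ContinuousLinearMap.inverse_equiv]
    rfl
  rw [h1, h2]
  constructor
  · intro h
    apply e.injective
    rw [map_neg, e.apply_symm_apply]
    exact eq_neg_of_add_eq_zero_right h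
  · rintro rfl
    rw [map_neg, e.apply_symm_apply, add_neg_cancel]

theorem contDiffAt_kernelSlope {X : Type*} [NormedAddCommGroup X] [NormedSpace ℝ X]
    {θ : X → V × F →L[ℝ] F} {z : X}
    (hθ : ContDiffAt ℝ ∞ θ z) (hL : ∀ y, ∃ b, θ z (0, b) = y) :
    ContDiffAt ℝ ∞ (fun z => kernelSlope (θ z)) z := by
  obtain ⟨e, he⟩ := exists_equiv_of_surjective hL
  unfold kernelSlope
  have h1 : ContDiffAt ℝ ∞ (fun z => (θ z).comp (ContinuousLinearMap.inr ℝ V F)) z :=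
    hθ.clm_comp contDiffAt_const
  have h2 : ContDiffAt ℝ ∞ (fun z => (θ z).comp (ContinuousLinearMap.inl ℝ V F)) z :=
    hθ.clm_comp contDiffAt_const
  have h3 : ContDiffAt ℝ ∞ (ContinuousLinearMap.inverse : (F →L[ℝ] F) → F →L[ℝ] F)
      ((θ z).comp (ContinuousLinearMap.inr ℝ V F)) := by
    rw [← he]; exact contDiffAt_map_inverse e
  exact ((h3.comp z h1).clm_comp h2).neg

/-- Differentiating `θ (w, U w) = 0` along the horizontal lift of `v`, and the same with `v` and `w`
exchanged, the symmetry of `Dθ` on horizontal vectors leaves `θ (0, difference) = 0`; and `θ` is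
injective on vertical vectors. -/
theorem kernelSlope_integrable {θ : V × F → V × F →L[ℝ] F} {Ω : Set (V × F)} (hΩ : IsOpen Ω)
    (hθ : ContDiffOn ℝ ∞ θ Ω) (hL : ∀ z ∈ Ω, ∀ y, ∃ b, θ z (0, b) = y)
    (hsymm : ∀ z ∈ Ω, ∀ u v, θ z u = 0 → θ z v = 0 → fderiv ℝ θ z u v = fderiv ℝ θ z v u)
    {z : V × F} (hz : z ∈ Ω) (v w : V) :
    fderiv ℝ (fun z => kernelSlope (θ z)) z (v, kernelSlope (θ z) v) w =
      fderiv ℝ (fun z => kernelSlope (θ z)) z (w, kernelSlope (θ z) w) v := by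
  have hθz := hθ.contDiffAt (hΩ.mem_nhds hz)
  have h1 := (hθz.differentiableAt (by simp)).hasFDerivAt
  have h2 := ((contDiffAt_kernelSlope hθz (hL z hz)).differentiableAt (by simp)).hasFDerivAt
  set U := fun z => kernelSlope (θ z)
  have key : ∀ u w, fderiv ℝ θ z u (w, U z w) + θ z (0, fderiv ℝ U z u w) = 0 := by
    intro u w
    have h3 : HasFDerivAt (fun z => U z w) ((fderiv ℝ U z).flip w) z := by
      simpa using h2.clm_apply (hasFDerivAt_const w z)
    have h4 := h1.clm_apply ((hasFDerivAt_const w z).prodMk h3)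
    have h5 : (fun z => θ z (w, U z w)) =ᶠ[𝓝 z] fun _ => 0 := by
      filter_upwards [hΩ.mem_nhds hz] with y hy
      exact (apply_eq_zero_iff (hL y hy) _ _).2 rfl
    have h6 := congrArg (fun L : V × F →L[ℝ] F => L u)
      (h4.unique ((hasFDerivAt_const (0 : F) z).congr_of_eventuallyEq h5))
    simpa [add_comm] using h6
  have e1 := key (v, U z v) w
  have e2 := key (w, U z w) v
  rw [hsymm z hz _ _ ((apply_eq_zero_iff (hL z hz) _ _).2 rfl)
    ((apply_eq_zero_iff (hL z hz) _ _).2 rfl)] at e1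
  have e3 : θ z (0, fderiv ℝ U z (v, U z v) w - fderiv ℝ U z (w, U z w) v) = 0 := by
    have e4 := e1.trans e2.symm
    have : ((0 : V), fderiv ℝ U z (v, U z v) w - fderiv ℝ U z (w, U z w) v) =
      (0, fderiv ℝ U z (v, U z v) w) - (0, fderiv ℝ U z (w, U z w) v) := by simp
    rw [this, map_sub, sub_eq_zero]
    exact add_left_cancel e4
  rw [apply_eq_zero_iff (hL z hz), map_zero] at e3
  exact sub_eq_zero.1 e3

/-- Two solutions of `y' = U(x, y) x'` along the same curve `x` that agree at one time agree
nearby. -/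
theorem eventually_eq_of_slope {U : V × F → V →L[ℝ] F} {x : ℝ → V} {y₁ y₂ : ℝ → F} {t₀ : ℝ}
    (ht₀ : t₀ ∈ Icc (0 : ℝ) 1) (h0 : y₁ t₀ = y₂ t₀) (hU : ContDiffAt ℝ 1 U (x t₀, y₁ t₀))
    (hx : ContDiffWithinAt ℝ 1 x (Icc 0 1) t₀)
    (h1 : ∀ᶠ t in 𝓝[Icc 0 1] t₀, HasDerivWithinAt y₁
      (U (x t, y₁ t) (derivWithin x (Icc 0 1) t)) (Icc 0 1) t)
    (h2 : ∀ᶠ t in 𝓝[Icc 0 1] t₀, HasDerivWithinAt y₂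
      (U (x t, y₂ t) (derivWithin x (Icc 0 1) t)) (Icc 0 1) t) :
    ∀ᶠ t in 𝓝[Icc 0 1] t₀, y₁ t = y₂ t := by
  obtain ⟨K, s, hs, hK⟩ := hU.exists_lipschitzOnWith
  have hc1 : ContinuousWithinAt (fun t => (x t, y₁ t)) (Icc 0 1) t₀ :=
    hx.continuousWithinAt.prodMk (h1.self_of_nhdsWithin ht₀).continuousWithinAt
  have hc2 : ContinuousWithinAt (fun t => (x t, y₂ t)) (Icc 0 1) t₀ :=
    hx.continuousWithinAt.prodMk (h2.self_of_nhdsWithin ht₀).continuousWithinAt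
  have hs1 := hc1.eventually (p := (· ∈ s)) hs
  have hs2 := hc2.eventually (p := (· ∈ s)) (by
    change s ∈ 𝓝 (x t₀, y₂ t₀)
    rw [← h0]; exact hs)
  have hxc : ContinuousWithinAt (fun t => derivWithin x (Icc 0 1) t) (Icc 0 1) t₀ := by
    have h3 := (hx.fderivWithin_right (m := 0) (uniqueDiffOn_Icc zero_lt_one) (by norm_num)
      ht₀).continuousWithinAt
    exact h3.clm_apply continuousWithinAt_const
  have hb : ∀ᶠ t in 𝓝[Icc 0 1] t₀, ‖derivWithin x (Icc 0 1) t‖ <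
      ‖derivWithin x (Icc 0 1) t₀‖ + 1 :=
    hxc.norm.eventually (p := (· < ‖derivWithin x (Icc 0 1) t₀‖ + 1))
      (Iio_mem_nhds (by linarith))
  obtain ⟨ε, hε, hball⟩ := Metric.mem_nhdsWithin_iff.1 (hs1.and (hs2.and (hb.and (h1.and h2))))
  set a := max 0 (t₀ - ε / 2)
  set b := min 1 (t₀ + ε / 2)
  have hab : Icc a b ⊆ Metric.ball t₀ ε ∩ Icc 0 1 := by
    intro t ht
    have ha1 := (le_max_left 0 (t₀ - ε / 2)).trans ht.1
    have ha2 := (le_max_right 0 (t₀ - ε / 2)).trans ht.1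
    have hb1 := ht.2.trans (min_le_left 1 (t₀ + ε / 2))
    have hb2 := ht.2.trans (min_le_right 1 (t₀ + ε / 2))
    refine ⟨?_, ha1, hb1⟩
    rw [Metric.mem_ball, Real.dist_eq, abs_lt]
    constructor <;> linarith
  have hta : t₀ ∈ Icc a b := ⟨max_le ht₀.1 (by linarith), le_min ht₀.2 (by linarith)⟩
  have hz := eq_zero_of_norm_deriv_le (f := fun t => y₁ t - y₂ t)
    (f' := fun t => U (x t, y₁ t) (derivWithin x (Icc 0 1) t) -
      U (x t, y₂ t) (derivWithin x (Icc 0 1) t))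
    (K := K * (‖derivWithin x (Icc 0 1) t₀‖ + 1)) (t₀ := t₀) (a := a) (b := b)
    (hf := fun t ht => by
      obtain ⟨-, -, -, g1, g2⟩ := hball (hab ht)
      exact (g1.sub g2).mono fun u hu => (hab hu).2)
    (h0 := by simp [h0]) (ht₀ := hta)
    (hb := fun t ht => by
      obtain ⟨g1, g2, g3, -, -⟩ := hball (hab ht)
      have g4 := hK.norm_sub_le g1 g2
      rw [← sub_apply]
      refine (ContinuousLinearMap.le_opNorm _ _).trans ?_
      have g5 : ‖((x t, y₁ t) : V × F) - (x t, y₂ t)‖ = ‖y₁ t - y₂ t‖ := by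
        simp [Prod.norm_def]
      rw [g5] at g4
      calc _ ≤ (K * ‖y₁ t - y₂ t‖) * (‖derivWithin x (Icc 0 1) t₀‖ + 1) := by
            gcongr
        _ = _ := by ring)
  have hmem : Icc a b ∈ 𝓝[Icc 0 1] t₀ := by
    refine Metric.mem_nhdsWithin_iff.2 ⟨ε / 2, by linarith, ?_⟩
    rintro t ⟨ht, ht1⟩
    rw [Metric.mem_ball, Real.dist_eq, abs_lt] at ht
    exact ⟨max_le ht1.1 (by linarith), le_min ht1.2 (by linarith)⟩
  filter_upwards [hmem] with t ht
  exact sub_eq_zero.1 (hz t ht)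

end Horizontal

/-! ### Local horizontal sections -/

section Sections

variable {m k : ℕ}
  {M : Type*} [TopologicalSpace M] [ChartedSpace (E m) M] [IsManifold (𝓡 m) ∞ M]
  {G : Type*} [TopologicalSpace G] [ChartedSpace (E k) G] [Group G] [LieGroup (𝓡 k) ∞ G]
  {P : Type*} [TopologicalSpace P] [ChartedSpace (ModelProd (E m) (E k)) P]
  [IsManifold ((𝓡 m).prod (𝓡 k)) ∞ P] [MulAction Gᵐᵒᵖ P]
  {proj : P → M}

theorem IsPrincipalBundle.smooth_orbit (hP : IsPrincipalBundle m k G proj) (q : P) :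
    ContMDiff (𝓡 k) ((𝓡 m).prod (𝓡 k)) ∞ (fun g : G => MulOpposite.op g • q) :=
  hP.smooth_action.comp (contMDiff_const.prodMk contMDiff_id)

theorem IsPrincipalBundle.smooth_smul (hP : IsPrincipalBundle m k G proj) (g : G) :
    ContMDiff ((𝓡 m).prod (𝓡 k)) ((𝓡 m).prod (𝓡 k)) ∞ (fun q : P => MulOpposite.op g • q) :=
  hP.smooth_action.comp (contMDiff_id.prodMk contMDiff_const)

/-- The fundamental vector of `ξ` is tangent to the fibre, so it has no base component in an adapted
chart, and the connection form sends it to `ξ`. With equal dimensions, this surjectivity on vertical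
vectors makes the kernel a graph over the base. -/
theorem AdaptedChart.exists_pullback_eq (hP : IsPrincipalBundle m k G proj)
    (A : Connection m k G P) {p : P} (κ : AdaptedChart (m := m) (k := k) proj p)
    {z : E m × E k} (hz : z ∈ κ.dom) (ξ : E k) :
    ∃ b : E k, A.pullback κ.toFun univ z (0, b) = ξ := by
  set q := κ.toFun z with hq
  have hqn : q ∈ κ.nbhd := κ.mapsTo hz
  set o := fun g : G => MulOpposite.op g • q with ho
  have ho1 : o 1 = q := by simp [ho]
  have hos : ContMDiffAt (𝓡 k) ((𝓡 m).prod (𝓡 k)) ∞ o 1 := hP.smooth_orbit q 1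
  have hev : ∀ᶠ g in 𝓝 (1 : G), o g ∈ κ.nbhd :=
    hos.continuousAt.eventually (κ.isOpen_nbhd.mem_nhds (by rw [ho1]; exact hqn))
  have hinv : ContMDiffAt ((𝓡 m).prod (𝓡 k)) 𝓘(ℝ, E m × E k) ∞ κ.inv (o 1) :=
    κ.smooth_inv _ (by rw [ho1]; exact hqn)
  have hi : ContMDiffAt (𝓡 k) 𝓘(ℝ, E m × E k) ∞ (fun g => κ.inv (o g)) 1 := hinv.comp 1 hos
  have hi1 : κ.inv (o 1) = z := by rw [ho1, hq, κ.right_inv z hz]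
  let L : E k →L[ℝ] E m × E k := mfderiv (𝓡 k) 𝓘(ℝ, E m × E k) (fun g => κ.inv (o g)) 1
  have hL : HasMFDerivAt (𝓡 k) 𝓘(ℝ, E m × E k) (fun g => κ.inv (o g)) 1 L :=
    (hi.mdifferentiableAt (by simp)).hasMFDerivAt
  have hfst : (L ξ).1 = 0 := by
    have h1 : HasMFDerivAt (𝓡 k) 𝓘(ℝ, E m) (Prod.fst ∘ fun g => κ.inv (o g)) 1
        ((ContinuousLinearMap.fst ℝ (E m) (E k)).comp L) :=
      HasMFDerivAt.comp (1 : G) (g := (Prod.fst : E m × E k → E m))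
        (ContinuousLinearMap.fst ℝ (E m) (E k)).hasFDerivAt.hasMFDerivAt hL
    have h2 : HasMFDerivAt (𝓡 k) 𝓘(ℝ, E m) (Prod.fst ∘ fun g => κ.inv (o g)) 1
        (0 : E k →L[ℝ] E m) := by
      refine (hasMFDerivAt_const (extChartAt (𝓡 m) (proj p) (proj q)) (1 : G)).congr_of_eventuallyEq
        ?_
      filter_upwards [hev] with g hg
      change (κ.inv (o g)).1 = _
      rw [κ.inv_fst _ hg, hP.proj_action]
    exact congrArg (fun T : E k →L[ℝ] E m => T ξ) (hasMFDerivAt_unique h1 h2)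
  refine ⟨(L ξ).2, ?_⟩
  let D : E m × E k →L[ℝ] E m × E k :=
    mfderivWithin 𝓘(ℝ, E m × E k) ((𝓡 m).prod (𝓡 k)) κ.toFun univ z
  have hD : HasMFDerivAt 𝓘(ℝ, E m × E k) ((𝓡 m).prod (𝓡 k)) κ.toFun (κ.inv (o 1)) D := by
    rw [hi1]
    change HasMFDerivAt _ _ _ _
      (mfderivWithin 𝓘(ℝ, E m × E k) ((𝓡 m).prod (𝓡 k)) κ.toFun univ z)
    rw [mfderivWithin_univ]
    exact ((κ.smooth z hz).mdifferentiableAt (by simp)).hasMFDerivAt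
  have hcomp : HasMFDerivAt (𝓡 k) ((𝓡 m).prod (𝓡 k)) o 1 (D.comp L) := by
    refine (HasMFDerivAt.comp (1 : G) hD hL).congr_of_eventuallyEq ?_
    filter_upwards [hev] with g hg
    exact (κ.left_inv _ hg).symm
  have hv := A.vertical q ξ
  have h3 : (L ξ) = (0, (L ξ).2) := Prod.ext hfst rfl
  rw [← h3]
  refine Eq.trans ?_ hv
  have h4 : (mfderiv (𝓡 k) ((𝓡 m).prod (𝓡 k)) o 1 : E k →L[ℝ] E m × E k) = D.comp L :=
    hcomp.mfderiv
  exact congrArg (fun T : E k →L[ℝ] E m × E k => A.formAt q (T ξ)) h4.symm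

/-- A smooth horizontal section over an open set, with the property that a horizontal curve that
meets the section over the set stays on it for a while. -/
structure IsHorizontalSection (A : Connection m k G P) (proj : P → M) (V : Set M) (s : M → P) :
    Prop where
  isOpen : IsOpen V
  smooth : ∀ x ∈ V, ContMDiffAt (𝓡 m) ((𝓡 m).prod (𝓡 k)) ∞ s x
  proj_eq : ∀ x ∈ V, proj (s x) = x
  horizontal : ∀ x ∈ V, ∀ v : TangentSpace (𝓡 m) x,
    A.form (s x) (mfderiv (𝓡 m) ((𝓡 m).prod (𝓡 k)) s x v) = 0
  stay : ∀ c : ℝ → P, ContMDiffOn 𝓘(ℝ, ℝ) ((𝓡 m).prod (𝓡 k)) ∞ c (Icc 0 1) →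
    (∀ t ∈ Icc (0 : ℝ) 1, A.form (c t)
      (mfderivWithin 𝓘(ℝ, ℝ) ((𝓡 m).prod (𝓡 k)) c (Icc 0 1) t (1 : ℝ)) = 0) →
    ∀ t₀ ∈ Icc (0 : ℝ) 1, proj (c t₀) ∈ V → c t₀ = s (proj (c t₀)) →
      ∀ᶠ t in 𝓝[Icc 0 1] t₀, c t = s (proj (c t))

/-- In an adapted chart the horizontal spaces are graphs of a slope `U`, integrable by flatness, and
the Frobenius solution `g` through `p` gives the section `x ↦ (x, g x)`. The `stay` property is
uniqueness of horizontal lifts: a horizontal curve and the section over its projection solve the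
same equation. -/
theorem Connection.exists_horizontalSection (hP : IsPrincipalBundle m k G proj)
    {A : Connection m k G P} (hA : A.IsFlat) (p : P) :
    ∃ V s, IsHorizontalSection A proj V s ∧ proj p ∈ V ∧ s (proj p) = p := by
  obtain ⟨κ⟩ := hP.exists_adaptedChart p
  set θ := A.pullback κ.toFun univ with hθ
  have hκs : ∀ z ∈ κ.dom, ∀ᶠ w in 𝓝 z,
      ContMDiffAt 𝓘(ℝ, E m × E k) ((𝓡 m).prod (𝓡 k)) ∞ κ.toFun w := fun z hz => by
    filter_upwards [κ.isOpen_dom.mem_nhds hz] with w hw using κ.smooth w hw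
  have hθs : ContDiffOn ℝ ∞ θ κ.dom := fun z hz =>
    (A.contDiffAt_pullback (hκs z hz)).contDiffWithinAt
  have hL : ∀ z ∈ κ.dom, ∀ y, ∃ b, θ z (0, b) = y := fun z hz y => κ.exists_pullback_eq hP A hz y
  set U := fun z => kernelSlope (θ z) with hUdef
  have hUat : ∀ z ∈ κ.dom, ContDiffAt ℝ ∞ U z := fun z hz =>
    contDiffAt_kernelSlope (hθs.contDiffAt (κ.isOpen_dom.mem_nhds hz)) (hL z hz)
  set φ := extChartAt (𝓡 m) (proj p) with hφ
  set z₀ := κ.inv p with hz₀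
  have hz₀d : z₀ ∈ κ.dom := κ.mapsTo_inv κ.mem
  have hz₀1 : z₀.1 = φ (proj p) := κ.inv_fst p κ.mem
  obtain ⟨r, hr, g, hg0, hgs, hg⟩ := exists_contDiffOn_of_integrable (x₀ := z₀.1) (y₀ := z₀.2)
    (U := U) κ.isOpen_dom hz₀d (fun z hz => (hUat z hz).contDiffWithinAt)
    (fun z hz v w => kernelSlope_integrable κ.isOpen_dom hθs hL
      (fun z hz u v hu hv => hA.fderiv_pullback_symm (hκs z hz) hu hv) hz v w)
  set f : E m → E m × E k := fun y => (y, g y) with hf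
  set V := φ.source ∩ φ ⁻¹' Metric.ball z₀.1 r with hV
  have hVo : IsOpen V := (continuousOn_extChartAt _).isOpen_inter_preimage
    (isOpen_extChartAt_source _) Metric.isOpen_ball
  have hfd : ∀ y ∈ Metric.ball z₀.1 r, HasFDerivAt f
      ((ContinuousLinearMap.id ℝ (E m)).prod (U (y, g y))) y := fun y hy =>
    (hasFDerivAt_id y).prodMk (hg y hy).2
  have hfs : ∀ y ∈ Metric.ball z₀.1 r, ContDiffAt ℝ ∞ f y := fun y hy =>
    contDiffAt_id.prodMk (hgs.contDiffAt (Metric.isOpen_ball.mem_nhds hy))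
  have hφat : ∀ x ∈ V, ContMDiffAt (𝓡 m) 𝓘(ℝ, E m) ∞ φ x := fun x hx =>
    contMDiffAt_extChartAt' (by rw [← extChartAt_source (𝓡 m)]; exact hx.1)
  have hFs : ∀ y ∈ Metric.ball z₀.1 r,
      ContMDiffAt 𝓘(ℝ, E m) ((𝓡 m).prod (𝓡 k)) ∞ (κ.toFun ∘ f) y := fun y hy =>
    (κ.smooth _ (hg y hy).1).comp y (hfs y hy).contMDiffAt
  have hFh : ∀ y ∈ Metric.ball z₀.1 r, A.pullback (κ.toFun ∘ f) univ y = 0 := by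
    intro y hy
    rw [A.pullback_comp (F := κ.toFun) (f := f) (t := univ)
      ((κ.smooth _ (hg y hy).1).mdifferentiableAt (by simp)).mdifferentiableWithinAt
      (hfd y hy).differentiableAt.differentiableWithinAt (mapsTo_univ _ _)
      uniqueDiffWithinAt_univ, fderivWithin_univ, (hfd y hy).fderiv]
    ext1 v
    exact (apply_eq_zero_iff (hL _ (hg y hy).1) v _).2 rfl
  refine ⟨V, fun x => κ.toFun (f (φ x)), ⟨hVo, ?_, ?_, ?_, ?_⟩, ⟨mem_extChartAt_source _, ?_⟩, ?_⟩
  · intro x hx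
    exact (hFs _ hx.2).comp x (hφat x hx)
  · intro x hx
    rw [κ.proj_toFun (hg _ hx.2).1]
    exact φ.left_inv hx.1
  · intro x hx v
    have h1 : HasMFDerivAt (𝓡 m) ((𝓡 m).prod (𝓡 k)) ((κ.toFun ∘ f) ∘ φ) x _ :=
      HasMFDerivAt.comp x ((hFs _ hx.2).mdifferentiableAt (by simp)).hasMFDerivAt
        ((hφat x hx).mdifferentiableAt (by simp)).hasMFDerivAt
    let D : E m →L[ℝ] E m := mfderiv (𝓡 m) 𝓘(ℝ, E m) φ x
    have h2 := congrArg (fun T : E m →L[ℝ] E m × E k => A.formAt (κ.toFun (f (φ x))) (T v)) h1.mfderiv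
    refine h2.trans ?_
    have h3 := congrArg (fun T : E m →L[ℝ] E k => T (D v)) (hFh _ hx.2)
    refine Eq.trans ?_ h3
    unfold Connection.pullback vd
    rw [mfderivWithin_univ]
    rfl
  · intro c hc hch t₀ ht₀ hV₀ hs₀
    have hc₀ : κ.toFun (f (φ (proj (c t₀)))) = c t₀ := hs₀.symm
    have hmem₀ : f (φ (proj (c t₀))) ∈ κ.dom := (hg _ hV₀.2).1
    have hn₀ : c t₀ ∈ κ.nbhd := by rw [← hc₀]; exact κ.mapsTo hmem₀
    have hw₀ : κ.inv (c t₀) = f (φ (proj (c t₀))) := by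
      rw [← κ.right_inv _ hmem₀, hc₀]
    have hcn : ∀ᶠ t in 𝓝[Icc 0 1] t₀, c t ∈ κ.nbhd :=
      (hc t₀ ht₀).continuousWithinAt.eventually (κ.isOpen_nbhd.mem_nhds hn₀)
    set w := fun t => κ.inv (c t) with hw
    have hws : ∀ t ∈ Icc (0 : ℝ) 1, c t ∈ κ.nbhd → ContDiffWithinAt ℝ ∞ w (Icc 0 1) t :=
      fun t ht h => contMDiffWithinAt_iff_contDiffWithinAt.1
        ((κ.smooth_inv _ h).comp_contMDiffWithinAt t (hc t ht))
    have hwc := (hws t₀ ht₀ hn₀).continuousWithinAt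
    have hxball : ∀ᶠ t in 𝓝[Icc 0 1] t₀, (w t).1 ∈ Metric.ball z₀.1 r := by
      refine hwc.fst.eventually (p := (· ∈ Metric.ball z₀.1 r)) (Metric.isOpen_ball.mem_nhds ?_)
      change (κ.inv (c t₀)).1 ∈ _
      rw [hw₀]; exact hV₀.2
    have hcn2 := eventually_eventually_nhdsWithin.2 hcn
    -- In coordinates, horizontality of the curve says that its fibre velocity is the slope applied
    -- to its base velocity.
    have hmain : ∀ᶠ t in 𝓝[Icc 0 1] t₀, HasDerivWithinAt w
        (derivWithin (fun t => (w t).1) (Icc 0 1) t,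
          U (w t) (derivWithin (fun t => (w t).1) (Icc 0 1) t)) (Icc 0 1) t := by
      filter_upwards [hcn, hcn2, self_mem_nhdsWithin] with t ht ht2 ht01
      have hd := (hws t ht01 ht).differentiableWithinAt (by simp)
      have hu : UniqueDiffWithinAt ℝ (Icc (0 : ℝ) 1) t := uniqueDiffOn_Icc zero_lt_one t ht01
      have heq : c =ᶠ[𝓝[Icc 0 1] t] κ.toFun ∘ w := by
        filter_upwards [ht2] with u hu using (κ.left_inv _ hu).symm
      have h1 : A.pullback c (Icc 0 1) t 1 = 0 := hch t ht01
      have hdom : w t ∈ κ.dom := κ.mapsTo_inv ht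
      rw [A.pullback_congr heq (κ.left_inv _ ht).symm, A.pullback_comp (t := univ)
        ((κ.smooth _ hdom).mdifferentiableAt (by simp)).mdifferentiableWithinAt hd
        (mapsTo_univ _ _) hu] at h1
      have h2 := hd.hasDerivWithinAt
      have h3 : derivWithin (fun t => (w t).1) (Icc 0 1) t = (derivWithin w (Icc 0 1) t).1 :=
        HasDerivWithinAt.derivWithin
          ((ContinuousLinearMap.fst ℝ (E m) (E k)).hasFDerivAt.comp_hasDerivWithinAt
            (f := w) t h2) hu
      have h4 : θ (w t) ((derivWithin w (Icc 0 1) t).1, (derivWithin w (Icc 0 1) t).2) = 0 := h1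
      rw [apply_eq_zero_iff (hL _ hdom)] at h4
      rw [h3]
      have h5 : derivWithin w (Icc 0 1) t = ((derivWithin w (Icc 0 1) t).1,
        U (w t) (derivWithin w (Icc 0 1) t).1) := Prod.ext rfl h4
      rw [← h5]
      exact h2
    have hfin := eventually_eq_of_slope (U := U) (x := fun t => (w t).1) (y₁ := fun t => (w t).2)
      (y₂ := fun t => g (w t).1) ht₀ (by
        change (κ.inv (c t₀)).2 = g (κ.inv (c t₀)).1
        rw [hw₀]) ((hUat _ (κ.mapsTo_inv hn₀)).of_le (by norm_cast))
      ((contDiff_fst.contDiffAt.comp_contDiffWithinAt t₀ (hws t₀ ht₀ hn₀)).of_le (by norm_cast))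
      (by filter_upwards [hmain] with t ht using ht.snd)
      (by
        filter_upwards [hmain, hxball] with t ht hb
        exact (hg _ hb).2.comp_hasDerivWithinAt t ht.fst)
    filter_upwards [hfin, hcn] with t ht hn
    have h6 : κ.inv (c t) = f (φ (proj (c t))) := by
      rw [hφ, ← κ.inv_fst _ hn]
      exact Prod.ext rfl ht
    change c t = κ.toFun (f (φ (proj (c t))))
    rw [← h6, κ.left_inv _ hn]
  · rw [mem_preimage, ← hz₀1]
    exact Metric.mem_ball_self hr
  · change κ.toFun (φ (proj p), g (φ (proj p))) = p
    rw [← hz₀1, hg0]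
    exact κ.left_inv p κ.mem

end Sections

/-- Over a simply connected space, locally constant transition functions admit a flat section. -/
theorem exists_section_of_locallyConstant_cocycle {X G : Type*} [TopologicalSpace X]
    [SimplyConnectedSpace X] [LocallyPathConnectedSpace X] [Group G] {V : X → Set X}
    (hV : ∀ i, IsOpen (V i)) (hmem : ∀ x, x ∈ V x) (D : X → X → X → G)
    (hself : ∀ i, ∀ x ∈ V i, D i i x = 1)
    (hcomp : ∀ i j l, ∀ x ∈ V i ∩ V j ∩ V l, D j l x * D i j x = D i l x)
    (hloc : ∀ i j, ∀ x ∈ V i ∩ V j, ∀ᶠ y in 𝓝 x, D i j y = D i j x) (x₀ : X) (g₀ : G) :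
    ∃ f : X → G, f x₀ = g₀ ∧ ∀ i, ∀ x ∈ V i, ∀ᶠ y in 𝓝 x, D y i y * f y = D x i x * f x := by
  -- With discrete fibres, the locally constant cocycle glues to a fibre bundle that is a covering
  -- of `X`. As `X` is simply connected, the identity of `X` lifts to it through the given point,
  -- and the lift is the section.
  let _ : TopologicalSpace G := ⊥
  have : DiscreteTopology G := ⟨rfl⟩
  let Z : FiberBundleCore X X G :=
    { baseSet := V
      isOpen_baseSet := hV
      indexAt := id
      mem_baseSet_at := hmem
      coordChange := fun i j x g => D i j x * g
      coordChange_self := fun i x hx g => by rw [hself i x hx, one_mul]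
      continuousOn_coordChange := by
        rintro i j ⟨x, g⟩ ⟨hx, -⟩
        refine ContinuousAt.continuousWithinAt ?_
        rw [ContinuousAt, nhds_discrete G, tendsto_pure, nhds_prod_eq, nhds_discrete G]
        filter_upwards [(hloc i j x hx).prod_mk (show ∀ᶠ h in pure g, h = g from rfl)]
          with z hz
        rw [hz.1, hz.2]
      coordChange_comp := fun i j l x hx g => by rw [← mul_assoc, hcomp i j l x hx] }
  have hcov : IsCoveringMap (Bundle.TotalSpace.proj : Z.TotalSpace → X) :=
    FiberBundle.isCoveringMap
  obtain ⟨Φ, ⟨hΦ0, hΦ⟩, -⟩ := hcov.existsUnique_continuousMap_lifts (ContinuousMap.id X) x₀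
    (⟨x₀, g₀⟩ : Z.TotalSpace) rfl
  have hproj : ∀ x, (Φ x).proj = x := fun x => congrFun hΦ x
  have hex : ∀ x, ∃ g : G, Φ x = (⟨x, g⟩ : Z.TotalSpace) := fun x => by
    have := hproj x
    generalize Φ x = z at this
    obtain ⟨y, g⟩ := z
    obtain rfl : y = x := this
    exact ⟨g, rfl⟩
  choose f hf using hex
  refine ⟨f, ?_, ?_⟩
  · have h := hf x₀
    rw [hΦ0] at h
    injection h with _ h2
    exact h2.symm
  · intro i x hx
    -- Read in the trivialization `i`, the lift at `y` is `D y i y * f y`; continuity into a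
    -- discrete space is local constancy.
    have hc : ContinuousAt (fun y => (Z.localTriv i (Φ y)).2) x := by
      refine continuous_snd.continuousAt.comp ?_
      refine ContinuousAt.comp (g := Z.localTriv i) ?_ Φ.continuous.continuousAt
      refine (Z.localTriv i).continuousOn_toFun.continuousAt
        ((Z.localTriv i).open_source.mem_nhds ?_)
      rw [(Z.localTriv i).mem_source]
      change (Φ x).proj ∈ V i
      rw [hproj]
      exact hx
    rw [ContinuousAt, nhds_discrete G, tendsto_pure] at hc
    filter_upwards [hc] with y hy
    rw [hf, hf] at hy
    exact hy

/-! ### From local to global horizontal sections -/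

section Sections

variable {m k : ℕ}
  {M : Type*} [TopologicalSpace M] [ChartedSpace (E m) M] [IsManifold (𝓡 m) ∞ M]
  {G : Type*} [TopologicalSpace G] [ChartedSpace (E k) G] [Group G] [LieGroup (𝓡 k) ∞ G]
  {P : Type*} [TopologicalSpace P] [ChartedSpace (ModelProd (E m) (E k)) P]
  [IsManifold ((𝓡 m).prod (𝓡 k)) ∞ P] [MulAction Gᵐᵒᵖ P]
  {proj : P → M} {A : Connection m k G P} {V V' : Set M} {s s' : M → P}

open MulOpposite

theorem IsPrincipalBundle.exists_smul_eq (hP : IsPrincipalBundle m k G proj) {p q : P}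
    (h : proj p = proj q) : ∃ g : G, op g • p = q := by
  obtain ⟨U, hU, hpU, e, hes, het, he, he', hee⟩ := hP.locally_trivial (proj p)
  have hp : p ∈ e.source := by rw [hes]; exact hpU
  have hq : q ∈ e.source := by rw [hes, mem_preimage, ← h]; exact hpU
  refine ⟨(e p).2⁻¹ * (e q).2, e.injOn ?_ hq ?_⟩
  · rw [hes, mem_preimage, hP.proj_action]; exact hpU
  · rw [(hee p hp).2, mul_inv_cancel_left, (hee p hp).1, h, ← (hee q hq).1]

theorem IsPrincipalBundle.smul_left_injective (hP : IsPrincipalBundle m k G proj) {p : P} {g h : G}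
    (hgh : op g • p = op h • p) : g = h := by
  obtain ⟨U, hU, hpU, e, hes, het, he, he', hee⟩ := hP.locally_trivial (proj p)
  have hp : p ∈ e.source := by rw [hes]; exact hpU
  have h1 := congrArg (fun q => (e q).2) hgh
  simp only [(hee p hp).2] at h1
  exact mul_left_cancel h1

theorem IsPrincipalBundle.surjective_proj (hP : IsPrincipalBundle m k G proj) :
    Function.Surjective proj := by
  intro x
  obtain ⟨U, hU, hxU, e, hes, het, he, he', hee⟩ := hP.locally_trivial x
  have h : (x, (1 : G)) ∈ e.target := by rw [het]; exact ⟨hxU, mem_univ _⟩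
  exact ⟨e.symm (x, 1), by rw [← (hee _ (e.map_target h)).1, e.right_inv h]⟩

theorem Connection.form_smul (hP : IsPrincipalBundle m k G proj) (A : Connection m k G P) (g : G)
    {W : Type*} [NormedAddCommGroup W] [NormedSpace ℝ W] {c : W → P} {S : Set W} {z v : W}
    (hc : MDifferentiableWithinAt 𝓘(ℝ, W) ((𝓡 m).prod (𝓡 k)) c S z)
    (hS : UniqueDiffWithinAt ℝ S z) :
    A.pullback (fun w => op g • c w) S z v = Ad g⁻¹ (A.pullback c S z v) := by
  have h1 := mfderivWithin_comp z (u := univ) (g := fun q : P => op g • q)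
    (((hP.smooth_smul g).mdifferentiableAt (by simp)).mdifferentiableWithinAt) hc
    (subset_univ _) hS.uniqueMDiffWithinAt
  rw [mfderivWithin_univ] at h1
  refine Eq.trans ?_ (A.equivariant (c z) g _)
  exact congrArg (fun T : W →L[ℝ] E m × E k => A.formAt (op g • c z) (T v)) h1

theorem IsHorizontalSection.smul (hP : IsPrincipalBundle m k G proj)
    (hs : IsHorizontalSection A proj V s) (g : G) :
    IsHorizontalSection A proj V (fun x => op g • s x) := by
  have hAd : ∀ h : G, Ad h (0 : E k) = 0 := fun h => by rw [Ad_eq_AdL, map_zero]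
  refine ⟨hs.isOpen, fun x hx => ((hP.smooth_smul g) _).comp x (hs.smooth x hx), fun x hx => ?_,
    fun x hx v => ?_, fun c hc hch t₀ ht₀ hV hct => ?_⟩
  · rw [hP.proj_action, hs.proj_eq x hx]
  · have h1 : HasMFDerivAt (𝓡 m) ((𝓡 m).prod (𝓡 k)) ((fun q : P => op g • q) ∘ s) x _ :=
      HasMFDerivAt.comp x (((hP.smooth_smul g).mdifferentiableAt (by simp)).hasMFDerivAt)
        ((hs.smooth x hx).mdifferentiableAt (by simp)).hasMFDerivAt
    have h2 := congrArg (fun T : E m →L[ℝ] E m × E k => A.formAt (op g • s x) (T v)) h1.mfderiv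
    refine h2.trans ((A.equivariant (s x) g _).trans ?_)
    exact (congrArg (Ad g⁻¹) (hs.horizontal x hx v)).trans (hAd _)
  · have hback : ∀ t, op g⁻¹ • c t = s (proj (op g⁻¹ • c t)) ↔ c t = op g • s (proj (c t)) := by
      intro t
      rw [hP.proj_action, op_inv, inv_smul_eq_iff]
    have h2 := hs.stay (fun t => op g⁻¹ • c t)
      (fun t ht => ((hP.smooth_smul g⁻¹) _).comp_contMDiffWithinAt t (hc t ht))
      (fun t ht => by
        have h3 : A.pullback c (Icc 0 1) t 1 = 0 := hch t ht
        have h4 := A.form_smul hP g⁻¹ (c := c) (v := 1)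
          ((hc t ht).mdifferentiableWithinAt (by simp)) (uniqueDiffOn_Icc zero_lt_one t ht)
        rw [h3, hAd] at h4
        exact h4) t₀ ht₀ (by simp only [hP.proj_action]; exact hV) ((hback t₀).2 hct)
    filter_upwards [h2] with t ht using (hback t).1 ht

theorem IsHorizontalSection.mono (hs : IsHorizontalSection A proj V s) (hV : IsOpen V')
    (h : V' ⊆ V) : IsHorizontalSection A proj V' s :=
  ⟨hV, fun x hx => hs.smooth x (h hx), fun x hx => hs.proj_eq x (h hx),
    fun x hx => hs.horizontal x (h hx),
    fun c hc hch t₀ ht₀ hV' hct => hs.stay c hc hch t₀ ht₀ (h hV') hct⟩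

theorem IsHorizontalSection.congr (hP : IsPrincipalBundle m k G proj)
    (hs : IsHorizontalSection A proj V s) (h : EqOn s' s V) :
    IsHorizontalSection A proj V s' := by
  have hev : ∀ x ∈ V, s' =ᶠ[𝓝 x] s := fun x hx => h.eventuallyEq_of_mem (hs.isOpen.mem_nhds hx)
  refine ⟨hs.isOpen, fun x hx => (hs.smooth x hx).congr_of_eventuallyEq (hev x hx),
    fun x hx => by rw [h hx, hs.proj_eq x hx], fun x hx v => ?_, fun c hc hch t₀ ht₀ hV hct => ?_⟩
  · have h1 := (hev x hx).mfderiv_eq (I := 𝓡 m) (I' := (𝓡 m).prod (𝓡 k))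
    refine Eq.trans ?_ (hs.horizontal x hx v)
    have h2 : ∀ q : P, q = s x → ∀ w : E m × E k, A.formAt q w = A.formAt (s x) w := by
      rintro _ rfl w; rfl
    refine (h2 _ (h hx) _).trans ?_
    exact congrArg (fun T : E m →L[ℝ] E m × E k => A.formAt (s x) (T v)) h1
  · rw [h hV] at hct
    have h3 : ∀ᶠ t in 𝓝[Icc 0 1] t₀, proj (c t) ∈ V :=
      (hP.smooth_proj.continuous.continuousAt.comp_continuousWithinAt
        (hc t₀ ht₀).continuousWithinAt).eventually (hs.isOpen.mem_nhds hV)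
    filter_upwards [hs.stay c hc hch t₀ ht₀ hV hct, h3] with t ht1 ht2
    rw [h ht2, ← ht1]

/-- The group element that carries the section to the curve is locally constant in time, by `stay`
applied to translates of the section. -/
theorem IsHorizontalSection.eq_of_curve (hP : IsPrincipalBundle m k G proj)
    (hs : IsHorizontalSection A proj V s) {c : ℝ → P}
    (hc : ContMDiffOn 𝓘(ℝ, ℝ) ((𝓡 m).prod (𝓡 k)) ∞ c (Icc 0 1))
    (hch : ∀ t ∈ Icc (0 : ℝ) 1, A.form (c t)
      (mfderivWithin 𝓘(ℝ, ℝ) ((𝓡 m).prod (𝓡 k)) c (Icc 0 1) t (1 : ℝ)) = 0)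
    (hV : ∀ t ∈ Icc (0 : ℝ) 1, proj (c t) ∈ V) {h : G} (h0 : c 0 = op h • s (proj (c 0))) :
    c 1 = op h • s (proj (c 1)) := by
  have hex : ∀ t, ∃ g : G, t ∈ Icc (0 : ℝ) 1 → c t = op g • s (proj (c t)) := fun t => by
    by_cases ht : t ∈ Icc (0 : ℝ) 1
    · obtain ⟨g, hg⟩ := hP.exists_smul_eq (p := s (proj (c t))) (q := c t) (hs.proj_eq _ (hV t ht))
      exact ⟨g, fun _ => hg.symm⟩
    · exact ⟨1, fun h => absurd h ht⟩
  choose g hg using hex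
  have key : ∀ t ∈ Icc (0 : ℝ) 1, ∀ᶠ t' in 𝓝[Icc 0 1] t, g t' = g t := by
    intro t ht
    filter_upwards [(hs.smul hP (g t)).stay c hc hch t ht (hV t ht) (hg t ht),
      self_mem_nhdsWithin] with t' h1 h2
    exact hP.smul_left_injective ((hg t' h2).symm.trans h1)
  have h01 : (0 : ℝ) ∈ Icc (0 : ℝ) 1 := by simp
  have h11 : (1 : ℝ) ∈ Icc (0 : ℝ) 1 := by simp
  have h1 := eqOn_of_eventually_eq isPreconnected_Icc key h01 h11
  rw [hP.smul_left_injective (h0.symm.trans (hg 0 h01)), h1]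
  exact hg 1 h11

/-- Horizontal sections restrict to horizontal curves. -/
theorem IsHorizontalSection.pullback_comp (hs : IsHorizontalSection A proj V s) {W : Type*}
    [NormedAddCommGroup W] [NormedSpace ℝ W] {γ : W → M} {S : Set W} {z : W}
    (hγ : MDifferentiableWithinAt 𝓘(ℝ, W) (𝓡 m) γ S z) (hS : UniqueDiffWithinAt ℝ S z)
    (hz : γ z ∈ V) : A.pullback (fun w => s (γ w)) S z = 0 := by
  have h1 := mfderivWithin_comp z (u := univ) (g := s)
    (((hs.smooth _ hz).mdifferentiableAt (by simp)).mdifferentiableWithinAt) hγ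
    (subset_univ _) hS.uniqueMDiffWithinAt
  rw [mfderivWithin_univ] at h1
  ext1 v
  refine Eq.trans ?_ (hs.horizontal (γ z) hz (mfderivWithin 𝓘(ℝ, W) (𝓡 m) γ S z v))
  exact congrArg (fun T : W →L[ℝ] E m × E k => A.formAt (s (γ z)) (T v)) h1

/-- Along a straight segment in a chart from `x` to `y`, the section `s'` is a horizontal curve, and
such a curve stays on a fixed translate of `s`. -/
theorem IsHorizontalSection.eventually_eq (hP : IsPrincipalBundle m k G proj)
    (hs : IsHorizontalSection A proj V s) (hs' : IsHorizontalSection A proj V' s') {x : M}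
    (hx : x ∈ V) (hx' : x ∈ V') {h : G} (hh : s' x = op h • s x) :
    ∀ᶠ y in 𝓝 x, s' y = op h • s y := by
  set φ := extChartAt (𝓡 m) x with hφ
  have hO : IsOpen (φ.target ∩ φ.symm ⁻¹' (V ∩ V')) :=
    (continuousOn_extChartAt_symm _).isOpen_inter_preimage (isOpen_extChartAt_target _)
      (hs.isOpen.inter hs'.isOpen)
  have hx0 : φ.symm (φ x) = x := extChartAt_to_inv x
  obtain ⟨r, hr, hball⟩ := Metric.isOpen_iff.1 hO (φ x)
    ⟨mem_extChartAt_target x, by rw [mem_preimage, hx0]; exact ⟨hx, hx'⟩⟩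
  have hev : ∀ᶠ y in 𝓝 x, y ∈ φ.source ∧ φ y ∈ Metric.ball (φ x) r :=
    Filter.Eventually.and ((isOpen_extChartAt_source x).mem_nhds (mem_extChartAt_source x))
      ((continuousAt_extChartAt x).eventually (Metric.ball_mem_nhds _ hr))
  filter_upwards [hev] with y hy
  set ℓ := fun t : ℝ => φ x + t • (φ y - φ x) with hℓ
  have hℓb : ∀ t ∈ Icc (0 : ℝ) 1, ℓ t ∈ Metric.ball (φ x) r := fun t ht =>
    (convex_ball (φ x) r).add_smul_sub_mem (Metric.mem_ball_self hr) hy.2 ht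
  have hℓs : ContDiff ℝ ∞ ℓ := contDiff_const.add (contDiff_id.smul contDiff_const)
  set γ := fun t : ℝ => φ.symm (ℓ t) with hγ
  have hγV : ∀ t ∈ Icc (0 : ℝ) 1, γ t ∈ V ∩ V' := fun t ht => (hball (hℓb t ht)).2
  have hγs : ∀ t ∈ Icc (0 : ℝ) 1, ContMDiffAt 𝓘(ℝ, ℝ) (𝓡 m) ∞ γ t := fun t ht =>
    (contMDiffAt_extChartAt_symm (hball (hℓb t ht)).1).comp t hℓs.contDiffAt.contMDiffAt
  have hγ0 : γ 0 = x := by simp [hγ, hℓ, hx0]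
  have hγ1 : γ 1 = y := by simp [hγ, hℓ, φ.left_inv hy.1]
  have h1 := hs.eq_of_curve hP (c := fun t => s' (γ t)) (h := h)
    (fun t ht => ((hs'.smooth _ (hγV t ht).2).comp t (hγs t ht)).contMDiffWithinAt)
    (fun t ht => congrArg (fun T : ℝ →L[ℝ] E k => T 1) (hs'.pullback_comp
      ((hγs t ht).mdifferentiableAt (by simp)).mdifferentiableWithinAt
      (uniqueDiffOn_Icc zero_lt_one t ht) (hγV t ht).2))
    (fun t ht => by rw [hs'.proj_eq _ (hγV t ht).2]; exact (hγV t ht).1)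
    (by rw [hγ0, hs'.proj_eq _ hx', hh])
  simp only [hγ1] at h1
  rw [hs'.proj_eq y (by rw [← hγ1]; exact (hγV 1 (by simp)).2)] at h1
  exact h1

/-- A flat connection over a simply connected base has a global horizontal section. -/
theorem Connection.exists_global_horizontalSection [SimplyConnectedSpace M]
    (hP : IsPrincipalBundle m k G proj) (hA : A.IsFlat) (p₀ : P) :
    ∃ s, IsHorizontalSection A proj univ s ∧ s (proj p₀) = p₀ := by
  have : LocallyPathConnectedSpace M := ChartedSpace.locallyPathConnectedSpace (E m) M
  have hloc : ∀ x : M, ∃ V s, IsHorizontalSection A proj V s ∧ x ∈ V := fun x => by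
    obtain ⟨p, rfl⟩ := hP.surjective_proj x
    obtain ⟨V, s, h1, h2, -⟩ := Connection.exists_horizontalSection hP hA p
    exact ⟨V, s, h1, h2⟩
  choose V σ hσ hxV using hloc
  -- Transition functions between horizontal sections are locally constant, so they form a cocycle
  -- of the kind required above. The right action reverses the order of composition.
  have hdiv : ∀ i j x, ∃ g : G, x ∈ V i ∩ V j → σ i x = op g • σ j x := fun i j x => by
    by_cases hx : x ∈ V i ∩ V j
    · obtain ⟨g, hg⟩ := hP.exists_smul_eq (p := σ j x) (q := σ i x)
        (by rw [(hσ j).proj_eq x hx.2, (hσ i).proj_eq x hx.1])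
      exact ⟨g, fun _ => hg.symm⟩
    · exact ⟨1, fun h => absurd h hx⟩
  choose D hD using hdiv
  obtain ⟨g₀, hg₀⟩ := hP.exists_smul_eq (p := σ (proj p₀) (proj p₀)) (q := p₀)
    ((hσ _).proj_eq _ (hxV _))
  obtain ⟨f, hf0, hf⟩ := exists_section_of_locallyConstant_cocycle (fun i => (hσ i).isOpen) hxV D
    (fun i x hx => hP.smul_left_injective (p := σ i x)
      ((hD i i x ⟨hx, hx⟩).symm.trans (by simp)))
    (fun i j l x hx => hP.smul_left_injective (p := σ l x) (by
      rw [← hD i l x ⟨hx.1.1, hx.2⟩, op_mul, mul_smul, ← hD j l x ⟨hx.1.2, hx.2⟩,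
        ← hD i j x hx.1]))
    (fun i j x hx => by
      filter_upwards [(hσ j).eventually_eq hP (hσ i) hx.2 hx.1 (hD i j x hx),
        ((hσ i).isOpen.inter (hσ j).isOpen).mem_nhds hx] with y h1 h2
      exact hP.smul_left_injective ((hD i j y h2).symm.trans h1))
    (proj p₀) g₀
  have hself : ∀ x, D x x x = 1 := fun x => hP.smul_left_injective (p := σ x x)
    ((hD x x x ⟨hxV x, hxV x⟩).symm.trans (by simp))
  set s := fun x => op (f x) • σ x x with hs
  have hs0 : s (proj p₀) = p₀ := by simp only [hs, hf0, hg₀]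
  -- Near each point the glued section is one fixed translate of a local horizontal section, so all
  -- its properties are inherited.
  have hnear : ∀ x, ∀ᶠ y in 𝓝 x, s y = op (f x) • σ x y := fun x => by
    filter_upwards [hf x x (hxV x), (hσ x).isOpen.mem_nhds (hxV x)] with y h1 h2
    rw [hself, one_mul] at h1
    rw [hs, ← h1, op_mul, mul_smul, ← hD y x y ⟨hxV y, h2⟩]
  have hsec : ∀ x, ∃ V', x ∈ V' ∧ IsHorizontalSection A proj V' s := fun x => by
    obtain ⟨O, hO1, hO, hxO⟩ := eventually_nhds_iff.1 (hnear x)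
    exact ⟨V x ∩ O, ⟨hxV x, hxO⟩, (((hσ x).smul hP (f x)).mono ((hσ x).isOpen.inter hO)
      inter_subset_left).congr hP fun y hy => hO1 y hy.2⟩
  refine ⟨s, ⟨isOpen_univ, fun x _ => ?_, fun x _ => ?_, fun x _ => ?_,
    fun c hc hch t₀ ht₀ _ hct => ?_⟩, hs0⟩
  · obtain ⟨V', h1, h2⟩ := hsec x
    exact h2.smooth x h1
  · obtain ⟨V', h1, h2⟩ := hsec x
    exact h2.proj_eq x h1
  · obtain ⟨V', h1, h2⟩ := hsec x
    exact h2.horizontal x h1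
  · obtain ⟨V', h1, h2⟩ := hsec (proj (c t₀))
    exact h2.stay c hc hch t₀ ht₀ h1 hct

end Sections

/-! ### Smooth paths between any two points -/

section SmoothPaths

variable {m : ℕ} {M : Type*} [TopologicalSpace M] [ChartedSpace (E m) M] [IsManifold (𝓡 m) ∞ M]

variable (m) in
/-- Two points are joined by a smooth path that is constant at both ends. -/
def SmoothlyJoined (x y : M) : Prop :=
  ∃ γ : ℝ → M, ContMDiff 𝓘(ℝ, ℝ) (𝓡 m) ∞ γ ∧ (∀ t ≤ 0, γ t = x) ∧ ∀ t, 1 ≤ t → γ t = y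

theorem SmoothlyJoined.symm {x y : M} (h : SmoothlyJoined m x y) : SmoothlyJoined m y x := by
  obtain ⟨γ, h1, h2, h3⟩ := h
  refine ⟨fun t => γ (1 - t), h1.comp (contDiff_const.sub contDiff_id).contMDiff,
    fun t ht => h3 _ (by linarith), fun t ht => h2 _ (by linarith)⟩

/-- Each path is run in a third of the time, so both pieces are constantly `y` on `[1/3, 2/3]`, and
switching at `1/2` is smooth. -/
theorem SmoothlyJoined.trans {x y z : M} (h : SmoothlyJoined m x y) (h' : SmoothlyJoined m y z) :
    SmoothlyJoined m x z := by
  obtain ⟨γ, h1, h2, h3⟩ := h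
  obtain ⟨γ', h1', h2', h3'⟩ := h'
  have hs : ContMDiff 𝓘(ℝ, ℝ) (𝓡 m) ∞ fun t => γ (3 * t) :=
    h1.comp (contDiff_const.mul contDiff_id).contMDiff
  have hs' : ContMDiff 𝓘(ℝ, ℝ) (𝓡 m) ∞ fun t => γ' (3 * t - 2) :=
    h1'.comp ((contDiff_const.mul contDiff_id).sub contDiff_const).contMDiff
  refine ⟨fun t => if t < 1 / 2 then γ (3 * t) else γ' (3 * t - 2), fun t => ?_, fun t ht => ?_,
    fun t ht => ?_⟩
  · rcases lt_or_ge t (1 / 2) with ht | ht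
    · refine (hs t).congr_of_eventuallyEq ?_
      filter_upwards [Iio_mem_nhds ht] with u hu
      exact if_pos hu
    · refine (hs' t).congr_of_eventuallyEq ?_
      filter_upwards [Ioi_mem_nhds (show (1 / 3 : ℝ) < t by linarith)] with u hu
      have hu : 1 / 3 < u := hu
      split_ifs with h
      · rw [h3 _ (by linarith), h2' _ (by linarith)]
      · rfl
  · simp only [if_pos (show t < 1 / 2 by linarith), h2 (3 * t) (by linarith)]
  · simp only [if_neg (show ¬ t < 1 / 2 by linarith), h3' (3 * t - 2) (by linarith)]

theorem eventually_smoothlyJoined (x : M) : ∀ᶠ y in 𝓝 x, SmoothlyJoined m x y := by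
  set φ := extChartAt (𝓡 m) x with hφ
  obtain ⟨r, hr, hball⟩ := Metric.isOpen_iff.1 (isOpen_extChartAt_target (I := 𝓡 m) x) (φ x)
    (mem_extChartAt_target x)
  have hev : ∀ᶠ y in 𝓝 x, y ∈ φ.source ∧ φ y ∈ Metric.ball (φ x) r :=
    Filter.Eventually.and ((isOpen_extChartAt_source x).mem_nhds (mem_extChartAt_source x))
      ((continuousAt_extChartAt x).eventually (Metric.ball_mem_nhds _ hr))
  filter_upwards [hev] with y hy
  set ℓ := fun t : ℝ => φ x + Real.smoothTransition t • (φ y - φ x) with hℓ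
  have hℓb : ∀ t, ℓ t ∈ φ.target := fun t =>
    hball ((convex_ball (φ x) r).add_smul_sub_mem (Metric.mem_ball_self hr) hy.2
      ⟨Real.smoothTransition.nonneg t, Real.smoothTransition.le_one t⟩)
  have hℓs : ContDiff ℝ ∞ ℓ :=
    contDiff_const.add (Real.smoothTransition.contDiff.smul contDiff_const)
  refine ⟨fun t => φ.symm (ℓ t), fun t =>
    (contMDiffAt_extChartAt_symm (hℓb t)).comp t hℓs.contDiffAt.contMDiffAt, fun t ht => ?_,
    fun t ht => ?_⟩
  · simp only [hℓ, Real.smoothTransition.zero_of_nonpos ht, zero_smul, add_zero]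
    exact extChartAt_to_inv x
  · simp only [hℓ, Real.smoothTransition.one_of_one_le ht, one_smul, add_sub_cancel]
    exact φ.left_inv hy.1

/-- Being joined to `x` is a locally constant property, and it holds at `x`. -/
theorem smoothlyJoined [PreconnectedSpace M] (x y : M) : SmoothlyJoined m x y := by
  have h := eqOn_of_eventually_eq (f := fun z => SmoothlyJoined m x z)
    (isPreconnected_univ : IsPreconnected (univ : Set M)) (fun z _ => by
      rw [nhdsWithin_univ]
      filter_upwards [eventually_smoothlyJoined (m := m) z] with w hw
      exact propext ⟨fun h => h.trans hw.symm, fun h => h.trans hw⟩) (mem_univ x) (mem_univ y)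
  exact h.mp ⟨fun _ => x, contMDiff_const, fun _ _ => rfl, fun _ _ => rfl⟩

end SmoothPaths

/-! ### Parallel transport is given by the horizontal section -/

section Frame

variable {m k : ℕ}
  {M : Type*} [TopologicalSpace M] [ChartedSpace (E m) M] [IsManifold (𝓡 m) ∞ M]
  {G : Type*} [TopologicalSpace G] [ChartedSpace (E k) G] [Group G] [LieGroup (𝓡 k) ∞ G]
  {P : Type*} [TopologicalSpace P] [ChartedSpace (ModelProd (E m) (E k)) P]
  [IsManifold ((𝓡 m).prod (𝓡 k)) ∞ P] [MulAction Gᵐᵒᵖ P]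
  {proj : P → M} {A : Connection m k G P} {s : M → P}

/-- Horizontal curves starting on the section never leave it, so every transport of `p₀` lies on it.
One transport to each fibre exists: the image under the section of a smooth path. This is path
independence. -/
theorem IsHorizontalSection.frame_eq [PreconnectedSpace M] (hP : IsPrincipalBundle m k G proj)
    (hs : IsHorizontalSection A proj univ s) {p₀ : P} (h0 : s (proj p₀) = p₀) (x : M) :
    A.frame proj p₀ x = s x := by
  have huniq : ∀ q, A.IsTransport p₀ q → q = s (proj q) := by
    intro q hq
    induction hq with
    | refl => exact h0.symm
    | @tail p q _ hpq ih =>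
      obtain ⟨c, hc, hc0, hc1, hch⟩ := hpq
      have h1 := hs.eq_of_curve hP hc hch (fun _ _ => mem_univ _) (h := 1)
        (by rw [hc0, MulOpposite.op_one, one_smul]; exact ih)
      rwa [hc1, MulOpposite.op_one, one_smul] at h1
  have hex : ∃ q : P, proj q = x ∧ A.IsTransport p₀ q := by
    obtain ⟨γ, h1, h2, h3⟩ := smoothlyJoined (m := m) (proj p₀) x
    refine ⟨s x, hs.proj_eq x (mem_univ x), Relation.ReflTransGen.single
      ⟨fun t => s (γ t), ?_, ?_, ?_, fun t ht => ?_⟩⟩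
    · exact fun t _ => ((hs.smooth _ (mem_univ _)).comp t (h1 t)).contMDiffWithinAt
    · simp only [h2 0 le_rfl, h0]
    · simp only [h3 1 le_rfl]
    · exact congrArg (fun T : ℝ →L[ℝ] E k => T 1) (hs.pullback_comp
        ((h1 t).mdifferentiableAt (by simp)).mdifferentiableWithinAt
        (uniqueDiffOn_Icc zero_lt_one t ht) (mem_univ _))
  rw [Connection.frame, dif_pos hex, huniq _ hex.choose_spec.2, hex.choose_spec.1]

end Frame

/-! ### Pullbacks of the transported form -/

section Pull

variable {m k r : ℕ}
  {M : Type*} [TopologicalSpace M] [ChartedSpace (E m) M] [IsManifold (𝓡 m) ∞ M]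
  {G : Type*} [TopologicalSpace G] [ChartedSpace (E k) G] [Group G] [LieGroup (𝓡 k) ∞ G]
  {P : Type*} [TopologicalSpace P] [ChartedSpace (ModelProd (E m) (E k)) P]
  [IsManifold ((𝓡 m).prod (𝓡 k)) ∞ P] [MulAction Gᵐᵒᵖ P]
  {proj : P → M} {A : Connection m k G P} {s : M → P}
  {V W : Type*} [NormedAddCommGroup V] [NormedSpace ℝ V] [NormedAddCommGroup W] [NormedSpace ℝ W]

/-- The value of an adjoint form in a frame, as an alternating map on the model space. -/
def AdForm.formAt (B : AdForm m k G proj r) (p : P) : E m [⋀^Fin r]→L[ℝ] E k := B.form p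

/-- The pullback to a vector space of an adjoint form in the frame given by a section. -/
def AdForm.pull (B : AdForm m k G proj r) (s : M → P) (F : W → M) (S : Set W) (z : W) :
    W [⋀^Fin r]→L[ℝ] E k :=
  (B.formAt (s (F z))).compContinuousLinearMap (vd (𝓡 m) F S z)

theorem AdForm.pull_apply (B : AdForm m k G proj r) (s : M → P) (F : W → M) (S : Set W) (z : W)
    (ζ : Fin r → W) :
    B.pull s F S z ζ = B.formAt (s (F z)) fun i => vd (𝓡 m) F S z (ζ i) := rfl

theorem AdForm.pull_comp (B : AdForm m k G proj r) (s : M → P) {F : W → M} {f : V → W} {S : Set V}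
    {T : Set W} {z : V} (hF : MDifferentiableWithinAt 𝓘(ℝ, W) (𝓡 m) F T (f z))
    (hf : DifferentiableWithinAt ℝ f S z) (hST : MapsTo f S T) (hS : UniqueDiffWithinAt ℝ S z) :
    B.pull s (F ∘ f) S z = (B.pull s F T (f z)).compContinuousLinearMap (fderivWithin ℝ f S z) := by
  rw [AdForm.pull, vd_comp hF hf hST hS]
  rfl

theorem AdForm.pull_congr (B : AdForm m k G proj r) (s : M → P) {F F' : W → M} {S : Set W} {z : W}
    (h : F =ᶠ[𝓝[S] z] F') (hz : F z = F' z) : B.pull s F S z = B.pull s F' S z := by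
  rw [AdForm.pull, AdForm.pull, vd_congr h hz, hz]

theorem transported_eq [PreconnectedSpace M] (hP : IsPrincipalBundle m k G proj)
    (hs : IsHorizontalSection A proj univ s) {p₀ : P} (h0 : s (proj p₀) = p₀)
    (B : AdForm m k G proj r) (x : M) (v : Fin r → E m) :
    (transported A B p₀ x v : E k) = B.formAt (s x) v :=
  congrArg (fun p => B.formAt p v) (hs.frame_eq hP h0 x)

/-- The lift of an adjoint form to the total space, in the preferred chart at `q`. -/
def AdForm.chartForm (B : AdForm m k G proj r) (q : P) (z : E m × E k) :
    (E m × E k) [⋀^Fin r]→L[ℝ] E k :=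
  (B.formAt (chartInv m P q z)).compContinuousLinearMap
    ((mfderiv ((𝓡 m).prod (𝓡 k)) (𝓡 m) proj (chartInv m P q z) : E m × E k →L[ℝ] E m).comp
      (vd ((𝓡 m).prod (𝓡 k)) (chartInv m P q) univ z))

theorem AdForm.contDiffOn_chartForm (B : AdForm m k G proj r) (q : P) :
    ContDiffOn ℝ ∞ (B.chartForm q) (extChartAt ((𝓡 m).prod (𝓡 k)) q).target := by
  have h := B.smooth q
  refine h.congr fun z _ => ?_
  unfold AdForm.chartForm vd
  rw [mfderivWithin_univ]
  rfl

/-- Smoothness of `B` is known only for its lift to the total space. Since `F = proj ∘ s ∘ F`, the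
pullback by `F` is the pullback of that lift by `s ∘ F`, so the regularity carries over. -/
theorem AdForm.pull_eq_chartForm (hP : IsPrincipalBundle m k G proj) (B : AdForm m k G proj r)
    (hs : IsHorizontalSection A proj univ s) {F : W → M} {S : Set W} {z : W} {q : P}
    (hF : ContMDiffWithinAt 𝓘(ℝ, W) (𝓡 m) ∞ F S z) (hS : UniqueDiffWithinAt ℝ S z)
    (hq : s (F z) ∈ (extChartAt ((𝓡 m).prod (𝓡 k)) q).source) :
    B.pull s F S z =
      (B.chartForm q (extChartAt ((𝓡 m).prod (𝓡 k)) q (s (F z)))).compContinuousLinearMap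
        (fderivWithin ℝ (fun w => extChartAt ((𝓡 m).prod (𝓡 k)) q (s (F w))) S z) := by
  set c := extChartAt ((𝓡 m).prod (𝓡 k)) q with hc
  have hsF : ContMDiffWithinAt 𝓘(ℝ, W) ((𝓡 m).prod (𝓡 k)) ∞ (fun w => s (F w)) S z :=
    (hs.smooth _ (mem_univ _)).comp_contMDiffWithinAt z hF
  have hcF : DifferentiableWithinAt ℝ (fun w => c (s (F w))) S z :=
    (contMDiffWithinAt_iff_contDiffWithinAt.1
      ((contMDiffAt_extChartAt' (by rwa [← extChartAt_source ((𝓡 m).prod (𝓡 k))])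
        ).comp_contMDiffWithinAt z hsF)).differentiableWithinAt (by simp)
  have hinv : chartInv m P q (c (s (F z))) = s (F z) := c.left_inv hq
  have hci : MDifferentiableAt 𝓘(ℝ, E m × E k) ((𝓡 m).prod (𝓡 k)) (chartInv m P q)
      (c (s (F z))) :=
    (contMDiffAt_extChartAt_symm (c.map_source hq)).mdifferentiableAt (by simp)
  have h1 : vd ((𝓡 m).prod (𝓡 k)) (fun w => s (F w)) S z =
      (vd ((𝓡 m).prod (𝓡 k)) (chartInv m P q) univ (c (s (F z)))).comp
        (fderivWithin ℝ (fun w => c (s (F w))) S z) := by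
    rw [← vd_comp (F := chartInv m P q) (f := fun w => c (s (F w)))
      hci.mdifferentiableWithinAt hcF (mapsTo_univ _ _) hS]
    refine vd_congr ?_ hinv.symm
    have h4 : ∀ᶠ w in 𝓝[S] z, s (F w) ∈ c.source :=
      hsF.continuousWithinAt.eventually ((isOpen_extChartAt_source q).mem_nhds hq)
    filter_upwards [h4] with w hw
    exact (c.left_inv hw).symm
  have h2 : vd (𝓡 m) F S z =
      (mfderiv ((𝓡 m).prod (𝓡 k)) (𝓡 m) proj (s (F z)) : E m × E k →L[ℝ] E m).comp
        (vd ((𝓡 m).prod (𝓡 k)) (fun w => s (F w)) S z) := by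
    have h5 := mfderivWithin_comp z (u := univ) (g := proj)
      ((hP.smooth_proj.mdifferentiableAt (by simp)).mdifferentiableWithinAt)
      (hsF.mdifferentiableWithinAt (by simp)) (subset_univ _) hS.uniqueMDiffWithinAt
    rw [mfderivWithin_univ] at h5
    have h6 : vd (𝓡 m) F S z = vd (𝓡 m) (proj ∘ fun w => s (F w)) S z :=
      vd_congr (Eventually.of_forall fun w => (hs.proj_eq _ (mem_univ _)).symm)
        (hs.proj_eq _ (mem_univ _)).symm
    rw [h6]
    exact h5
  rw [AdForm.pull, h2, h1]
  exact (congrArg (fun p : P => (B.formAt p).compContinuousLinearMap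
    ((mfderiv ((𝓡 m).prod (𝓡 k)) (𝓡 m) proj p : E m × E k →L[ℝ] E m).comp
      ((vd ((𝓡 m).prod (𝓡 k)) (chartInv m P q) univ (c (s (F z)))).comp
        (fderivWithin ℝ (fun w => c (s (F w))) S z)))) hinv).symm

theorem AdForm.continuousOn_pull (hP : IsPrincipalBundle m k G proj) (B : AdForm m k G proj r)
    (hs : IsHorizontalSection A proj univ s) {F : W → M} {S : Set W}
    (hF : ContMDiffOn 𝓘(ℝ, W) (𝓡 m) ∞ F S) (hS : UniqueDiffOn ℝ S) :
    ContinuousOn (B.pull s F S) S := by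
  intro z hz
  set q := s (F z) with hq
  set c := extChartAt ((𝓡 m).prod (𝓡 k)) q with hc
  have hsF : ContMDiffOn 𝓘(ℝ, W) ((𝓡 m).prod (𝓡 k)) ∞ (fun w => s (F w)) S := fun w hw =>
    (hs.smooth _ (mem_univ _)).comp_contMDiffWithinAt w (hF w hw)
  have hcF : ContDiffWithinAt ℝ ∞ (fun w => c (s (F w))) S z :=
    contMDiffWithinAt_iff_contDiffWithinAt.1
      ((contMDiffAt_extChartAt' (mem_chart_source _ q)).comp_contMDiffWithinAt z (hsF z hz))
  have h1 : ContinuousWithinAt (fderivWithin ℝ (fun w => c (s (F w))) S) S z :=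
    (hcF.fderivWithin_right (m := 0) hS (by norm_cast) hz).continuousWithinAt
  have h2 : ContinuousWithinAt (fun w => B.chartForm q (c (s (F w)))) S z :=
    ContinuousAt.comp_continuousWithinAt (f := fun w => c (s (F w))) (((B.contDiffOn_chartForm q).continuousOn).continuousAt
      ((isOpen_extChartAt_target q).mem_nhds (mem_extChartAt_target q))) hcF.continuousWithinAt
  have h3 : ContinuousWithinAt (fun w => (B.chartForm q (c (s (F w)))).compContinuousLinearMap
      (fderivWithin ℝ (fun w => c (s (F w))) S w)) S z :=
    ContinuousWithinAt.clm_apply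
      (ContinuousAlternatingMap.continuous_compContinuousLinearMapCLM.continuousAt.comp_continuousWithinAt
        h1) h2
  refine h3.congr_of_eventuallyEq_of_mem ?_ hz
  have h4 : ∀ᶠ w in 𝓝[S] z, s (F w) ∈ c.source :=
    (hsF z hz).continuousWithinAt.eventually (extChartAt_source_mem_nhds q)
  filter_upwards [h4, self_mem_nhdsWithin] with w hw hwS
  exact B.pull_eq_chartForm hP hs (hF w hwS) (hS w hwS) hw

end Pull

open MeasureTheory

/-! ### Basic facts on the cubes -/

section Cubes

variable {n : ℕ}

theorem two_pi_pos : (0 : ℝ) < 2 * Real.pi := by positivity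

theorem uniqueDiffOn_cube (n : ℕ) : UniqueDiffOn ℝ (cube n) := by
  rw [cube, ← pi_univ_Icc]
  exact UniqueDiffOn.univ_pi fun i => uniqueDiffOn_Icc two_pi_pos

theorem uniqueDiffOn_cubeTime (n : ℕ) : UniqueDiffOn ℝ (cubeTime n) :=
  (uniqueDiffOn_cube n).prod (uniqueDiffOn_Icc two_pi_pos)

theorem isCompact_cube (n : ℕ) : IsCompact (cube n) := isCompact_Icc

theorem isCompact_cubeTime (n : ℕ) : IsCompact (cubeTime n) := (isCompact_cube n).prod isCompact_Icc

theorem measurableSet_cubeTime (n : ℕ) : MeasurableSet (cubeTime n) :=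
  (isCompact_cubeTime n).measurableSet

theorem mk_mem_cubeTime {σ : Fin n → ℝ} {τ : ℝ} (hσ : σ ∈ cube n) (hτ : τ ∈ Icc 0 (2 * Real.pi)) :
    (σ, τ) ∈ cubeTime n := ⟨hσ, hτ⟩

/-- The standard frame of `ℝⁿ × ℝ`, with the last coordinate first. -/
def frameVec (n : ℕ) : Fin (n + 1) → (Fin n → ℝ) × ℝ :=
  Matrix.vecCons (0, 1) fun i => (Pi.single i 1, 0)

theorem hasFDerivAt_slice (σ : Fin n → ℝ) (τ : ℝ) :
    HasFDerivAt (fun σ : Fin n → ℝ => (σ, τ)) (ContinuousLinearMap.inl ℝ (Fin n → ℝ) ℝ) σ :=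
  hasFDerivAt_prodMk_left (𝕜 := ℝ) σ τ

end Cubes

/-! ### Alternating maps of top degree -/

section Top

variable {W F : Type*} [AddCommGroup W] [Module ℝ W] [AddCommGroup F] [Module ℝ F] {r : ℕ}

/-- In top degree every alternating map is a constant multiple of the determinant in a basis, and
determinants are multiplicative. -/
theorem alternatingMap_apply_comp_linearMap (f : W [⋀^Fin r]→ₗ[ℝ] F)
    (b : Module.Basis (Fin r) ℝ W) (L : W →ₗ[ℝ] W) (v : Fin r → W) :
    f (fun i => L (v i)) = LinearMap.det L • f v := by
  have key : f = (LinearMap.toSpanSingleton ℝ F (f b)).compAlternatingMap b.det := by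
    refine Module.Basis.ext_alternating b fun i h => ?_
    let σ : Equiv.Perm (Fin r) := Equiv.ofBijective i (Finite.injective_iff_bijective.1 h)
    change f (b ∘ σ) = b.det (b ∘ σ) • f b
    rw [AlternatingMap.map_perm, AlternatingMap.map_perm, Module.Basis.det_self, smul_assoc, one_smul]
  have h1 : ∀ w : Fin r → W, f w = b.det w • f b := fun w => by
    conv_lhs => rw [key]
    rfl
  rw [h1, h1 v, show (fun i => L (v i)) = L ∘ v from rfl, Module.Basis.det_comp, mul_smul]

end Top

/-! ### Reparametrizations preserve orientation and integrals -/

section Reparametrizations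

variable {n : ℕ} {h : (Fin n → ℝ) × ℝ → (Fin n → ℝ) × ℝ}

theorem IsCubeDiffeo.bijOn (hh : IsCubeDiffeo n h) : BijOn h (cubeTime n) (cubeTime n) := by
  obtain ⟨-, h1, ⟨j, -, h2, h3⟩, -⟩ := hh
  exact h3.bijOn h1 h2

theorem IsCubeDiffeo.det_ne_zero (hh : IsCubeDiffeo n h) {z : (Fin n → ℝ) × ℝ}
    (hz : z ∈ cubeTime n) : (fderivWithin ℝ h (cubeTime n) z).det ≠ 0 := by
  obtain ⟨h1, h2, ⟨j, hj, hj2, hinv⟩, -⟩ := hh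
  have hu := uniqueDiffOn_cubeTime n z hz
  have hd := (h1 z hz).differentiableWithinAt (by simp)
  have hdj := (hj _ (h2 hz)).differentiableWithinAt (by simp)
  have hc := hdj.hasFDerivWithinAt.comp z hd.hasFDerivWithinAt h2
  have hid : HasFDerivWithinAt (j ∘ h) (ContinuousLinearMap.id ℝ _) (cubeTime n) z :=
    (hasFDerivWithinAt_id z _).congr (fun w hw => hinv.1 hw) (hinv.1 hz)
  have heq := hu.eq hc hid
  intro h0
  have h3 : LinearMap.det ((fderivWithin ℝ j (cubeTime n) (h z) :
      (Fin n → ℝ) × ℝ →ₗ[ℝ] (Fin n → ℝ) × ℝ) ∘ₗ (fderivWithin ℝ h (cubeTime n) z :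
      (Fin n → ℝ) × ℝ →ₗ[ℝ] (Fin n → ℝ) × ℝ)) = 1 :=
    (congrArg (fun T : (Fin n → ℝ) × ℝ →L[ℝ] (Fin n → ℝ) × ℝ =>
      LinearMap.det (T : (Fin n → ℝ) × ℝ →ₗ[ℝ] (Fin n → ℝ) × ℝ)) heq).trans LinearMap.det_id
  rw [ContinuousLinearMap.det] at h0
  rw [LinearMap.det_comp, h0, mul_zero] at h3
  exact zero_ne_one h3

theorem IsReparametrization.isCubeDiffeo (hh : IsReparametrization n h) : IsCubeDiffeo n h := by
  obtain ⟨H, -, h2, -, h4⟩ := hh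
  obtain ⟨g1, g2, ⟨j, g3, g4, g5⟩, g6⟩ := h2 1 (by simp)
  refine ⟨g1.congr fun z hz => (h4 hz).symm, fun z hz => by rw [← h4 hz]; exact g2 hz,
    ⟨j, g3, g4, fun z hz => by rw [← h4 hz]; exact g5.1 hz,
      fun z hz => by rw [← h4 (g4 hz)]; exact g5.2 hz⟩, fun z hz => ?_⟩
  exact (h4 ((isCompact_cubeTime n).isClosed.frontier_subset hz)).symm.trans (g6 z hz)

/-- Along the isotopy the Jacobian determinant at `z` is continuous, never zero, and equal to `1` at
the start, so it remains positive. -/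
theorem IsReparametrization.det_pos (hh : IsReparametrization n h) {z : (Fin n → ℝ) × ℝ}
    (hz : z ∈ cubeTime n) : 0 < (fderivWithin ℝ h (cubeTime n) z).det := by
  obtain ⟨H, h1, h2, h3, h4⟩ := hh
  have hu := uniqueDiffOn_cubeTime n
  have hU : UniqueDiffOn ℝ (Icc (0 : ℝ) 1 ×ˢ cubeTime n) := (uniqueDiffOn_Icc zero_lt_one).prod hu
  set T := fun s : ℝ => fderivWithin ℝ (H s) (cubeTime n) z with hT
  have hTeq : ∀ s ∈ Icc (0 : ℝ) 1, T s =
      (fderivWithin ℝ (fun w : ℝ × ((Fin n → ℝ) × ℝ) => H w.1 w.2) (Icc 0 1 ×ˢ cubeTime n)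
        (s, z)).comp (ContinuousLinearMap.inr ℝ ℝ ((Fin n → ℝ) × ℝ)) := by
    intro s hs
    have hd := ((h1 (s, z) ⟨hs, hz⟩).differentiableWithinAt (by simp)).hasFDerivWithinAt
    exact (hd.comp z (hasFDerivAt_prodMk_right (𝕜 := ℝ) s z).hasFDerivWithinAt
      (fun w hw => ⟨hs, hw⟩)).fderivWithin (hu z hz)
  have hcont : ContinuousOn (fun s => (T s).det) (Icc 0 1) := by
    refine ContinuousLinearMap.continuous_det.comp_continuousOn ?_
    refine ContinuousOn.congr ?_ hTeq
    refine ContinuousOn.clm_comp ?_ continuousOn_const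
    exact (h1.continuousOn_fderivWithin hU (by simp)).comp (by fun_prop) fun s hs => ⟨hs, hz⟩
  have h0 : (T 0).det = 1 := by
    have : T 0 = ContinuousLinearMap.id ℝ _ := by
      simp only [hT]
      rw [fderivWithin_congr h3 (h3 hz), fderivWithin_id (hu z hz)]
    rw [this, ContinuousLinearMap.det, ContinuousLinearMap.coe_id, LinearMap.det_id]
  have hone : T 1 = fderivWithin ℝ h (cubeTime n) z := fderivWithin_congr h4 (h4 hz)
  rw [← hone]
  by_contra hneg
  obtain ⟨s, hs, hs0⟩ := (isPreconnected_Icc (a := (0 : ℝ)) (b := 1)).intermediate_value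
    (right_mem_Icc.2 zero_le_one) (left_mem_Icc.2 zero_le_one) hcont
    (⟨not_lt.1 hneg, by rw [h0]; exact zero_le_one⟩ : (0 : ℝ) ∈ Icc _ _)
  exact (h2 s hs).det_ne_zero hz hs0

theorem IsReparametrization.setIntegral_det_smul (hh : IsReparametrization n h) {F : Type*}
    [NormedAddCommGroup F] [NormedSpace ℝ F] (g : (Fin n → ℝ) × ℝ → F) :
    ∫ z in cubeTime n, (fderivWithin ℝ h (cubeTime n) z).det • g (h z) =
      ∫ z in cubeTime n, g z := by
  have hd := hh.isCubeDiffeo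
  have : (volume : Measure ((Fin n → ℝ) × ℝ)).IsAddHaarMeasure := by
    rw [Measure.volume_eq_prod]; infer_instance
  have h1 := integral_image_eq_integral_abs_det_fderiv_smul (volume : Measure ((Fin n → ℝ) × ℝ))
    (measurableSet_cubeTime n)
    (fun z hz => ((hd.1 z hz).differentiableWithinAt (by simp)).hasFDerivWithinAt)
    hd.bijOn.injOn g
  rw [hd.bijOn.image_eq] at h1
  rw [h1]
  refine setIntegral_congr_fun (measurableSet_cubeTime n) fun z hz => ?_
  simp only [abs_of_pos (hh.det_pos hz)]

end Reparametrizations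

/-! ### The loop space connection as an integral of a density -/

section LoopIntegrals

variable {m k n r : ℕ}
  {M : Type*} [TopologicalSpace M] [ChartedSpace (E m) M] [IsManifold (𝓡 m) ∞ M]
  {G : Type*} [TopologicalSpace G] [ChartedSpace (E k) G] [Group G] [LieGroup (𝓡 k) ∞ G]
  {P : Type*} [TopologicalSpace P] [ChartedSpace (ModelProd (E m) (E k)) P]
  [IsManifold ((𝓡 m).prod (𝓡 k)) ∞ P] [MulAction Gᵐᵒᵖ P]
  {proj : P → M} {A : Connection m k G P} {s : M → P} {B : AdForm m k G proj (n + 1)} {p₀ : P}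

theorem contraction_eq [PreconnectedSpace M] (hP : IsPrincipalBundle m k G proj)
    (hs : IsHorizontalSection A proj univ s) (h0 : s (proj p₀) = p₀)
    (N : (Fin n → ℝ) → M) (σ : Fin n → ℝ) (X : E m) :
    contraction A B p₀ N σ X = B.formAt (s (N σ))
      (Matrix.vecCons X fun i => vd (𝓡 m) N (cube n) σ (Pi.single i 1)) :=
  transported_eq hP hs h0 B (N σ) _

/-- The coefficient of the volume form in the pullback of the transported form by a loop of
loops. -/
def density (B : AdForm m k G proj (n + 1)) (s : M → P) (Γ : (Fin n → ℝ) × ℝ → M)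
    (z : (Fin n → ℝ) × ℝ) : E k :=
  B.pull s Γ (cubeTime n) z (frameVec n)

/-- The velocity is the first argument in the contraction, which is why `frameVec` lists the time
direction first: no sign appears. -/
theorem contraction_velocity_eq [PreconnectedSpace M] (hP : IsPrincipalBundle m k G proj)
    (hs : IsHorizontalSection A proj univ s) (h0 : s (proj p₀) = p₀)
    {Γ : (Fin n → ℝ) × ℝ → M} (hΓ : ContMDiffOn 𝓘(ℝ, (Fin n → ℝ) × ℝ) (𝓡 m) ∞ Γ (cubeTime n))
    {σ : Fin n → ℝ} {τ : ℝ} (hσ : σ ∈ cube n) (hτ : τ ∈ Icc 0 (2 * Real.pi)) :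
    (contraction A B p₀ (fun σ => Γ (σ, τ)) σ (velocity (m := m) Γ σ τ) : E k) =
      density B s Γ (σ, τ) := by
  have hvd : ∀ v, vd (𝓡 m) (fun σ => Γ (σ, τ)) (cube n) σ v =
      vd (𝓡 m) Γ (cubeTime n) (σ, τ) (v, 0) := by
    intro v
    have hu := uniqueDiffOn_cube n σ hσ
    have h1 := vd_comp (I₂ := 𝓡 m) (F := Γ) (f := fun σ => (σ, τ)) (s := cube n)
      (t := cubeTime n) (z := σ)
      ((hΓ _ (mk_mem_cubeTime hσ hτ)).mdifferentiableWithinAt (by simp))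
      (hasFDerivAt_slice σ τ).differentiableAt.differentiableWithinAt
      (fun w hw => mk_mem_cubeTime hw hτ) hu
    rw [(hasFDerivAt_slice σ τ).hasFDerivWithinAt.fderivWithin hu] at h1
    exact congrArg (fun T : (Fin n → ℝ) →L[ℝ] E m => T v) h1
  refine (contraction_eq hP hs h0 _ σ _).trans ?_
  rw [density, AdForm.pull_apply]
  congr 1
  funext i
  refine Fin.cases ?_ (fun j => ?_) i
  · rfl
  · simp only [frameVec, Matrix.cons_val_succ]
    exact hvd _

theorem loopConnection_velocity_eq [PreconnectedSpace M] (hP : IsPrincipalBundle m k G proj)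
    (hs : IsHorizontalSection A proj univ s) (h0 : s (proj p₀) = p₀)
    {Γ : (Fin n → ℝ) × ℝ → M} (hΓ : ContMDiffOn 𝓘(ℝ, (Fin n → ℝ) × ℝ) (𝓡 m) ∞ Γ (cubeTime n))
    {τ : ℝ} (hτ : τ ∈ Icc 0 (2 * Real.pi)) :
    (loopConnection A B p₀ (fun σ => Γ (σ, τ)) (fun σ => velocity (m := m) Γ σ τ) : E k) =
      ∫ σ in cube n, density B s Γ (σ, τ) :=
  setIntegral_congr_fun (isCompact_cube n).measurableSet fun _ hσ =>
    contraction_velocity_eq hP hs h0 hΓ hσ hτ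

theorem continuousOn_density (hP : IsPrincipalBundle m k G proj)
    (hs : IsHorizontalSection A proj univ s) {Γ : (Fin n → ℝ) × ℝ → M}
    (hΓ : ContMDiffOn 𝓘(ℝ, (Fin n → ℝ) × ℝ) (𝓡 m) ∞ Γ (cubeTime n)) :
    ContinuousOn (density B s Γ) (cubeTime n) := fun z hz =>
  (B.continuousOn_pull hP hs hΓ (uniqueDiffOn_cubeTime n) z hz).eval continuousWithinAt_const

theorem continuousOn_integral_slice {F : Type*} [NormedAddCommGroup F] [NormedSpace ℝ F]
    {w : (Fin n → ℝ) × ℝ → F} (hw : ContinuousOn w (cubeTime n)) :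
    ContinuousOn (fun τ => ∫ σ in cube n, w (σ, τ)) (Icc 0 (2 * Real.pi)) := by
  obtain ⟨K, hK⟩ := (isCompact_cubeTime n).exists_bound_of_continuousOn hw
  have hslice : ∀ τ ∈ Icc 0 (2 * Real.pi), ContinuousOn (fun σ => w (σ, τ)) (cube n) :=
    fun τ hτ => hw.comp (by fun_prop) fun σ hσ => mk_mem_cubeTime hσ hτ
  refine continuousOn_of_dominated (bound := fun _ => K)
    (fun τ hτ => (hslice τ hτ).aestronglyMeasurable (isCompact_cube n).measurableSet)
    (fun τ hτ => ?_) ?_ ?_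
  · exact (ae_restrict_iff' (isCompact_cube n).measurableSet).2
      (Eventually.of_forall fun σ hσ => hK _ (mk_mem_cubeTime hσ hτ))
  · exact integrableOn_const (isCompact_cube n).measure_lt_top.ne
  · exact (ae_restrict_iff' (isCompact_cube n).measurableSet).2
      (Eventually.of_forall fun σ hσ => hw.comp (by fun_prop) fun τ hτ => mk_mem_cubeTime hσ hτ)

theorem integral_integral_slice {F : Type*} [NormedAddCommGroup F] [NormedSpace ℝ F]
    {w : (Fin n → ℝ) × ℝ → F} (hw : ContinuousOn w (cubeTime n)) :
    ∫ τ in (0 : ℝ)..(2 * Real.pi), ∫ σ in cube n, w (σ, τ) = ∫ z in cubeTime n, w z := by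
  have hi : IntegrableOn w (cubeTime n) := hw.integrableOn_compact (isCompact_cubeTime n)
  rw [intervalIntegral.integral_of_le two_pi_pos.le, ← integral_Icc_eq_integral_Ioc]
  rw [cubeTime, Measure.volume_eq_prod, IntegrableOn, ← Measure.prod_restrict] at hi
  rw [cubeTime, Measure.volume_eq_prod, ← Measure.prod_restrict]
  exact (integral_prod_symm w hi).symm

theorem finBasis_cubeTime (n : ℕ) :
    Nonempty (Module.Basis (Fin (n + 1)) ℝ ((Fin n → ℝ) × ℝ)) :=
  ⟨Module.finBasisOfFinrankEq ℝ _ (by simp)⟩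

/-- The form has degree `n + 1`, the dimension of the cube of `(σ, τ)`, so pulling it back by `h`
multiplies it by the Jacobian determinant. -/
theorem density_comp {Γ : (Fin n → ℝ) × ℝ → M}
    (hΓ : ContMDiffOn 𝓘(ℝ, (Fin n → ℝ) × ℝ) (𝓡 m) ∞ Γ (cubeTime n))
    {h : (Fin n → ℝ) × ℝ → (Fin n → ℝ) × ℝ} (hh : IsCubeDiffeo n h) {z : (Fin n → ℝ) × ℝ}
    (hz : z ∈ cubeTime n) :
    density B s (Γ ∘ h) z =
      (fderivWithin ℝ h (cubeTime n) z).det • density B s Γ (h z) := by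
  obtain ⟨b⟩ := finBasis_cubeTime n
  rw [density, B.pull_comp s ((hΓ _ (hh.2.1 hz)).mdifferentiableWithinAt (by simp))
    ((hh.1 z hz).differentiableWithinAt (by simp)) hh.2.1 (uniqueDiffOn_cubeTime n z hz)]
  exact alternatingMap_apply_comp_linearMap (B.pull s Γ (cubeTime n) (h z)).toAlternatingMap b
    (fderivWithin ℝ h (cubeTime n) z : (Fin n → ℝ) × ℝ →ₗ[ℝ] (Fin n → ℝ) × ℝ) (frameVec n)

theorem IsReparametrization.contMDiffOn_comp {Γ : (Fin n → ℝ) × ℝ → M}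
    (hΓ : ContMDiffOn 𝓘(ℝ, (Fin n → ℝ) × ℝ) (𝓡 m) ∞ Γ (cubeTime n))
    {h : (Fin n → ℝ) × ℝ → (Fin n → ℝ) × ℝ} (hh : IsReparametrization n h) :
    ContMDiffOn 𝓘(ℝ, (Fin n → ℝ) × ℝ) (𝓡 m) ∞ (Γ ∘ h) (cubeTime n) :=
  hΓ.comp hh.isCubeDiffeo.1.contMDiffOn hh.isCubeDiffeo.2.1

end LoopIntegrals

/-! ### Commuting components imply the other conditions -/

section Commuting

variable {m k n : ℕ}
  {M : Type*} [TopologicalSpace M] [ChartedSpace (E m) M] [IsManifold (𝓡 m) ∞ M]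
  {G : Type*} [TopologicalSpace G] [ChartedSpace (E k) G] [Group G] [LieGroup (𝓡 k) ∞ G]
  {P : Type*} [TopologicalSpace P] [ChartedSpace (ModelProd (E m) (E k)) P]
  [IsManifold ((𝓡 m).prod (𝓡 k)) ∞ P] [MulAction Gᵐᵒᵖ P]
  {proj : P → M} {A : Connection m k G P} {s : M → P} {B : AdForm m k G proj (n + 1)} {p₀ : P}

/-- The centre of the centralizer of a set of Lie algebra elements. -/
def bicommutant (G : Type*) [TopologicalSpace G] [ChartedSpace (E k) G] [Group G]
    [LieGroup (𝓡 k) ∞ G] (S : Set (E k)) : Set (E k) :=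
  {ξ | (∀ η ∈ S, bracketL G ξ η = 0) ∧
    ∀ η, (∀ ζ ∈ S, bracketL G η ζ = 0) → bracketL G ξ η = 0}

theorem bracketL_eq_zero_of_mem_bicommutant {S : Set (E k)} {ξ η : E k}
    (hξ : ξ ∈ bicommutant G S) (hη : η ∈ bicommutant G S) : bracketL G ξ η = 0 :=
  hξ.2 η hη.1

/-- A bracket with a fixed element passes under the integral sign, so the integral commutes with
everything that commutes with `S`. The bicommutant is a convenient commuting set because it contains
all such integrals. -/
theorem integral_mem_bicommutant {S : Set (E k)} (hS : ∀ ξ ∈ S, ∀ η ∈ S, bracketL G ξ η = 0)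
    {X : Type*} [MeasurableSpace X] {μ : Measure X} {f : X → E k} {D : Set X}
    (hf : ∀ x ∈ D, f x ∈ S) :
    ∫ x in D, f x ∂μ ∈ bicommutant G S := by
  have key : ∀ η, (∀ ζ ∈ S, bracketL G η ζ = 0) → bracketL G (∫ x in D, f x ∂μ) η = 0 := by
    intro η hη
    rw [bracketL_antisymm, neg_eq_zero]
    -- No regularity of `f` is assumed; a non-integrable function has integral `0`, which commutes
    -- with everything.
    by_cases hi : IntegrableOn f D μ
    · rw [← ContinuousLinearMap.integral_comp_comm _ hi]
      exact setIntegral_eq_zero_of_forall_eq_zero fun x hx => hη _ (hf x hx)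
    · rw [integral_undef hi, map_zero]
  exact ⟨fun η hη => key η (hS η hη), key⟩

/-- The set of all components of an adjoint form in the frame given by a section. -/
def components (B : AdForm m k G proj (n + 1)) (s : M → P) : Set (E k) :=
  {ξ | ∃ x v, ξ = B.formAt (s x) v}

theorem componentsCommute_iff [PreconnectedSpace M] (hP : IsPrincipalBundle m k G proj)
    (hs : IsHorizontalSection A proj univ s) (h0 : s (proj p₀) = p₀) :
    ComponentsCommute A B p₀ ↔
      ∀ ξ ∈ components B s, ∀ η ∈ components B s, bracketL G ξ η = 0 := by
  have key : ∀ x (v : Fin (n + 1) → E m), (transported A B p₀ x v : E k) = B.formAt (s x) v :=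
    transported_eq hP hs h0 B
  constructor
  · rintro h _ ⟨x, v, rfl⟩ _ ⟨x', v', rfl⟩
    rw [← key, ← key, ← bracket_eq_bracketL]
    exact h x x' v v'
  · intro h x x' v v'
    refine (bracket_eq_bracketL (G := G) _ _).trans ?_
    exact h _ ⟨x, v, key x v⟩ _ ⟨x', v', key x' v'⟩

theorem ComponentsCommute.isCurvatureLocal [PreconnectedSpace M]
    (hP : IsPrincipalBundle m k G proj) (hs : IsHorizontalSection A proj univ s)
    (h0 : s (proj p₀) = p₀) (h : ComponentsCommute A B p₀) : IsCurvatureLocal A B p₀ := by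
  rw [componentsCommute_iff hP hs h0] at h
  intro N _ X Y _ _
  have hmem : ∀ X : ∀ σ, TangentSpace (𝓡 m) (N σ),
      loopConnection A B p₀ N X ∈ bicommutant G (components B s) := fun X =>
    integral_mem_bicommutant h fun σ _ =>
      ⟨N σ, _, contraction_eq hP hs h0 N σ (X σ)⟩
  rw [bracket_eq_bracketL]
  exact bracketL_eq_zero_of_mem_bicommutant (hmem X) (hmem Y)

theorem ComponentsCommute.commutesAlongLoops (h : ComponentsCommute A B p₀) :
    CommutesAlongLoops A B p₀ :=
  fun _ _ _ _ _ _ _ _ => h _ _ _ _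

/-- Both holonomies are the same function of the time integral of the connection. By Fubini that
integral is the integral of the density over the whole cube, which a change of variables with
positive determinant preserves. -/
theorem ComponentsCommute.isRFlat [PreconnectedSpace M]
    (hP : IsPrincipalBundle m k G proj) (hs : IsHorizontalSection A proj univ s)
    (h0 : s (proj p₀) = p₀) (h : ComponentsCommute A B p₀) : IsRFlat A B p₀ := by
  rw [componentsCommute_iff hP hs h0] at h
  intro Γ hΓ j hj
  have hΓs := hΓ.1
  have hΓj := hj.contMDiffOn_comp hΓs
  set a := fun Γ' : (Fin n → ℝ) × ℝ → M => fun τ =>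
    (loopConnection A B p₀ (fun σ => Γ' (σ, τ)) (fun σ => velocity (m := m) Γ' σ τ) : E k) with ha
  have hcont : ∀ Γ' : (Fin n → ℝ) × ℝ → M,
      ContMDiffOn 𝓘(ℝ, (Fin n → ℝ) × ℝ) (𝓡 m) ∞ Γ' (cubeTime n) →
      ContinuousOn (a Γ') (Icc 0 (2 * Real.pi)) := fun Γ' hΓ' =>
    (continuousOn_integral_slice (continuousOn_density hP hs hΓ')).congr fun τ hτ =>
      loopConnection_velocity_eq hP hs h0 hΓ' hτ
  have hint : ∀ Γ' : (Fin n → ℝ) × ℝ → M,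
      ContMDiffOn 𝓘(ℝ, (Fin n → ℝ) × ℝ) (𝓡 m) ∞ Γ' (cubeTime n) →
      ∫ τ in (0 : ℝ)..(2 * Real.pi), a Γ' τ = ∫ z in cubeTime n, density B s Γ' z := by
    intro Γ' hΓ'
    rw [← integral_integral_slice (continuousOn_density hP hs hΓ')]
    refine intervalIntegral.integral_congr fun τ hτ => ?_
    rw [uIcc_of_le two_pi_pos.le] at hτ
    exact loopConnection_velocity_eq hP hs h0 hΓ' hτ
  have hmem : ∀ Γ' : (Fin n → ℝ) × ℝ → M, ∀ τ, a Γ' τ ∈ bicommutant G (components B s) :=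
    fun Γ' τ => integral_mem_bicommutant h fun σ _ =>
      ⟨Γ' (σ, τ), _, contraction_eq hP hs h0 _ σ _⟩
  obtain ⟨K₁, hK₁⟩ := isCompact_Icc.exists_bound_of_continuousOn (hcont Γ hΓs)
  obtain ⟨K₂, hK₂⟩ := isCompact_Icc.exists_bound_of_continuousOn (hcont _ hΓj)
  -- A bound common to both loops is needed, so that one function `H` serves for the two.
  obtain ⟨H, hH⟩ := exists_holonomy_eq_of_commuting (G := G)
    (S := bicommutant G (components B s))
    (fun ξ hξ η hη => bracketL_eq_zero_of_mem_bicommutant hξ hη) (max K₁ K₂)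
  have e1 := hH (a Γ) (hcont Γ hΓs) (fun τ _ => hmem Γ τ) fun τ hτ =>
    (hK₁ τ hτ).trans (le_max_left _ _)
  have e2 := hH (a (Γ ∘ j)) (hcont _ hΓj) (fun τ _ => hmem _ τ) fun τ hτ =>
    (hK₂ τ hτ).trans (le_max_right _ _)
  have e3 : ∫ z in cubeTime n, density B s (Γ ∘ j) z = ∫ z in cubeTime n, density B s Γ z := by
    rw [← hj.setIntegral_det_smul (density B s Γ)]
    exact setIntegral_congr_fun (measurableSet_cubeTime n) fun z hz =>
      density_comp hΓs hj.isCubeDiffeo hz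
  refine e2.trans (Eq.trans ?_ e1.symm)
  rw [hint _ hΓj, hint Γ hΓs, e3]

end Commuting

/-! ### Families of maps with a prescribed 1-jet at one point -/

section Blobs

variable {m n : ℕ} {M : Type*} [TopologicalSpace M] [ChartedSpace (E m) M] [IsManifold (𝓡 m) ∞ M]

/-- The inverse of a chart extends, from a neighbourhood of the base point, to a smooth map defined
on the whole model space. -/
theorem exists_global_chart_inverse (x : M) :
    ∃ ι : E m → M, ContMDiff 𝓘(ℝ, E m) (𝓡 m) ∞ ι ∧ ι 0 = x ∧
      ∀ᶠ y in 𝓝 0, extChartAt (𝓡 m) x (ι y) = extChartAt (𝓡 m) x x + y := by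
  set φ := extChartAt (𝓡 m) x with hφ
  obtain ⟨r, hr, hball⟩ := Metric.isOpen_iff.1 (isOpen_extChartAt_target (I := 𝓡 m) x) (φ x)
    (mem_extChartAt_target x)
  -- The vector `f y • y` has norm less than `r` for every `y`, so the point never leaves the chart,
  -- while it equals `y` near `0`. A blob needs such a global map because its parameter `u` is not
  -- cut off.
  let f : ContDiffBump (0 : E m) := ⟨r / 4, r / 2, by linarith, by linarith⟩
  have hmem : ∀ y, φ x + f y • y ∈ φ.target := by
    intro y
    apply hball
    rw [Metric.mem_ball, dist_self_add_left, norm_smul, Real.norm_eq_abs, abs_of_nonneg f.nonneg]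
    by_cases hy : ‖y‖ < r / 2
    · exact (mul_le_of_le_one_left (norm_nonneg y) f.le_one).trans_lt (by linarith)
    · have h0 : f y = 0 := f.zero_of_le_dist (by rw [dist_zero_right]; exact not_lt.1 hy)
      rw [h0, zero_mul]; exact hr
  refine ⟨fun y => φ.symm (φ x + f y • y), fun y => ?_, ?_, ?_⟩
  · have hs : ContDiff ℝ ∞ fun y : E m => φ x + f y • y :=
      contDiff_const.add (f.contDiff.smul contDiff_id)
    exact (contMDiffAt_extChartAt_symm (hmem y)).comp y hs.contDiffAt.contMDiffAt
  · simp only [smul_zero, add_zero]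
    exact extChartAt_to_inv x
  · have h1 : ∀ᶠ y in 𝓝 (0 : E m), f y = 1 := f.eventuallyEq_one
    filter_upwards [h1] with y hy
    have h2 := hmem y
    rw [hy, one_smul] at h2
    rw [hy, one_smul]
    exact φ.right_inv h2

/-- The linear map taking the standard frame to the given vectors. -/
def frameMap (v : Fin (n + 1) → E m) : (Fin n → ℝ) × ℝ →L[ℝ] E m :=
  (∑ i : Fin n, (ContinuousLinearMap.proj (R := ℝ) (φ := fun _ : Fin n => ℝ) i).smulRight
    (v i.succ)).comp (ContinuousLinearMap.fst ℝ (Fin n → ℝ) ℝ) +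
  (ContinuousLinearMap.snd ℝ (Fin n → ℝ) ℝ).smulRight (v 0)

theorem frameMap_frameVec (v : Fin (n + 1) → E m) (i : Fin (n + 1)) :
    frameMap v (frameVec n i) = v i := by
  refine Fin.cases ?_ (fun j => ?_) i
  · simp [frameMap, frameVec]
  · simp [frameMap, frameVec, Pi.single_apply, ite_smul]

/-- A family of maps, equal to `x₀` away from `c`, with prescribed first derivatives at `c`. -/
theorem exists_blob [PreconnectedSpace M] (x₀ x : M) (c : Fin n → ℝ) (v : Fin (n + 1) → E m) :
    ∃ β : (Fin n → ℝ) × ℝ → M, ContMDiff 𝓘(ℝ, (Fin n → ℝ) × ℝ) (𝓡 m) ∞ β ∧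
      (∀ σ, 7 / 8 ≤ dist σ c → ∀ u, β (σ, u) = x₀) ∧ β (c, 0) = x ∧
      ∀ i, vd (𝓡 m) β univ (c, 0) (frameVec n i) = v i := by
  obtain ⟨ι, hι, hι0, hιx⟩ := exists_global_chart_inverse (m := m) x
  obtain ⟨γ, hγ, hγ0, hγ1⟩ := smoothlyJoined (m := m) x₀ x
  -- The inner part carries the derivatives and is constantly `x` beyond distance `1/2`. The outer
  -- part runs along a path: it is constantly `x` up to distance `3/4` and `x₀` from `7/8` on. They
  -- are joined at distance `2/3`, where both are `x`.
  let κ : ContDiffBump c := ⟨1 / 4, 1 / 2, by norm_num, by norm_num⟩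
  let ρ : ContDiffBump c := ⟨3 / 4, 7 / 8, by norm_num, by norm_num⟩
  set inner := fun z : (Fin n → ℝ) × ℝ => ι (κ z.1 • frameMap v (z - (c, 0))) with hin
  set outer := fun z : (Fin n → ℝ) × ℝ => γ (ρ z.1) with hout
  have hins : ContMDiff 𝓘(ℝ, (Fin n → ℝ) × ℝ) (𝓡 m) ∞ inner :=
    hι.comp (((κ.contDiff (n := ⊤)).comp contDiff_fst).smul
      ((frameMap v).contDiff.comp (contDiff_id.sub contDiff_const))).contMDiff
  have houts : ContMDiff 𝓘(ℝ, (Fin n → ℝ) × ℝ) (𝓡 m) ∞ outer :=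
    hγ.comp ((ρ.contDiff (n := ⊤)).comp contDiff_fst).contMDiff
  set β := fun z : (Fin n → ℝ) × ℝ => if dist z.1 c < 2 / 3 then inner z else outer z with hβ
  have hdist : Continuous fun z : (Fin n → ℝ) × ℝ => dist z.1 c := by fun_prop
  have hnear : ∀ z : (Fin n → ℝ) × ℝ, dist z.1 c < 2 / 3 → β =ᶠ[𝓝 z] inner := fun z hz => by
    filter_upwards [hdist.continuousAt.eventually (Iio_mem_nhds hz)] with w hw
    exact if_pos hw
  have hc0 : β (c, 0) = x := by
    simp only [hβ, hin]
    rw [if_pos (by rw [dist_self]; norm_num), sub_self, map_zero, smul_zero, hι0]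
  refine ⟨β, fun z => ?_, fun σ hσ u => ?_, hc0, fun i => ?_⟩
  · rcases lt_or_ge (dist z.1 c) (2 / 3) with hz | hz
    · exact (hins z).congr_of_eventuallyEq (hnear z hz)
    · refine (houts z).congr_of_eventuallyEq ?_
      filter_upwards [hdist.continuousAt.eventually
        (Ioi_mem_nhds (show (1 / 2 : ℝ) < dist z.1 c by linarith))] with w hw
      have hw : 1 / 2 < dist w.1 c := hw
      simp only [hβ]
      split_ifs with h
      · have h1 : κ w.1 = 0 := κ.zero_of_le_dist hw.le
        have h2 : ρ w.1 = 1 := ρ.one_of_mem_closedBall (by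
          rw [Metric.mem_closedBall]; change dist w.1 c ≤ 3 / 4; linarith)
        simp only [hin, hout, h1, h2, zero_smul, hι0, hγ1 1 le_rfl]
      · rfl
  · have h1 : ρ σ = 0 := ρ.zero_of_le_dist hσ
    simp only [hβ, hout]
    rw [if_neg (by linarith), h1, hγ0 0 le_rfl]
  · have hd : MDifferentiableAt 𝓘(ℝ, (Fin n → ℝ) × ℝ) (𝓡 m) β (c, 0) :=
      ((hins (c, 0)).congr_of_eventuallyEq (hnear (c, 0) (by
        rw [dist_self]; norm_num))).mdifferentiableAt (by simp)
    rw [vd_eq_fderivWithin hd.mdifferentiableWithinAt uniqueDiffWithinAt_univ, fderivWithin_univ,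
      hc0]
    have hκ : ∀ᶠ z in 𝓝 ((c, 0) : (Fin n → ℝ) × ℝ), κ z.1 = 1 :=
      (continuous_fst.continuousAt (x := ((c, 0) : (Fin n → ℝ) × ℝ))).eventually
        (p := fun σ => κ σ = 1) κ.eventuallyEq_one
    have hlim : Tendsto (fun z : (Fin n → ℝ) × ℝ => frameMap v (z - (c, 0))) (𝓝 (c, 0)) (𝓝 0) := by
      have h1 : Continuous fun z : (Fin n → ℝ) × ℝ => frameMap v (z - (c, 0)) := by fun_prop
      simpa using h1.tendsto (c, 0)
    have heq : (fun z => extChartAt (𝓡 m) x (β z)) =ᶠ[𝓝 (c, 0)]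
        fun z => extChartAt (𝓡 m) x x + frameMap v (z - (c, 0)) := by
      filter_upwards [hκ, hlim.eventually hιx, hnear (c, 0) (by rw [dist_self]; norm_num)]
        with z h1 h2 h3
      rw [h3, hin]
      simp only [h1, one_smul]
      exact h2
    have hder : HasFDerivAt (fun z => extChartAt (𝓡 m) x x + frameMap v (z - (c, 0)))
        (frameMap v) (c, 0) := by
      simpa using ((frameMap v).hasFDerivAt.comp ((c, 0) : (Fin n → ℝ) × ℝ)
        ((hasFDerivAt_id _).sub_const (c, 0))).const_add (extChartAt (𝓡 m) x x)
    rw [heq.fderiv_eq, hder.fderiv, frameMap_frameVec]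

end Blobs

/-! ### The fundamental lemma of the calculus of variations -/

section Localize

/-- A continuous function whose integrals against all smooth functions are killed by a linear map
takes values in the kernel of that map. -/
theorem map_eq_zero_of_integral_smul {n k : ℕ} {f : (Fin n → ℝ) → E k} (hf : Continuous f)
    (T : E k →L[ℝ] E k)
    (hT : ∀ q : (Fin n → ℝ) → ℝ, ContDiff ℝ ∞ q → T (∫ σ in cube n, q σ • f σ) = 0)
    {c : Fin n → ℝ} (hc : c ∈ interior (cube n)) : T (f c) = 0 := by
  have hTf : Continuous fun σ => T (f σ) := T.continuous.comp hf
  have hae := isOpen_interior.ae_eq_zero_of_integral_contDiff_smul_eq_zero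
    (μ := (volume : Measure (Fin n → ℝ))) (f := fun σ => T (f σ)) (U := interior (cube n))
    (hTf.locallyIntegrable.locallyIntegrableOn _) (fun g hg _ hsupp => by
      rw [← setIntegral_eq_integral_of_forall_compl_eq_zero (s := cube n) (fun σ hσ => by
        rw [image_eq_zero_of_notMem_tsupport (fun h => hσ (interior_subset (hsupp h))), zero_smul])]
      have hi : IntegrableOn (fun σ => g σ • f σ) (cube n) :=
        (hg.continuous.smul hf).continuousOn.integrableOn_compact (isCompact_cube n)
      rw [← hT g hg, ← ContinuousLinearMap.integral_comp_comm T hi]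
      simp only [map_smul])
  have heq : (fun σ => T (f σ)) =ᵐ[volume.restrict (interior (cube n))] fun _ => 0 :=
    (ae_restrict_iff' isOpen_interior.measurableSet).2 hae
  exact Measure.eqOn_open_of_ae_eq heq isOpen_interior hTf.continuousOn continuousOn_const hc

end Localize

/-! ### Two separate balls in the cube -/

section Centers

variable {n : ℕ}

/-- The centre of the part of the cube where the coordinate `i₀` is less than `π`. -/
def lowCenter (i₀ : Fin n) : Fin n → ℝ := Function.update (fun _ => Real.pi) i₀ (Real.pi / 2)

/-- The centre of the part of the cube where the coordinate `i₀` is greater than `π`. -/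
def highCenter (i₀ : Fin n) : Fin n → ℝ :=
  Function.update (fun _ => Real.pi) i₀ (3 * Real.pi / 2)

/-- In the sup distance the centres are at least `π/2 > 3/2` away from the boundary. This leaves
room for blobs of radius `7/8` and for the reparametrization of radius `3/2`. -/
theorem mem_interior_cube_of_dist_lt {c σ : Fin n → ℝ}
    (hc : ∀ i, Real.pi / 2 ≤ c i ∧ c i ≤ 3 * Real.pi / 2) (h : dist σ c < 3 / 2) :
    σ ∈ interior (cube n) := by
  refine mem_interior.2 ⟨Metric.ball c (3 / 2), fun τ hτ => ?_, Metric.isOpen_ball, h⟩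
  have hpi := Real.pi_gt_three
  have h1 : ∀ i, |τ i - c i| < 3 / 2 := fun i =>
    (dist_le_pi_dist τ c i).trans_lt hτ
  refine ⟨fun i => ?_, fun i => ?_⟩
  · have := (abs_lt.1 (h1 i)).1
    have := (hc i).1
    simp only [Pi.zero_apply]
    linarith
  · have := (abs_lt.1 (h1 i)).2
    have := (hc i).2
    simp only
    linarith

theorem lowCenter_bounds (i₀ i : Fin n) :
    Real.pi / 2 ≤ lowCenter i₀ i ∧ lowCenter i₀ i ≤ 3 * Real.pi / 2 := by
  have hpi := Real.pi_pos
  by_cases h : i = i₀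
  · subst h; simp only [lowCenter, Function.update_self]; constructor <;> linarith
  · simp only [lowCenter, Function.update_of_ne h]; constructor <;> linarith

theorem highCenter_bounds (i₀ i : Fin n) :
    Real.pi / 2 ≤ highCenter i₀ i ∧ highCenter i₀ i ≤ 3 * Real.pi / 2 := by
  have hpi := Real.pi_pos
  by_cases h : i = i₀
  · subst h; simp only [highCenter, Function.update_self]; constructor <;> linarith
  · simp only [highCenter, Function.update_of_ne h]; constructor <;> linarith

theorem le_dist_lowCenter {i₀ : Fin n} {σ : Fin n → ℝ} {r : ℝ} (h : Real.pi / 2 + r ≤ σ i₀) :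
    r ≤ dist σ (lowCenter i₀) := by
  refine le_trans ?_ (dist_le_pi_dist σ (lowCenter i₀) i₀)
  rw [Real.dist_eq, lowCenter, Function.update_self]
  exact le_trans (by linarith) (le_abs_self _)

theorem le_dist_highCenter {i₀ : Fin n} {σ : Fin n → ℝ} {r : ℝ} (h : σ i₀ ≤ 3 * Real.pi / 2 - r) :
    r ≤ dist σ (highCenter i₀) := by
  refine le_trans ?_ (dist_le_pi_dist σ (highCenter i₀) i₀)
  rw [Real.dist_eq, highCenter, Function.update_self]
  linarith [neg_abs_le (σ i₀ - 3 * Real.pi / 2)]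

end Centers

/-! ### Gluing two blobs into a family of loops -/

section Glue

variable {m n : ℕ} {M : Type*} [TopologicalSpace M] [ChartedSpace (E m) M]

variable (m) in
/-- A smooth family of maps of `ℝⁿ` that equal `x₀` away from the point `c`. -/
structure IsBlob (x₀ : M) (c : Fin n → ℝ) (β : (Fin n → ℝ) × ℝ → M) : Prop where
  smooth : ContMDiff 𝓘(ℝ, (Fin n → ℝ) × ℝ) (𝓡 m) ∞ β
  eq_of_dist : ∀ σ, 7 / 8 ≤ dist σ c → ∀ u, β (σ, u) = x₀

/-- A loop of loops moving two separate blobs. -/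
def glue (i₀ : Fin n) (β₁ β₂ : (Fin n → ℝ) × ℝ → M) (f g : ℝ → ℝ) (z : (Fin n → ℝ) × ℝ) : M :=
  if z.1 i₀ < Real.pi then β₁ (z.1, f z.2) else β₂ (z.1, g z.2)

variable {i₀ : Fin n} {β₁ β₂ : (Fin n → ℝ) × ℝ → M} {x₀ : M} {f g : ℝ → ℝ}

/-- The slab of points with `|σ i₀ - π| ≤ 1/2` is at distance at least `π/2 - 1/2 > 7/8` from both
centres, so both blobs are constant there; this makes the gluing smooth. -/
theorem IsBlob.eq_of_le (h : IsBlob m x₀ (lowCenter i₀) β₁) {σ : Fin n → ℝ}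
    (hσ : Real.pi - 1 / 2 ≤ σ i₀) (u : ℝ) : β₁ (σ, u) = x₀ :=
  h.eq_of_dist σ (le_dist_lowCenter (by linarith [Real.pi_gt_three])) u

theorem IsBlob.eq_of_ge (h : IsBlob m x₀ (highCenter i₀) β₂) {σ : Fin n → ℝ}
    (hσ : σ i₀ ≤ Real.pi + 1 / 2) (u : ℝ) : β₂ (σ, u) = x₀ :=
  h.eq_of_dist σ (le_dist_highCenter (by linarith [Real.pi_gt_three])) u

theorem IsBlob.eq_of_mem_frontier {c : Fin n → ℝ}
    (hc : ∀ i, Real.pi / 2 ≤ c i ∧ c i ≤ 3 * Real.pi / 2) (h : IsBlob m x₀ c β₁)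
    {σ : Fin n → ℝ} (hσ : σ ∈ frontier (cube n)) (u : ℝ) : β₁ (σ, u) = x₀ := by
  refine h.eq_of_dist σ ?_ u
  by_contra hlt
  exact hσ.2 (mem_interior_cube_of_dist_lt hc (by linarith))

/-- Near each point only one blob is present. The constancy of the other one is recorded too,
because it makes the densities additive. -/
theorem glue_eventuallyEq (h₁ : IsBlob m x₀ (lowCenter i₀) β₁)
    (h₂ : IsBlob m x₀ (highCenter i₀) β₂) (z : (Fin n → ℝ) × ℝ) :
    (glue i₀ β₁ β₂ f g =ᶠ[𝓝 z] (fun z => β₁ (z.1, f z.2)) ∧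
      ∀ u, β₂ =ᶠ[𝓝 (z.1, u)] fun _ => x₀) ∨
    (glue i₀ β₁ β₂ f g =ᶠ[𝓝 z] (fun z => β₂ (z.1, g z.2)) ∧
      ∀ u, β₁ =ᶠ[𝓝 (z.1, u)] fun _ => x₀) := by
  have hc : Continuous fun z : (Fin n → ℝ) × ℝ => z.1 i₀ := by fun_prop
  rcases lt_or_ge (z.1 i₀) Real.pi with hz | hz
  · left
    refine ⟨?_, fun u => ?_⟩
    · filter_upwards [hc.continuousAt.eventually (Iio_mem_nhds hz)] with w hw
      exact if_pos hw
    · filter_upwards [(hc.continuousAt (x := (z.1, u))).eventually (Iio_mem_nhds hz)] with w hw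
      have hw : w.1 i₀ < Real.pi := hw
      exact h₂.eq_of_ge (by linarith) w.2
  · right
    have hz' : Real.pi - 1 / 2 < z.1 i₀ := by linarith
    refine ⟨?_, fun u => ?_⟩
    · filter_upwards [hc.continuousAt.eventually (Ioi_mem_nhds hz')] with w hw
      have hw : Real.pi - 1 / 2 < w.1 i₀ := hw
      simp only [glue]
      split_ifs with h
      · rw [h₁.eq_of_le hw.le, h₂.eq_of_ge (by linarith)]
      · rfl
    · filter_upwards [(hc.continuousAt (x := (z.1, u))).eventually (Ioi_mem_nhds hz')] with w hw
      exact h₁.eq_of_le (le_of_lt hw) w.2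

theorem contDiff_slide (hf : ContDiff ℝ ∞ f) :
    ContDiff ℝ ∞ fun z : (Fin n → ℝ) × ℝ => (z.1, f z.2) :=
  contDiff_fst.prodMk (hf.comp contDiff_snd)

theorem contMDiff_glue (h₁ : IsBlob m x₀ (lowCenter i₀) β₁)
    (h₂ : IsBlob m x₀ (highCenter i₀) β₂) (hf : ContDiff ℝ ∞ f) (hg : ContDiff ℝ ∞ g) :
    ContMDiff 𝓘(ℝ, (Fin n → ℝ) × ℝ) (𝓡 m) ∞ (glue i₀ β₁ β₂ f g) := by
  intro z
  rcases glue_eventuallyEq (f := f) (g := g) h₁ h₂ z with h | h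
  · exact ((h₁.smooth.comp (contDiff_slide hf).contMDiff) z).congr_of_eventuallyEq h.1
  · exact ((h₂.smooth.comp (contDiff_slide hg).contMDiff) z).congr_of_eventuallyEq h.1

theorem glue_eq_of_mem_frontier (h₁ : IsBlob m x₀ (lowCenter i₀) β₁)
    (h₂ : IsBlob m x₀ (highCenter i₀) β₂) {σ : Fin n → ℝ} (hσ : σ ∈ frontier (cube n)) (τ : ℝ) :
    glue i₀ β₁ β₂ f g (σ, τ) = x₀ := by
  simp only [glue]
  split_ifs
  · exact h₁.eq_of_mem_frontier (lowCenter_bounds i₀) hσ _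
  · exact h₂.eq_of_mem_frontier (highCenter_bounds i₀) hσ _

/-- Replacing `u` by `u * q σ` keeps the map at `u = 0` and multiplies its velocity there by `q`:
these are the test functions of the localization. -/
theorem IsBlob.comp {c : Fin n → ℝ} (h : IsBlob m x₀ c β₁) {q : (Fin n → ℝ) → ℝ}
    (hq : ContDiff ℝ ∞ q) : IsBlob m x₀ c (fun z => β₁ (z.1, z.2 * q z.1)) :=
  ⟨h.smooth.comp (contDiff_fst.prodMk (contDiff_snd.mul (hq.comp contDiff_fst))).contMDiff,
    fun σ hσ _ => h.eq_of_dist σ hσ _⟩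

end Glue

/-! ### Sweeps of blobs, and localization at the centres -/

section BlobIntegrals

variable {m k n : ℕ}
  {M : Type*} [TopologicalSpace M] [ChartedSpace (E m) M] [IsManifold (𝓡 m) ∞ M]
  {G : Type*} [TopologicalSpace G] [ChartedSpace (E k) G] [Group G] [LieGroup (𝓡 k) ∞ G]
  {P : Type*} [TopologicalSpace P] [ChartedSpace (ModelProd (E m) (E k)) P]
  [IsManifold ((𝓡 m).prod (𝓡 k)) ∞ P] [MulAction Gᵐᵒᵖ P]
  {proj : P → M} {A : Connection m k G P} {s : M → P} {B : AdForm m k G proj (n + 1)} {p₀ : P}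
  {i₀ : Fin n} {β β₁ β₂ : (Fin n → ℝ) × ℝ → M} {x₀ : M} {f g : ℝ → ℝ}

/-- The coefficient of the pullback of the transported form by a map of `ℝⁿ × ℝ`. -/
def openDensity (B : AdForm m k G proj (n + 1)) (s : M → P) (Γ : (Fin n → ℝ) × ℝ → M)
    (z : (Fin n → ℝ) × ℝ) : E k :=
  B.pull s Γ univ z (frameVec n)

theorem density_eq_openDensity {Γ : (Fin n → ℝ) × ℝ → M}
    (hΓ : ContMDiff 𝓘(ℝ, (Fin n → ℝ) × ℝ) (𝓡 m) ∞ Γ) {z : (Fin n → ℝ) × ℝ}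
    (hz : z ∈ cubeTime n) : density B s Γ z = openDensity B s Γ z := by
  have h : vd (𝓡 m) Γ (cubeTime n) z = vd (𝓡 m) Γ univ z := by
    unfold vd
    rw [mfderivWithin_univ, mfderivWithin_eq_mfderiv
      (uniqueDiffOn_cubeTime n z hz).uniqueMDiffWithinAt ((hΓ z).mdifferentiableAt (by simp))]
  rw [density, openDensity, AdForm.pull, AdForm.pull, h]

theorem continuous_openDensity (hP : IsPrincipalBundle m k G proj)
    (hs : IsHorizontalSection A proj univ s) {Γ : (Fin n → ℝ) × ℝ → M}
    (hΓ : ContMDiff 𝓘(ℝ, (Fin n → ℝ) × ℝ) (𝓡 m) ∞ Γ) : Continuous (openDensity B s Γ) :=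
  continuousOn_univ.1 fun z hz =>
    (B.continuousOn_pull hP hs hΓ.contMDiffOn uniqueDiffOn_univ z hz).eval
      continuousWithinAt_const

theorem openDensity_congr {Γ Γ' : (Fin n → ℝ) × ℝ → M} {z : (Fin n → ℝ) × ℝ} (h : Γ =ᶠ[𝓝 z] Γ') :
    openDensity B s Γ z = openDensity B s Γ' z := by
  rw [openDensity, openDensity, B.pull_congr s (by rwa [nhdsWithin_univ]) h.self_of_nhds]

theorem openDensity_eq_zero {z : (Fin n → ℝ) × ℝ} (h : β =ᶠ[𝓝 z] fun _ => x₀) :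
    openDensity B s β z = 0 := by
  rw [openDensity_congr h, openDensity, AdForm.pull_apply]
  refine ContinuousAlternatingMap.map_coord_zero _ (0 : Fin (n + 1)) ?_
  unfold vd
  rw [mfderivWithin_univ, mfderiv_const]
  rfl

theorem openDensity_comp (hβ : ContMDiff 𝓘(ℝ, (Fin n → ℝ) × ℝ) (𝓡 m) ∞ β)
    {j : (Fin n → ℝ) × ℝ → (Fin n → ℝ) × ℝ} {z : (Fin n → ℝ) × ℝ}
    {D : (Fin n → ℝ) × ℝ →L[ℝ] (Fin n → ℝ) × ℝ} (hj : HasFDerivAt j D z) {c : ℝ}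
    (h0 : D (0, 1) = c • ((0, 1) : (Fin n → ℝ) × ℝ)) (hi : ∀ v, D (v, 0) = (v, 0)) :
    openDensity B s (fun z => β (j z)) z = c • openDensity B s β (j z) := by
  have h1 := B.pull_comp s (F := β) (f := j) (S := univ) (T := univ) (z := z)
    ((hβ _).mdifferentiableAt (by simp)).mdifferentiableWithinAt
    hj.differentiableAt.differentiableWithinAt (mapsTo_univ _ _) uniqueDiffWithinAt_univ
  rw [fderivWithin_univ, hj.fderiv] at h1
  have h2 : ∀ i, D (frameVec n i) = (Matrix.vecCons (c • ((0, 1) : (Fin n → ℝ) × ℝ))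
      fun i => (Pi.single i 1, 0) : Fin (n + 1) → (Fin n → ℝ) × ℝ) i := fun i => by
    refine Fin.cases ?_ (fun j => ?_) i
    · exact h0
    · exact hi _
  have h3 : openDensity B s (fun z => β (j z)) z =
      B.pull s β univ (j z) fun i => D (frameVec n i) :=
    congrArg (fun T : ((Fin n → ℝ) × ℝ) [⋀^Fin (n + 1)]→L[ℝ] E k => T (frameVec n)) h1
  rw [h3, funext h2]
  exact ContinuousAlternatingMap.vecCons_smul _ _ _ _

theorem openDensity_slide (hβ : ContMDiff 𝓘(ℝ, (Fin n → ℝ) × ℝ) (𝓡 m) ∞ β)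
    (hf : ContDiff ℝ ∞ f) (z : (Fin n → ℝ) × ℝ) :
    openDensity B s (fun z => β (z.1, f z.2)) z =
      deriv f z.2 • openDensity B s β (z.1, f z.2) := by
  have hd : HasDerivAt f (deriv f z.2) z.2 :=
    (hf.differentiable (by simp)).differentiableAt.hasDerivAt
  have h1 := (hasFDerivAt_fst (𝕜 := ℝ) (p := z)).prodMk
    (hd.hasFDerivAt.comp z (hasFDerivAt_snd (𝕜 := ℝ) (p := z)))
  exact openDensity_comp hβ (j := fun z => (z.1, f z.2)) h1 (by simp) (by simp)

/-- Only at `u = 0` is the formula this simple: there the `σ`-derivatives of `u * q σ` vanish, so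
the spatial vectors are unchanged. -/
theorem openDensity_scale (hβ : ContMDiff 𝓘(ℝ, (Fin n → ℝ) × ℝ) (𝓡 m) ∞ β)
    {q : (Fin n → ℝ) → ℝ} (hq : ContDiff ℝ ∞ q) (σ : Fin n → ℝ) :
    openDensity B s (fun z => β (z.1, z.2 * q z.1)) (σ, 0) = q σ • openDensity B s β (σ, 0) := by
  have hd := (hq.differentiable (by simp)).differentiableAt (x := σ) |>.hasFDerivAt
  have h1 := (hasFDerivAt_fst (𝕜 := ℝ) (p := ((σ, 0) : (Fin n → ℝ) × ℝ))).prodMk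
    ((hasFDerivAt_snd (𝕜 := ℝ) (p := ((σ, 0) : (Fin n → ℝ) × ℝ))).mul
      (hd.comp ((σ, 0) : (Fin n → ℝ) × ℝ)
        (hasFDerivAt_fst (𝕜 := ℝ) (p := ((σ, 0) : (Fin n → ℝ) × ℝ)))))
  have h2 := openDensity_comp (B := B) (s := s) hβ (j := fun z => (z.1, z.2 * q z.1)) h1
    (c := q σ) (by simp) (by simp)
  simpa using h2

theorem openDensity_glue (h₁ : IsBlob m x₀ (lowCenter i₀) β₁)
    (h₂ : IsBlob m x₀ (highCenter i₀) β₂) (hf : ContDiff ℝ ∞ f) (hg : ContDiff ℝ ∞ g)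
    (z : (Fin n → ℝ) × ℝ) :
    openDensity B s (glue i₀ β₁ β₂ f g) z =
      deriv f z.2 • openDensity B s β₁ (z.1, f z.2) +
        deriv g z.2 • openDensity B s β₂ (z.1, g z.2) := by
  rcases glue_eventuallyEq (f := f) (g := g) h₁ h₂ z with h | h
  · rw [openDensity_congr h.1, openDensity_slide h₁.smooth hf, openDensity_eq_zero (h.2 _),
      smul_zero, add_zero]
  · rw [openDensity_congr h.1, openDensity_slide h₂.smooth hg, openDensity_eq_zero (h.2 _),
      smul_zero, zero_add]

/-- The value of the loop space connection on the velocity of a family of maps. -/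
def sweep (B : AdForm m k G proj (n + 1)) (s : M → P) (β : (Fin n → ℝ) × ℝ → M) (u : ℝ) : E k :=
  ∫ σ in cube n, openDensity B s β (σ, u)

theorem continuous_sweep (hP : IsPrincipalBundle m k G proj)
    (hs : IsHorizontalSection A proj univ s) (hβ : ContMDiff 𝓘(ℝ, (Fin n → ℝ) × ℝ) (𝓡 m) ∞ β) :
    Continuous (sweep B s β) := by
  have h := continuous_openDensity (B := B) hP hs hβ
  exact continuous_parametric_integral_of_continuous
    (f := fun u σ => openDensity B s β (σ, u)) (by
      exact h.comp (continuous_snd.prodMk continuous_fst)) (isCompact_cube n)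

theorem integral_density_glue (hP : IsPrincipalBundle m k G proj)
    (hs : IsHorizontalSection A proj univ s) (h₁ : IsBlob m x₀ (lowCenter i₀) β₁)
    (h₂ : IsBlob m x₀ (highCenter i₀) β₂) (hf : ContDiff ℝ ∞ f) (hg : ContDiff ℝ ∞ g) {τ : ℝ}
    (hτ : τ ∈ Icc 0 (2 * Real.pi)) :
    ∫ σ in cube n, density B s (glue i₀ β₁ β₂ f g) (σ, τ) =
      deriv f τ • sweep B s β₁ (f τ) + deriv g τ • sweep B s β₂ (g τ) := by
  have hi : ∀ {β : (Fin n → ℝ) × ℝ → M}, ContMDiff 𝓘(ℝ, (Fin n → ℝ) × ℝ) (𝓡 m) ∞ β → ∀ u,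
      IntegrableOn (fun σ => openDensity B s β (σ, u)) (cube n) := fun hβ u =>
    ((continuous_openDensity hP hs hβ).comp
      (continuous_id.prodMk continuous_const)).continuousOn.integrableOn_compact (isCompact_cube n)
  rw [sweep, sweep, ← integral_smul, ← integral_smul,
    ← integral_add (f := fun σ => deriv f τ • openDensity B s β₁ (σ, f τ))
      (g := fun σ => deriv g τ • openDensity B s β₂ (σ, g τ))
      ((hi h₁.smooth (f τ)).smul (deriv f τ)) ((hi h₂.smooth (g τ)).smul (deriv g τ))]
  refine setIntegral_congr_fun (isCompact_cube n).measurableSet fun σ hσ => ?_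
  rw [density_eq_openDensity (contMDiff_glue h₁ h₂ hf hg) (mk_mem_cubeTime hσ hτ),
    openDensity_glue h₁ h₂ hf hg]

/-- The components of an adjoint form commute as soon as the sweeps of separate blobs do. -/
theorem components_commute_of_sweep [PreconnectedSpace M] (hP : IsPrincipalBundle m k G proj)
    (hs : IsHorizontalSection A proj univ s) (i₀ : Fin n) (x₀ : M)
    (h : ∀ β₁ β₂ : (Fin n → ℝ) × ℝ → M, IsBlob m x₀ (lowCenter i₀) β₁ →
      IsBlob m x₀ (highCenter i₀) β₂ →
        bracketL G (sweep B s β₁ 0) (sweep B s β₂ 0) = 0) :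
    ∀ ξ ∈ components B s, ∀ η ∈ components B s, bracketL G ξ η = 0 := by
  rintro _ ⟨x, v, rfl⟩ _ ⟨x', v', rfl⟩
  obtain ⟨β₁, hs₁, hd₁, hx₁, hv₁⟩ := exists_blob x₀ x (lowCenter i₀) v
  obtain ⟨β₂, hs₂, hd₂, hx₂, hv₂⟩ := exists_blob x₀ x' (highCenter i₀) v'
  have e₁ : openDensity B s β₁ (lowCenter i₀, 0) = B.formAt (s x) v := by
    rw [openDensity, AdForm.pull_apply, funext hv₁, hx₁]
  have e₂ : openDensity B s β₂ (highCenter i₀, 0) = B.formAt (s x') v' := by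
    rw [openDensity, AdForm.pull_apply, funext hv₂, hx₂]
  have hc₁ : lowCenter i₀ ∈ interior (cube n) :=
    mem_interior_cube_of_dist_lt (lowCenter_bounds i₀) (by rw [dist_self]; norm_num)
  have hc₂ : highCenter i₀ ∈ interior (cube n) :=
    mem_interior_cube_of_dist_lt (highCenter_bounds i₀) (by rw [dist_self]; norm_num)
  have hcont : ∀ {β : (Fin n → ℝ) × ℝ → M}, ContMDiff 𝓘(ℝ, (Fin n → ℝ) × ℝ) (𝓡 m) ∞ β →
      Continuous fun σ => openDensity B s β (σ, 0) := fun hβ =>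
    (continuous_openDensity hP hs hβ).comp (continuous_id.prodMk continuous_const)
  have hsw : ∀ {β : (Fin n → ℝ) × ℝ → M}, ContMDiff 𝓘(ℝ, (Fin n → ℝ) × ℝ) (𝓡 m) ∞ β →
      ∀ {q : (Fin n → ℝ) → ℝ}, ContDiff ℝ ∞ q → sweep B s (fun z => β (z.1, z.2 * q z.1)) 0 =
        ∫ σ in cube n, q σ • openDensity B s β (σ, 0) := fun hβ q hq => by
    rw [sweep]
    exact setIntegral_congr_fun (isCompact_cube n).measurableSet fun σ _ =>
      openDensity_scale hβ hq σ
  rw [← e₁, ← e₂]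
  -- The bracket is localized in one argument at a time: first at the centre of the second blob,
  -- then at that of the first.
  refine map_eq_zero_of_integral_smul (hcont hs₂)
    (bracketL G (openDensity B s β₁ (lowCenter i₀, 0))) (fun q₂ hq₂ => ?_) hc₂
  rw [bracketL_antisymm, neg_eq_zero]
  refine map_eq_zero_of_integral_smul (hcont hs₁) (bracketL G _) (fun q₁ hq₁ => ?_) hc₁
  rw [bracketL_antisymm, neg_eq_zero, ← hsw hs₁ hq₁, ← hsw hs₂ hq₂]
  exact h _ _ ((⟨hs₁, hd₁⟩ : IsBlob m x₀ (lowCenter i₀) β₁).comp hq₁)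
    ((⟨hs₂, hd₂⟩ : IsBlob m x₀ (highCenter i₀) β₂).comp hq₂)

end BlobIntegrals

/-! ### Curvature locality and pointwise commutation imply commuting sweeps -/

section Converse

variable {m k n : ℕ}
  {M : Type*} [TopologicalSpace M] [ChartedSpace (E m) M] [IsManifold (𝓡 m) ∞ M]
  {G : Type*} [TopologicalSpace G] [ChartedSpace (E k) G] [Group G] [LieGroup (𝓡 k) ∞ G]
  {P : Type*} [TopologicalSpace P] [ChartedSpace (ModelProd (E m) (E k)) P]
  [IsManifold ((𝓡 m).prod (𝓡 k)) ∞ P] [MulAction Gᵐᵒᵖ P]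
  {proj : P → M} {A : Connection m k G P} {s : M → P} {B : AdForm m k G proj (n + 1)} {p₀ : P}
  {i₀ : Fin n} {β₁ β₂ : (Fin n → ℝ) × ℝ → M} {x₀ : M}

theorem isNLoop_slice {Γ : (Fin n → ℝ) × ℝ → M}
    (hΓ : ContMDiff 𝓘(ℝ, (Fin n → ℝ) × ℝ) (𝓡 m) ∞ Γ)
    (hx₀ : ∀ σ ∈ frontier (cube n), ∀ τ, Γ (σ, τ) = x₀) (τ : ℝ) :
    IsNLoop m n x₀ fun σ => Γ (σ, τ) := by
  have h : ContMDiff 𝓘(ℝ, Fin n → ℝ) (𝓡 m) ∞ fun σ => Γ (σ, τ) :=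
    hΓ.comp (contDiff_id.prodMk contDiff_const).contMDiff
  exact ⟨h.contMDiffOn, fun σ hσ => hx₀ σ hσ τ⟩

/-- Smoothness comes from the tangent map of `Γ` applied to the constant field `∂/∂τ`; on the
boundary of the cube `Γ` does not depend on `τ`. -/
theorem isTangentAt_velocity {Γ : (Fin n → ℝ) × ℝ → M}
    (hΓ : ContMDiff 𝓘(ℝ, (Fin n → ℝ) × ℝ) (𝓡 m) ∞ Γ)
    (hx₀ : ∀ σ ∈ frontier (cube n), ∀ τ, Γ (σ, τ) = x₀) {τ : ℝ} (hτ : τ ∈ Icc 0 (2 * Real.pi)) :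
    IsTangentAt (m := m) (fun σ => Γ (σ, τ)) (fun σ => velocity (m := m) Γ σ τ) := by
  have hvel : ∀ σ ∈ cube n, velocity (m := m) Γ σ τ =
      mfderiv 𝓘(ℝ, (Fin n → ℝ) × ℝ) (𝓡 m) Γ (σ, τ) ((0, 1) : (Fin n → ℝ) × ℝ) := by
    intro σ hσ
    have h := mfderivWithin_eq_mfderiv
      (uniqueDiffOn_cubeTime n _ (mk_mem_cubeTime hσ hτ)).uniqueMDiffWithinAt
      ((hΓ (σ, τ)).mdifferentiableAt (by simp))
    exact congrArg (fun T : (Fin n → ℝ) × ℝ →L[ℝ] E m => T (0, 1)) h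
  refine ⟨?_, fun σ hσ => ?_⟩
  · have h1 : ContMDiff 𝓘(ℝ, (Fin n → ℝ) × ℝ) 𝓘(ℝ, (Fin n → ℝ) × ℝ).tangent ∞
        (fun z : (Fin n → ℝ) × ℝ => (⟨z, ((0, 1) : (Fin n → ℝ) × ℝ)⟩ :
          TangentBundle 𝓘(ℝ, (Fin n → ℝ) × ℝ) ((Fin n → ℝ) × ℝ))) :=
      contMDiff_vectorSpace_iff_contDiff.2 contDiff_const
    have h2 : ContMDiff 𝓘(ℝ, Fin n → ℝ) 𝓘(ℝ, (Fin n → ℝ) × ℝ) ∞ fun σ : Fin n → ℝ => (σ, τ) :=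
      (contDiff_id.prodMk contDiff_const).contMDiff
    have h3 := ((hΓ.contMDiff_tangentMap (m := ∞) (by norm_cast)).comp h1).comp h2
    refine h3.contMDiffOn.congr fun σ hσ => ?_
    exact congrArg (fun w : E m => (⟨Γ (σ, τ), w⟩ : TangentBundle (𝓡 m) M)) (hvel σ hσ)
  · have hσ' := (isCompact_cube n).isClosed.frontier_subset hσ
    refine (hvel σ hσ').trans ?_
    have h1 : HasMFDerivAt 𝓘(ℝ, ℝ) (𝓡 m) (Γ ∘ fun u : ℝ => (σ, u)) τ _ :=
      HasMFDerivAt.comp τ ((hΓ (σ, τ)).mdifferentiableAt (by simp)).hasMFDerivAt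
        (hasFDerivAt_prodMk_right (𝕜 := ℝ) σ τ).hasMFDerivAt
    have h2 : (Γ ∘ fun u : ℝ => (σ, u)) = fun _ => x₀ := funext fun u => hx₀ σ hσ u
    have h3 : (mfderiv 𝓘(ℝ, ℝ) (𝓡 m) (Γ ∘ fun u : ℝ => (σ, u)) τ : ℝ →L[ℝ] E m) = 0 := by
      rw [h2, mfderiv_const]
    have h4 := congrArg (fun T : ℝ →L[ℝ] E m => T 1) (h1.mfderiv.symm.trans h3)
    exact h4

/-- The glued loop at parameters `(0, 0)` has two tangent vectors: one moves only the low blob, the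
other only the high blob. The connection takes them to the two sweeps. -/
theorem IsCurvatureLocal.bracketL_sweep [PreconnectedSpace M] (hP : IsPrincipalBundle m k G proj)
    (hs : IsHorizontalSection A proj univ s) (h0 : s (proj p₀) = p₀)
    (h : IsCurvatureLocal A B p₀) (h₁ : IsBlob m (proj p₀) (lowCenter i₀) β₁)
    (h₂ : IsBlob m (proj p₀) (highCenter i₀) β₂) :
    bracketL G (sweep B s β₁ 0) (sweep B s β₂ 0) = 0 := by
  have hz : (0 : ℝ) ∈ Icc 0 (2 * Real.pi) := ⟨le_rfl, two_pi_pos.le⟩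
  have hc : ContDiff ℝ ∞ fun _ : ℝ => (0 : ℝ) := contDiff_const
  have hi : ContDiff ℝ ∞ fun u : ℝ => u := contDiff_id
  set Γ₁ := glue i₀ β₁ β₂ (fun u => u) (fun _ => 0) with hΓ₁
  set Γ₂ := glue i₀ β₁ β₂ (fun _ => 0) (fun u => u) with hΓ₂
  have hs₁ := contMDiff_glue h₁ h₂ hi hc
  have hs₂ := contMDiff_glue h₁ h₂ hc hi
  have ht₁ := isTangentAt_velocity hs₁ (fun σ hσ τ => glue_eq_of_mem_frontier h₁ h₂ hσ τ) hz
  have ht₂ := isTangentAt_velocity hs₂ (fun σ hσ τ => glue_eq_of_mem_frontier h₁ h₂ hσ τ) hz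
  have hN := isNLoop_slice hs₁ (fun σ hσ τ => glue_eq_of_mem_frontier h₁ h₂ hσ τ) 0
  have hbr := h _ hN _ _ ht₁ ht₂
  have e₁ := (loopConnection_velocity_eq (A := A) (B := B) hP hs h0 hs₁.contMDiffOn hz).trans
    (integral_density_glue hP hs h₁ h₂ hi hc hz)
  have e₂ := (loopConnection_velocity_eq (A := A) (B := B) hP hs h0 hs₂.contMDiffOn hz).trans
    (integral_density_glue hP hs h₁ h₂ hc hi hz)
  simp only [deriv_id'', deriv_const, one_smul, zero_smul, add_zero, zero_add] at e₁ e₂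
  rw [← e₁, ← e₂, ← bracket_eq_bracketL]
  exact hbr

/-- With the same two variations the densities commute at every pair of points of the cube, and the
bracket of the sweeps is their double integral. -/
theorem CommutesAlongLoops.bracketL_sweep [PreconnectedSpace M]
    (hP : IsPrincipalBundle m k G proj)
    (hs : IsHorizontalSection A proj univ s) (h0 : s (proj p₀) = p₀)
    (h : CommutesAlongLoops A B p₀) (h₁ : IsBlob m (proj p₀) (lowCenter i₀) β₁)
    (h₂ : IsBlob m (proj p₀) (highCenter i₀) β₂) :
    bracketL G (sweep B s β₁ 0) (sweep B s β₂ 0) = 0 := by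
  have hz : (0 : ℝ) ∈ Icc 0 (2 * Real.pi) := ⟨le_rfl, two_pi_pos.le⟩
  have hc : ContDiff ℝ ∞ fun _ : ℝ => (0 : ℝ) := contDiff_const
  have hi : ContDiff ℝ ∞ fun u : ℝ => u := contDiff_id
  have hs₁ := contMDiff_glue h₁ h₂ hi hc
  have hs₂ := contMDiff_glue h₁ h₂ hc hi
  have hN := isNLoop_slice hs₁ (fun σ hσ τ => glue_eq_of_mem_frontier h₁ h₂ hσ τ) 0
  have key : ∀ σ ∈ cube n, ∀ σ' ∈ cube n,
      bracketL G (openDensity B s β₁ (σ, 0)) (openDensity B s β₂ (σ', 0)) = 0 := by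
    intro σ hσ σ' hσ'
    have e₁ := (contraction_velocity_eq (A := A) (B := B) hP hs h0 hs₁.contMDiffOn hσ hz).trans
      ((density_eq_openDensity hs₁ (mk_mem_cubeTime hσ hz)).trans
        (openDensity_glue h₁ h₂ hi hc _))
    have e₂ := (contraction_velocity_eq (A := A) (B := B) hP hs h0 hs₂.contMDiffOn hσ' hz).trans
      ((density_eq_openDensity hs₂ (mk_mem_cubeTime hσ' hz)).trans
        (openDensity_glue h₁ h₂ hc hi _))
    simp only [deriv_id'', deriv_const, one_smul, zero_smul, add_zero, zero_add] at e₁ e₂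
    rw [← e₁, ← e₂, ← bracket_eq_bracketL]
    exact h _ hN σ hσ σ' hσ' _ _
  have hint : ∀ {β : (Fin n → ℝ) × ℝ → M}, ContMDiff 𝓘(ℝ, (Fin n → ℝ) × ℝ) (𝓡 m) ∞ β →
      IntegrableOn (fun σ => openDensity B s β (σ, 0)) (cube n) := fun hβ =>
    ((continuous_openDensity hP hs hβ).comp
      (continuous_id.prodMk continuous_const)).continuousOn.integrableOn_compact (isCompact_cube n)
  rw [sweep, sweep, ← ContinuousLinearMap.integral_comp_comm _ (hint h₂.smooth)]
  refine setIntegral_eq_zero_of_forall_eq_zero fun σ' hσ' => ?_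
  rw [bracketL_antisymm, neg_eq_zero,
    ← ContinuousLinearMap.integral_comp_comm _ (hint h₁.smooth)]
  refine setIntegral_eq_zero_of_forall_eq_zero fun σ hσ => ?_
  rw [bracketL_antisymm, neg_eq_zero]
  exact key σ hσ σ' hσ'

end Converse

/-! ### Smooth steps and pulses in time -/

section Steps

/-- A smooth step from `0` to `1` on `[jπ/2, (j+1)π/2]`. -/
def step (j τ : ℝ) : ℝ := Real.smoothTransition (2 / Real.pi * τ - j)

variable {j τ : ℝ}

theorem contDiff_step (j : ℝ) : ContDiff ℝ ∞ (step j) :=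
  Real.smoothTransition.contDiff.comp ((contDiff_const.mul contDiff_id).sub contDiff_const)

theorem step_nonneg (j τ : ℝ) : 0 ≤ step j τ := Real.smoothTransition.nonneg _

theorem step_le_one (j τ : ℝ) : step j τ ≤ 1 := Real.smoothTransition.le_one _

theorem step_eq_zero (h : τ ≤ j * (Real.pi / 2)) : step j τ = 0 := by
  refine Real.smoothTransition.zero_of_nonpos ?_
  have hpi := Real.pi_pos
  rw [sub_nonpos, div_mul_eq_mul_div, div_le_iff₀ hpi]
  linarith

theorem step_eq_one (h : (j + 1) * (Real.pi / 2) ≤ τ) : step j τ = 1 := by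
  refine Real.smoothTransition.one_of_one_le ?_
  have hpi := Real.pi_pos
  rw [le_sub_iff_add_le, div_mul_eq_mul_div, le_div_iff₀ hpi]
  linarith

/-- The step attains its minimum there, which also covers the endpoint of the flat interval. -/
theorem deriv_step_of_le (h : τ ≤ j * (Real.pi / 2)) : deriv (step j) τ = 0 :=
  IsLocalMin.deriv_eq_zero (Eventually.of_forall fun u => by
    rw [step_eq_zero h]; exact step_nonneg j u)

theorem deriv_step_of_ge (h : (j + 1) * (Real.pi / 2) ≤ τ) : deriv (step j) τ = 0 :=
  IsLocalMax.deriv_eq_zero (Eventually.of_forall fun u => by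
    rw [step_eq_one h]; exact step_le_one j u)

theorem hasDerivAt_step (j τ : ℝ) : HasDerivAt (step j) (deriv (step j) τ) τ :=
  ((contDiff_step j).differentiable (by simp)).differentiableAt.hasDerivAt

/-- A smooth bump rising in the quarter `j` of `[0, 2π]` and falling in the quarter `j + 2`. -/
def pulse (j S τ : ℝ) : ℝ := S * (step j τ - step (j + 2) τ)

theorem contDiff_pulse (j S : ℝ) : ContDiff ℝ ∞ (pulse j S) :=
  contDiff_const.mul ((contDiff_step j).sub (contDiff_step (j + 2)))

theorem hasDerivAt_pulse (j S τ : ℝ) :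
    HasDerivAt (pulse j S) (S * (deriv (step j) τ - deriv (step (j + 2)) τ)) τ :=
  ((hasDerivAt_step j τ).sub (hasDerivAt_step (j + 2) τ)).const_mul S

theorem pulse_eq_rise {S : ℝ} (h : τ ≤ (j + 2) * (Real.pi / 2)) :
    pulse j S τ = S * step j τ := by
  rw [pulse, step_eq_zero h, sub_zero]

theorem pulse_eq_fall {S : ℝ} (h : (j + 1) * (Real.pi / 2) ≤ τ) :
    pulse j S τ = S * (1 - step (j + 2) τ) := by
  rw [pulse, step_eq_one h]

theorem pulse_eq_zero_of_le {S : ℝ} (h : τ ≤ j * (Real.pi / 2)) : pulse j S τ = 0 := by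
  have hpi := Real.pi_pos
  rw [pulse_eq_rise (by linarith), step_eq_zero h, mul_zero]

theorem pulse_eq_zero_of_ge {S : ℝ} (h : (j + 3) * (Real.pi / 2) ≤ τ) : pulse j S τ = 0 := by
  have hpi := Real.pi_pos
  rw [pulse_eq_fall (by linarith), step_eq_one (by linarith), sub_self, mul_zero]

theorem pulse_mem {S δ : ℝ} (hS : S ∈ Icc 0 δ) (j τ : ℝ) : pulse j S τ ∈ Icc (-δ) δ := by
  have hpi := Real.pi_pos
  rcases le_total τ ((j + 2) * (Real.pi / 2)) with h | h
  · rw [pulse_eq_rise h]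
    have h1 := mul_nonneg hS.1 (step_nonneg j τ)
    have h2 := mul_le_of_le_one_right hS.1 (step_le_one j τ)
    constructor <;> linarith [hS.1, hS.2]
  · rw [pulse_eq_fall (by linarith)]
    have h3 := step_nonneg (j + 2) τ
    have h4 := step_le_one (j + 2) τ
    have h1 := mul_nonneg hS.1 (show 0 ≤ 1 - step (j + 2) τ by linarith)
    have h2 := mul_le_of_le_one_right hS.1 (show 1 - step (j + 2) τ ≤ 1 by linarith)
    constructor <;> linarith [hS.1, hS.2]

end Steps

/-! ### Explicit holonomies of two pulses -/

section Wilson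

variable {k : ℕ} {G : Type*} [TopologicalSpace G] [ChartedSpace (E k) G] [Group G]
  [LieGroup (𝓡 k) ∞ G]

theorem holonomy_congr {a a' : ℝ → E k} (h : ∀ τ ∈ Icc 0 (2 * Real.pi), a τ = a' τ) :
    (holonomy a : G) = holonomy a' := by
  have h1 : (IsWilsonLine a : (ℝ → G) → Prop) = IsWilsonLine a' := by
    funext W
    rw [isWilsonLine_iff, isWilsonLine_iff]
    refine propext (and_congr_right fun _ => forall₂_congr fun τ hτ => ?_)
    rw [h τ hτ]
  unfold holonomy
  rw [h1]

/-- The twist by `Ad (V τ)` in the product rule is invisible when the right factor is at rest or the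
left factor is still `1`. This is how motions that take place one after another are multiplied. -/
theorem HasLogDerivWithinAt.mul_of_eq_one {V W : ℝ → G} {α β : E k} {s : Set ℝ} {τ : ℝ}
    (hV : HasLogDerivWithinAt V α s τ) (hW : HasLogDerivWithinAt W β s τ)
    (h : β = 0 ∨ V τ = 1) : HasLogDerivWithinAt (fun t => V t * W t) (α + β) s τ := by
  have h1 := hV.mul hW
  rcases h with h | h
  · rw [h, map_zero] at h1
    rwa [h]
  · rwa [h, AdL_one] at h1

variable {C₁ C₂ : ℝ → E k} {U₁ U₂ : ℝ → G} {δ₁ δ₂ S T : ℝ}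

theorem pulse_smul_eq (C : ℝ → E k) (j S τ : ℝ) :
    deriv (pulse j S) τ • C (pulse j S τ) =
      (S * deriv (step j) τ) • C (S * step j τ) +
        (-(S * deriv (step (j + 2)) τ)) • C (S * (1 - step (j + 2) τ)) := by
  have hpi := Real.pi_pos
  rw [(hasDerivAt_pulse j S τ).deriv]
  rcases le_total τ ((j + 2) * (Real.pi / 2)) with h | h
  · rw [deriv_step_of_le h, pulse_eq_rise h]
    simp
  · rw [deriv_step_of_ge (j := j) (by linarith), pulse_eq_fall (by linarith)]
    simp

/-- The holonomy of two interleaved pulses is a commutator. -/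
theorem holonomy_interleaved
    (hU₁ : ∀ u ∈ Icc (-δ₁) δ₁, HasLogDerivWithinAt U₁ (-C₁ u) (Icc (-δ₁) δ₁) u)
    (hU₂ : ∀ u ∈ Icc (-δ₂) δ₂, HasLogDerivWithinAt U₂ (-C₂ u) (Icc (-δ₂) δ₂) u)
    (h₁ : U₁ 0 = 1) (h₂ : U₂ 0 = 1) (hS : S ∈ Icc 0 δ₁) (hT : T ∈ Icc 0 δ₂) :
    (holonomy fun τ => deriv (pulse 0 S) τ • C₁ (pulse 0 S τ) +
      deriv (pulse 1 T) τ • C₂ (pulse 1 T τ)) = (U₂ T)⁻¹ * ((U₁ S)⁻¹ * (U₂ T * U₁ S)) := by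
  have hpi := Real.pi_pos
  have rise : ∀ {U : ℝ → G} {C : ℝ → E k} {δ S : ℝ} (j : ℝ),
      (∀ u ∈ Icc (-δ) δ, HasLogDerivWithinAt U (-C u) (Icc (-δ) δ) u) → S ∈ Icc 0 δ →
      ∀ τ, HasLogDerivWithinAt (fun τ => U (S * step j τ))
        (-((S * deriv (step j) τ) • C (S * step j τ))) (Icc 0 (2 * Real.pi)) τ := by
    intro U C δ S j hU hS τ
    have hm : ∀ τ, S * step j τ ∈ Icc (-δ) δ := fun τ =>
      ⟨by linarith [hS.1, hS.2, mul_nonneg hS.1 (step_nonneg j τ)],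
        (mul_le_of_le_one_right hS.1 (step_le_one j τ)).trans hS.2⟩
    rw [← smul_neg]
    exact (hU _ (hm τ)).comp (f := fun τ => S * step j τ)
      ((hasDerivAt_step j τ).const_mul S).hasDerivWithinAt fun t _ => hm t
  have fall : ∀ {U : ℝ → G} {C : ℝ → E k} {δ S : ℝ} (j : ℝ),
      (∀ u ∈ Icc (-δ) δ, HasLogDerivWithinAt U (-C u) (Icc (-δ) δ) u) → S ∈ Icc 0 δ →
      ∀ τ, HasLogDerivWithinAt (fun τ => U (S * (1 - step j τ)) * (U S)⁻¹)
        (-((-(S * deriv (step j) τ)) • C (S * (1 - step j τ)))) (Icc 0 (2 * Real.pi)) τ := by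
    intro U C δ S j hU hS τ
    have hm : ∀ τ, S * (1 - step j τ) ∈ Icc (-δ) δ := fun τ =>
      ⟨by linarith [hS.1, hS.2, mul_nonneg hS.1 (sub_nonneg.2 (step_le_one j τ))],
        (mul_le_of_le_one_right hS.1 (by linarith [step_nonneg j τ])).trans hS.2⟩
    rw [← smul_neg]
    have hd : HasDerivAt (fun τ => S * (1 - step j τ)) (-(S * deriv (step j) τ)) τ := by
      simpa using ((hasDerivAt_step j τ).const_sub 1).const_mul S
    exact ((hU _ (hm τ)).comp (f := fun τ => S * (1 - step j τ)) hd.hasDerivWithinAt fun t _ => hm t).mul_const _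
  -- One factor for each quarter of `[0, 2π]`, the latest on the left: first rise, second rise,
  -- first fall, second fall. Each factor is `1` before its quarter and at rest after it.
  have hW : IsWilsonLine (fun τ => deriv (pulse 0 S) τ • C₁ (pulse 0 S τ) +
      deriv (pulse 1 T) τ • C₂ (pulse 1 T τ)) fun τ =>
        (U₂ (T * (1 - step (1 + 2) τ)) * (U₂ T)⁻¹) * ((U₁ (S * (1 - step (0 + 2) τ)) * (U₁ S)⁻¹) *
          (U₂ (T * step 1 τ) * U₁ (S * step 0 τ))) := by
    rw [isWilsonLine_iff]
    refine ⟨?_, fun τ hτ => ?_⟩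
    · rw [step_eq_zero (j := 1 + 2) (by linarith), step_eq_zero (j := 0 + 2) (by linarith),
        step_eq_zero (j := 1) (by linarith), step_eq_zero (j := 0) (by linarith)]
      simp [h₁, h₂]
    · have e1 := (rise 1 hU₂ hT τ).mul_of_eq_one (rise 0 hU₁ hS τ) (by
        rcases le_total τ (1 * (Real.pi / 2)) with h | h
        · right; rw [step_eq_zero h, mul_zero, h₂]
        · left; rw [deriv_step_of_ge (j := 0) (by linarith)]; simp)
      have e2 := (fall (0 + 2) hU₁ hS τ).mul_of_eq_one e1 (by
        rcases le_total τ ((0 + 2) * (Real.pi / 2)) with h | h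
        · right; rw [step_eq_zero h, sub_zero, mul_one, mul_inv_cancel]
        · left
          rw [deriv_step_of_ge (j := 0) (by linarith), deriv_step_of_ge (j := 1) (by linarith)]
          simp)
      have e3 := (fall (1 + 2) hU₂ hT τ).mul_of_eq_one e2 (by
        rcases le_total τ ((1 + 2) * (Real.pi / 2)) with h | h
        · right; rw [step_eq_zero h, sub_zero, mul_one, mul_inv_cancel]
        · left
          rw [deriv_step_of_ge (j := 0) (by linarith), deriv_step_of_ge (j := 1) (by linarith),
            deriv_step_of_ge (j := 0 + 2) (by linarith)]
          simp)
      convert e3 using 1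
      rw [pulse_smul_eq, pulse_smul_eq]
      abel
  rw [holonomy_eq hW, step_eq_one (j := 1 + 2) (by linarith),
    step_eq_one (j := 0 + 2) (by linarith), step_eq_one (j := 1) (by linarith),
    step_eq_one (j := 0) (by linarith)]
  simp [h₁, h₂]

/-- The holonomy of two consecutive loops in lines is trivial. -/
theorem holonomy_consecutive {f g : ℝ → ℝ}
    (hU₁ : ∀ u ∈ Icc (-δ₁) δ₁, HasLogDerivWithinAt U₁ (-C₁ u) (Icc (-δ₁) δ₁) u)
    (hU₂ : ∀ u ∈ Icc (-δ₂) δ₂, HasLogDerivWithinAt U₂ (-C₂ u) (Icc (-δ₂) δ₂) u)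
    (h₁ : U₁ 0 = 1) (h₂ : U₂ 0 = 1) (hf : ContDiff ℝ ∞ f) (hg : ContDiff ℝ ∞ g)
    (hfm : ∀ τ, f τ ∈ Icc (-δ₁) δ₁) (hgm : ∀ τ, g τ ∈ Icc (-δ₂) δ₂)
    (hf0 : f 0 = 0) (hg0 : g 0 = 0) (hf1 : f (2 * Real.pi) = 0) (hg1 : g (2 * Real.pi) = 0)
    (hfg : ∀ τ ∈ Icc 0 (2 * Real.pi), deriv f τ = 0 ∨ g τ = 0) :
    (holonomy fun τ => deriv f τ • C₁ (f τ) + deriv g τ • C₂ (g τ) : G) = 1 := by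
  have hW : IsWilsonLine (fun τ => deriv f τ • C₁ (f τ) + deriv g τ • C₂ (g τ))
      fun τ => U₂ (g τ) * U₁ (f τ) := by
    rw [isWilsonLine_iff]
    refine ⟨by simp only [hf0, hg0, h₁, h₂, one_mul], fun τ hτ => ?_⟩
    have e1 := (hU₁ _ (hfm τ)).comp (s' := Icc 0 (2 * Real.pi))
      (hf.differentiable (by simp) τ).hasDerivAt.hasDerivWithinAt fun t _ => hfm t
    have e2 := (hU₂ _ (hgm τ)).comp (s' := Icc 0 (2 * Real.pi))
      (hg.differentiable (by simp) τ).hasDerivAt.hasDerivWithinAt fun t _ => hgm t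
    -- While the first blob moves, the second is at its start and contributes the factor `1`, so the
    -- simple product of the two lines is a solution.
    have e3 := e2.mul_of_eq_one e1 (by
      rcases hfg τ hτ with h | h
      · left; rw [h, zero_smul]
      · right; rw [h, h₂])
    convert e3 using 1
    rw [smul_neg, smul_neg]
    abel
  rw [holonomy_eq hW, hf1, hg1, h₁, h₂, one_mul]

end Wilson

/-! ### A reparametrization that delays the second blob -/

section Warp

variable {n : ℕ}

/-- The projective reparametrization of `[0, 2π]` fixing the endpoints, with parameter `r`. -/
def mobius (r τ : ℝ) : ℝ := 2 * Real.pi * τ / (τ + (2 * Real.pi - τ) * r)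

theorem mobius_denom_pos {r τ : ℝ} (hr : 0 < r) (hτ : τ ∈ Icc 0 (2 * Real.pi)) :
    0 < τ + (2 * Real.pi - τ) * r := by
  have hpi := two_pi_pos
  rcases hτ.1.eq_or_lt with h | h
  · rw [← h, zero_add, sub_zero]; positivity
  · have := mul_nonneg (sub_nonneg.2 hτ.2) hr.le
    linarith

theorem mobius_mem {r τ : ℝ} (hr : 0 < r) (hτ : τ ∈ Icc 0 (2 * Real.pi)) :
    mobius r τ ∈ Icc 0 (2 * Real.pi) := by
  have hd := mobius_denom_pos hr hτ
  have hpi := two_pi_pos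
  refine ⟨div_nonneg (mul_nonneg hpi.le hτ.1) hd.le, ?_⟩
  rw [mobius, div_le_iff₀ hd]
  exact mul_le_mul_of_nonneg_left (by linarith [mul_nonneg (sub_nonneg.2 hτ.2) hr.le]) hpi.le

theorem mobius_one {τ : ℝ} : mobius 1 τ = τ := by
  have := two_pi_pos
  rw [mobius]; field_simp; ring

theorem mobius_zero_right {r : ℝ} : mobius r 0 = 0 := by simp [mobius]

theorem mobius_two_pi {r : ℝ} : mobius r (2 * Real.pi) = 2 * Real.pi := by
  have := two_pi_pos
  rw [mobius, sub_self, zero_mul, add_zero]; field_simp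

theorem mobius_inv_mobius {r τ : ℝ} (hr : 0 < r) (hτ : τ ∈ Icc 0 (2 * Real.pi)) :
    mobius r⁻¹ (mobius r τ) = τ := by
  have hd := mobius_denom_pos hr hτ
  have hpi := Real.pi_pos
  have h1 : mobius r τ + (2 * Real.pi - mobius r τ) * r⁻¹ =
      4 * Real.pi ^ 2 / (τ + (2 * Real.pi - τ) * r) := by
    rw [mobius]; field_simp; ring
  rw [mobius, h1, mobius]
  field_simp
  ring

/-- The parameter `9` is the one that sends `3π/2` exactly to `π/2`. A pulse starting at `π/2` is
thus delayed until `3π/2`, when the first pulse has ended. -/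
theorem mobius_nine_le {τ : ℝ} (h0 : 0 ≤ τ) (h : τ ≤ 3 * Real.pi / 2) :
    mobius 9 τ ≤ Real.pi / 2 := by
  have hpi := Real.pi_pos
  have hd := mobius_denom_pos (r := 9) (by norm_num) (⟨h0, by linarith⟩ : τ ∈ Icc 0 (2 * Real.pi))
  rw [mobius, div_le_iff₀ hd]
  nlinarith

/-- The reparametrization of the time coordinate by `mobius`, with a space dependent parameter. -/
def warp (ρ : (Fin n → ℝ) → ℝ) (z : (Fin n → ℝ) × ℝ) : (Fin n → ℝ) × ℝ :=
  (z.1, mobius (ρ z.1) z.2)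

/-- The inverse of the projective map with parameter `ρ` has parameter `ρ⁻¹`, so it is again smooth
in `(σ, τ)`. The faces `τ = 0` and `τ = 2π` are fixed always, the lateral faces because `ρ = 1`
gives the identity. -/
theorem isCubeDiffeo_warp {ρ : (Fin n → ℝ) → ℝ} (hρ : ContDiff ℝ ∞ ρ) (hpos : ∀ σ, 0 < ρ σ)
    (hfr : ∀ σ ∈ frontier (cube n), ρ σ = 1) : IsCubeDiffeo n (warp ρ) := by
  have hs : ∀ {ρ : (Fin n → ℝ) → ℝ}, ContDiff ℝ ∞ ρ → (∀ σ, 0 < ρ σ) →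
      ContDiffOn ℝ ∞ (warp ρ) (cubeTime n) := fun {ρ} hρ hpos => by
    refine contDiffOn_fst.prodMk (ContDiffOn.div ?_ ?_ fun z hz =>
      (mobius_denom_pos (hpos z.1) hz.2).ne')
    · exact (contDiff_const.mul contDiff_snd).contDiffOn
    · exact (contDiff_snd.add ((contDiff_const.sub contDiff_snd).mul
        (hρ.comp contDiff_fst))).contDiffOn
  have hm : ∀ {ρ : (Fin n → ℝ) → ℝ}, (∀ σ, 0 < ρ σ) → MapsTo (warp ρ) (cubeTime n) (cubeTime n) :=
    fun hpos z hz => ⟨hz.1, mobius_mem (hpos z.1) hz.2⟩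
  have hpos' : ∀ σ, 0 < (ρ σ)⁻¹ := fun σ => inv_pos.2 (hpos σ)
  refine ⟨hs hρ hpos, hm hpos, ⟨warp fun σ => (ρ σ)⁻¹,
    hs (hρ.inv fun σ => (hpos σ).ne') hpos', hm hpos', fun z hz => ?_, fun z hz => ?_⟩,
    fun z hz => ?_⟩
  · exact Prod.ext rfl (mobius_inv_mobius (hpos z.1) hz.2)
  · have := mobius_inv_mobius (hpos' z.1) hz.2
    rw [inv_inv] at this
    exact Prod.ext rfl this
  · rw [cubeTime, frontier_prod_eq, frontier_Icc two_pi_pos.le] at hz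
    refine Prod.ext rfl ?_
    change mobius (ρ z.1) z.2 = z.2
    rcases hz with h | h
    · rcases h.2 with h | h
      · rw [h, mobius_zero_right]
      · rw [h, mobius_two_pi]
    · rw [hfr _ h.1, mobius_one]

/-- The warp factor, equal to `9` near the high centre and to `1` away from it. -/
def warpFactor (i₀ : Fin n) (u : ℝ) (σ : Fin n → ℝ) : ℝ :=
  1 + 8 * u * (⟨1, 3 / 2, by norm_num, by norm_num⟩ : ContDiffBump (highCenter i₀)) σ

theorem contDiff_warpFactor (i₀ : Fin n) :
    ContDiff ℝ ∞ fun z : ℝ × (Fin n → ℝ) => warpFactor i₀ z.1 z.2 := by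
  unfold warpFactor
  exact contDiff_const.add ((contDiff_const.mul contDiff_fst).mul
    ((ContDiffBump.contDiff (n := ⊤) _).comp contDiff_snd))

theorem warpFactor_pos (i₀ : Fin n) {u : ℝ} (hu : 0 ≤ u) (σ : Fin n → ℝ) :
    0 < warpFactor i₀ u σ := by
  unfold warpFactor
  have := mul_nonneg (mul_nonneg (by norm_num : (0 : ℝ) ≤ 8) hu)
    (ContDiffBump.nonneg (⟨1, 3 / 2, by norm_num, by norm_num⟩ : ContDiffBump (highCenter i₀))
      (x := σ))
  linarith

theorem warpFactor_eq_one {i₀ : Fin n} {u : ℝ} {σ : Fin n → ℝ}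
    (h : 3 / 2 ≤ dist σ (highCenter i₀)) : warpFactor i₀ u σ = 1 := by
  rw [warpFactor, ContDiffBump.zero_of_le_dist _ h, mul_zero, add_zero]

theorem warpFactor_eq_nine {i₀ : Fin n} {σ : Fin n → ℝ} (h : dist σ (highCenter i₀) ≤ 1) :
    warpFactor i₀ 1 σ = 9 := by
  rw [warpFactor, ContDiffBump.one_of_mem_closedBall _ h]
  norm_num

theorem isReparametrization_warp (i₀ : Fin n) :
    IsReparametrization n (warp (warpFactor i₀ 1)) := by
  -- The isotopy lets the warp factor grow linearly from `1` to its final value; it stays positive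
  -- on the way.
  refine ⟨fun u => warp (warpFactor i₀ u), ?_, fun u hu => ?_, fun z _ => ?_, fun z _ => rfl⟩
  · have h1 : ContDiff ℝ ∞ fun z : ℝ × ((Fin n → ℝ) × ℝ) => warpFactor i₀ z.1 z.2.1 :=
      (contDiff_warpFactor i₀).comp (contDiff_fst.prodMk (contDiff_fst.comp contDiff_snd))
    have h2 : ContDiff ℝ ∞ fun z : ℝ × ((Fin n → ℝ) × ℝ) => z.2.2 :=
      contDiff_snd.comp contDiff_snd
    refine ((contDiff_fst.comp contDiff_snd).contDiffOn).prodMk (ContDiffOn.div ?_ ?_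
      fun z hz => (mobius_denom_pos (warpFactor_pos i₀ hz.1.1 z.2.1) hz.2.2).ne')
    · exact (contDiff_const.mul h2).contDiffOn
    · exact (h2.add ((contDiff_const.sub h2).mul h1)).contDiffOn
  · refine isCubeDiffeo_warp ((contDiff_warpFactor i₀).comp (contDiff_const.prodMk contDiff_id))
      (warpFactor_pos i₀ hu.1) fun σ hσ => warpFactor_eq_one ?_
    by_contra hlt
    exact hσ.2 (mem_interior_cube_of_dist_lt (highCenter_bounds i₀) (not_le.1 hlt))
  · refine Prod.ext rfl ?_
    change mobius (warpFactor i₀ 0 z.1) z.2 = z.2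
    rw [show warpFactor i₀ 0 z.1 = 1 by simp [warpFactor], mobius_one]

/-- A smooth function on the line that agrees with `mobius 9` on `[0, 2π]`. -/
theorem exists_contDiff_eq_mobius :
    ∃ μ : ℝ → ℝ, ContDiff ℝ ∞ μ ∧ ∀ τ ∈ Icc 0 (2 * Real.pi), μ τ = mobius 9 τ := by
  have hpi := Real.pi_pos
  -- The denominator `18π - 8τ` vanishes at `9π/4`, beyond `17π/8`, where the bump has ended.
  -- Interpolating it with `1` by means of `κ` keeps it positive on the whole line.
  let κ : ContDiffBump Real.pi := ⟨Real.pi, 9 * Real.pi / 8, hpi, by linarith⟩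
  have hpos : ∀ τ, 0 < 1 + κ τ * (τ + (2 * Real.pi - τ) * 9 - 1) := by
    intro τ
    by_cases h : dist τ Real.pi < 9 * Real.pi / 8
    · rw [Real.dist_eq, abs_lt] at h
      have h1 : 0 < τ + (2 * Real.pi - τ) * 9 := by linarith
      have h2 : 0 ≤ κ τ := κ.nonneg
      have h3 : κ τ ≤ 1 := κ.le_one
      rcases h2.eq_or_lt with h4 | h4
      · rw [← h4]; norm_num
      · have := mul_pos h4 h1
        linarith
    · have h1 : κ τ = 0 := κ.zero_of_le_dist (not_lt.1 h)
      rw [h1]; norm_num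
  refine ⟨fun τ => 2 * Real.pi * τ / (1 + κ τ * (τ + (2 * Real.pi - τ) * 9 - 1)), ?_,
    fun τ hτ => ?_⟩
  · refine ContDiff.div (contDiff_const.mul contDiff_id) ?_ fun τ => (hpos τ).ne'
    exact contDiff_const.add ((κ.contDiff (n := ⊤)).mul ((contDiff_id.add
      ((contDiff_const.sub contDiff_id).mul contDiff_const)).sub contDiff_const))
  · have h1 : κ τ = 1 := κ.one_of_mem_closedBall (by
      rw [Metric.mem_closedBall, Real.dist_eq, abs_le]
      change -Real.pi ≤ τ - Real.pi ∧ τ - Real.pi ≤ Real.pi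
      constructor <;> linarith [hτ.1, hτ.2])
    simp only [h1, one_mul, mobius]
    congr 1
    ring

end Warp

/-! ### Invariance of the holonomy implies commuting sweeps -/

section Final

variable {m k n : ℕ}
  {M : Type*} [TopologicalSpace M] [ChartedSpace (E m) M] [IsManifold (𝓡 m) ∞ M]
  {G : Type*} [TopologicalSpace G] [ChartedSpace (E k) G] [Group G] [LieGroup (𝓡 k) ∞ G]
  {P : Type*} [TopologicalSpace P] [ChartedSpace (ModelProd (E m) (E k)) P]
  [IsManifold ((𝓡 m).prod (𝓡 k)) ∞ P] [MulAction Gᵐᵒᵖ P]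
  {proj : P → M} {A : Connection m k G P} {s : M → P} {B : AdForm m k G proj (n + 1)} {p₀ : P}
  {i₀ : Fin n} {β₁ β₂ : (Fin n → ℝ) × ℝ → M} {x₀ : M}

/-- Where the low blob is not constant the warp is the identity, and where the high blob is not
constant the factor is exactly `9`. The transition region of the warp factor is invisible because
the glued map is `x₀` there. -/
theorem glue_warp_eq (h₁ : IsBlob m x₀ (lowCenter i₀) β₁)
    (h₂ : IsBlob m x₀ (highCenter i₀) β₂) {f g μ : ℝ → ℝ}
    (hμ : ∀ τ ∈ Icc 0 (2 * Real.pi), μ τ = mobius 9 τ) {z : (Fin n → ℝ) × ℝ}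
    (hz : z ∈ cubeTime n) :
    glue i₀ β₁ β₂ f g (warp (warpFactor i₀ 1) z) = glue i₀ β₁ β₂ f (fun τ => g (μ τ)) z := by
  have hpi := Real.pi_gt_three
  change (if z.1 i₀ < Real.pi then β₁ (z.1, f (mobius (warpFactor i₀ 1 z.1) z.2))
      else β₂ (z.1, g (mobius (warpFactor i₀ 1 z.1) z.2))) =
    if z.1 i₀ < Real.pi then β₁ (z.1, f z.2) else β₂ (z.1, g (μ z.2))
  by_cases h : z.1 i₀ < Real.pi
  · rw [if_pos h, if_pos h]
    by_cases hd : 3 / 2 ≤ dist z.1 (highCenter i₀)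
    · rw [warpFactor_eq_one hd, mobius_one]
    · have h3 : ¬ z.1 i₀ ≤ 3 * Real.pi / 2 - 3 / 2 := fun h4 => hd (le_dist_highCenter h4)
      have h5 : Real.pi - 1 / 2 ≤ z.1 i₀ := by linarith
      rw [h₁.eq_of_le h5, h₁.eq_of_le h5]
  · rw [if_neg h, if_neg h]
    by_cases hd : dist z.1 (highCenter i₀) ≤ 1
    · rw [warpFactor_eq_nine hd, hμ _ hz.2]
    · have h4 : 7 / 8 ≤ dist z.1 (highCenter i₀) := by linarith
      rw [h₂.eq_of_dist _ h4, h₂.eq_of_dist _ h4]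

theorem density_congr {Γ Γ' : (Fin n → ℝ) × ℝ → M} (h : EqOn Γ Γ' (cubeTime n))
    {z : (Fin n → ℝ) × ℝ} (hz : z ∈ cubeTime n) : density B s Γ z = density B s Γ' z := by
  rw [density, density, B.pull_congr s (h.eventuallyEq_of_mem self_mem_nhdsWithin) (h hz)]

/-- Interleaved pulses of the two blobs have a group commutator as holonomy; the warped loop has the
same holonomy by r-flatness, but its pulses are consecutive, so the commutator is `1`. This holds
for all small amplitudes `S` and `T`, and the bracket of the initial velocities vanishes. -/
theorem IsRFlat.bracketL_sweep [PreconnectedSpace M] (hP : IsPrincipalBundle m k G proj)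
    (hs : IsHorizontalSection A proj univ s) (h0 : s (proj p₀) = p₀)
    (h : IsRFlat A B p₀) (h₁ : IsBlob m (proj p₀) (lowCenter i₀) β₁)
    (h₂ : IsBlob m (proj p₀) (highCenter i₀) β₂) :
    bracketL G (sweep B s β₁ 0) (sweep B s β₂ 0) = 0 := by
  have hpi := Real.pi_pos
  obtain ⟨δ₁, hδ₁, U₁, hU₁0, hU₁⟩ := exists_hasLogDerivWithinAt (G := G)
    (continuous_sweep (B := B) hP hs h₁.smooth).neg
  obtain ⟨δ₂, hδ₂, U₂, hU₂0, hU₂⟩ := exists_hasLogDerivWithinAt (G := G)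
    (continuous_sweep (B := B) hP hs h₂.smooth).neg
  obtain ⟨μ, hμs, hμ⟩ := exists_contDiff_eq_mobius
  have hol : ∀ {Γ : (Fin n → ℝ) × ℝ → M} {f g : ℝ → ℝ}, ContDiff ℝ ∞ f → ContDiff ℝ ∞ g →
      ContMDiffOn 𝓘(ℝ, (Fin n → ℝ) × ℝ) (𝓡 m) ∞ Γ (cubeTime n) →
      EqOn Γ (glue i₀ β₁ β₂ f g) (cubeTime n) → loopHolonomy A B p₀ Γ =
        holonomy fun τ => deriv f τ • sweep B s β₁ (f τ) + deriv g τ • sweep B s β₂ (g τ) := by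
    intro Γ f g hf hg hΓ heq
    refine holonomy_congr fun τ hτ => ?_
    refine (loopConnection_velocity_eq hP hs h0 hΓ hτ).trans ?_
    rw [← integral_density_glue hP hs h₁ h₂ hf hg hτ]
    exact setIntegral_congr_fun (isCompact_cube n).measurableSet fun σ hσ =>
      density_congr heq (mk_mem_cubeTime hσ hτ)
  have hcomm : ∀ S ∈ Icc 0 δ₁, ∀ T ∈ Icc 0 δ₂, U₁ S * U₂ T = U₂ T * U₁ S := by
    intro S hS T hT
    have hf := contDiff_pulse 0 S
    have hg := contDiff_pulse 1 T
    have hgμ : ContDiff ℝ ∞ fun τ => pulse 1 T (μ τ) := hg.comp hμs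
    have hΓ : ContMDiffOn 𝓘(ℝ, (Fin n → ℝ) × ℝ) (𝓡 m) ∞
        (glue i₀ β₁ β₂ (pulse 0 S) (pulse 1 T)) (cubeTime n) :=
      (contMDiff_glue h₁ h₂ hf hg).contMDiffOn
    have hz : ∀ j S : ℝ, 0 ≤ j → j ≤ 1 → pulse j S 0 = 0 ∧ pulse j S (2 * Real.pi) = 0 :=
      fun j S hj hj1 => ⟨pulse_eq_zero_of_le (by positivity), pulse_eq_zero_of_ge (by nlinarith)⟩
    have hloop : IsLoopOfNLoops m n (proj p₀) (glue i₀ β₁ β₂ (pulse 0 S) (pulse 1 T)) := by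
      refine ⟨hΓ, fun σ hσ τ _ => glue_eq_of_mem_frontier h₁ h₂ hσ τ, fun σ _ => ?_⟩
      simp only [glue]
      rw [(hz 0 S le_rfl zero_le_one).1, (hz 0 S le_rfl zero_le_one).2,
        (hz 1 T zero_le_one le_rfl).1, (hz 1 T zero_le_one le_rfl).2]
    have hj := isReparametrization_warp i₀
    have e1 := h _ hloop _ hj
    rw [hol hf hg hΓ fun _ _ => rfl, hol hf hgμ (hj.contMDiffOn_comp hΓ)
      fun z hz => glue_warp_eq h₁ h₂ hμ hz] at e1
    rw [holonomy_interleaved hU₁ hU₂ hU₁0 hU₂0 hS hT,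
      holonomy_consecutive hU₁ hU₂ hU₁0 hU₂0 hf hgμ (pulse_mem hS 0)
        (fun τ => pulse_mem hT 1 (μ τ)) (hz 0 S le_rfl zero_le_one).1
        (by rw [hμ 0 ⟨le_rfl, two_pi_pos.le⟩, mobius_zero_right, (hz 1 T zero_le_one le_rfl).1])
        (hz 0 S le_rfl zero_le_one).2
        (by rw [hμ _ ⟨two_pi_pos.le, le_rfl⟩, mobius_two_pi, (hz 1 T zero_le_one le_rfl).2])
        (fun τ hτ => by
          -- Up to `3π/2` the delayed second pulse has not begun; from then on the first pulse is
          -- over.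
          rcases le_total τ (3 * Real.pi / 2) with h3 | h3
          · right
            rw [hμ τ hτ]
            exact pulse_eq_zero_of_le (by linarith [mobius_nine_le hτ.1 h3])
          · left
            rw [(hasDerivAt_pulse 0 S τ).deriv, deriv_step_of_ge (by linarith),
              deriv_step_of_ge (by linarith)]
            simp)] at e1
    have e2 : U₂ T * U₁ S = U₁ S * U₂ T := by
      have e3 := congrArg (fun x => U₁ S * (U₂ T * x)) e1
      simpa using e3.symm
    exact e2.symm
  have hmono : ∀ {U : ℝ → G} {C : E k} {δ : ℝ}, 0 < δ →
      HasLogDerivWithinAt U C (Icc (-δ) δ) 0 → HasLogDerivWithinAt U C (Icc 0 δ) 0 :=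
    fun hδ h => h.mono (Icc_subset_Icc_left (by linarith))
  have hbr := bracketL_eq_zero_of_commute hδ₁ hδ₂
    (hmono hδ₁ (hU₁ 0 ⟨by linarith, hδ₁.le⟩)) (hmono hδ₂ (hU₂ 0 ⟨by linarith, hδ₂.le⟩))
    hU₁0 hU₂0 hcomm
  simpa using hbr

end Final

end LoopSpace

end

theorem mainTheorem4 {m k n : ℕ} (hn : 1 ≤ n)
    {M : Type*} [TopologicalSpace M] [T2Space M] [SecondCountableTopology M]
    [ChartedSpace (LoopSpace.E m) M] [IsManifold (𝓡 m) ∞ M] [SimplyConnectedSpace M]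
    {G : Type*} [TopologicalSpace G] [ChartedSpace (LoopSpace.E k) G] [Group G]
    [LieGroup (𝓡 k) ∞ G] [ConnectedSpace G]
    {P : Type*} [TopologicalSpace P] [ChartedSpace (ModelProd (LoopSpace.E m) (LoopSpace.E k)) P]
    [IsManifold ((𝓡 m).prod (𝓡 k)) ∞ P] [MulAction Gᵐᵒᵖ P]
    (proj : P → M) (hP : LoopSpace.IsPrincipalBundle m k G proj)
    (A : LoopSpace.Connection m k G P) (hA : A.IsFlat)
    (B : LoopSpace.AdForm m k G proj (n + 1)) (p₀ : P) :
    (LoopSpace.IsCurvatureLocal A B p₀ ↔ LoopSpace.IsRFlat A B p₀) ∧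
    (LoopSpace.IsCurvatureLocal A B p₀ ↔ LoopSpace.CommutesAlongLoops A B p₀) ∧
    (LoopSpace.IsCurvatureLocal A B p₀ ↔ LoopSpace.ComponentsCommute A B p₀) ∧
    (LoopSpace.IsRFlat A B p₀ ↔ LoopSpace.ComponentsCommute A B p₀) := by
  obtain ⟨s, hs, h0⟩ := LoopSpace.Connection.exists_global_horizontalSection hP hA p₀
  -- A direction of the cube along which the two blobs can be separated; this is where `1 ≤ n`
  -- enters.
  let i₀ : Fin n := ⟨0, hn⟩
  have hcl : LoopSpace.IsCurvatureLocal A B p₀ ↔ LoopSpace.ComponentsCommute A B p₀ :=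
    ⟨fun h => (LoopSpace.componentsCommute_iff hP hs h0).2
      (LoopSpace.components_commute_of_sweep hP hs i₀ (proj p₀) fun _ _ h₁ h₂ =>
        h.bracketL_sweep hP hs h0 h₁ h₂), fun h => h.isCurvatureLocal hP hs h0⟩
  have hrf : LoopSpace.IsRFlat A B p₀ ↔ LoopSpace.ComponentsCommute A B p₀ :=
    ⟨fun h => (LoopSpace.componentsCommute_iff hP hs h0).2
      (LoopSpace.components_commute_of_sweep hP hs i₀ (proj p₀) fun _ _ h₁ h₂ =>
        h.bracketL_sweep hP hs h0 h₁ h₂), fun h => h.isRFlat hP hs h0⟩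
  have hcal : LoopSpace.CommutesAlongLoops A B p₀ ↔ LoopSpace.ComponentsCommute A B p₀ :=
    ⟨fun h => (LoopSpace.componentsCommute_iff hP hs h0).2
      (LoopSpace.components_commute_of_sweep hP hs i₀ (proj p₀) fun _ _ h₁ h₂ =>
        h.bracketL_sweep hP hs h0 h₁ h₂), fun h => h.commutesAlongLoops⟩
  exact ⟨hcl.trans hrf.symm, hcl.trans hcal.symm, hcl, hrf⟩
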